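/- Throughout, $G$ is a fixed discrete group. An \emph{algebra} $(A,\alpha)$ is a discrete, not necessarily unital algebra over $\mathbb C$ with an action $\alpha$ of $G$ by algebra automorphisms; algebra homomorphisms are $G$-equivariant. An \emph{approximate unit} of $A$ is a net $(x_i)_{i\in I}$ in $A$ such that for every $a\in A$ there is $j\in I$ with $x_ia=ax_i=a$ for all $i\ge j$. A \emph{functional $A$-module} $(\mathcal E,S,\Theta_A(\mathcal E))$ is a complex vector space $\mathcal E$ with a right $A$-module structure, a $G$-action $S$ with $S_g(\xi a)=S_g(\xi)\alpha_g(a)$, and a $G$-invariant left $A$-submodule $\Theta_A(\mathcal E)\subseteq \mathrm{Hom}_A(\mathcal E,A)$, where $(a\phi)(\xi)=a\phi(\xi)$ and $g(\phi)=\alpha_g\circ\phi\circ S_{g^{-1}}$. It is \emph{cofull} if every element of $\mathcal E$ is a finite sum of elements $\xi\phi(\eta)$, and $\Theta_A(\mathcal E)$ is \emph{cofull} if each of its elements is a finite sum of functionals $\phi(\xi)\tau$, with $\xi,\eta\in\mathcal E$, $\phi,\tau\in\Theta_A(\mathcal E)$. $\mathcal K_A(\mathcal E)$ is the algebra of finite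 sums of the operators $\theta_{\eta,\phi}(\xi)=\eta\phi(\xi)$ on $\mathcal E$, with $G$-action $T\mapsto S_gTS_{g^{-1}}$. For a set $n$, $A^n=\bigoplus_{i\in n}A$ carries the functionals $\xi\mapsto\sum_i b_i\xi_i$ with $b\in A^n$. For a linear $G$-action $\mu$ on $\mathbb C^n$ (finitely supported functions) leaving the space of finitely supported row functionals invariant, $(A\otimes\mathbb C^n,\alpha\otimes\mu)$ is called a plain module $A^n$. A \emph{functional extension} $\mathcal E\to\mathcal F$ is a pair $(U,U^*)$ consisting of an injective $G$-equivariant $A$-module homomorphism $U:\mathcal E\to\mathcal F$ and a $G$-equivariant left $A$-module homomorphism $U^*:\Theta_A(\mathcal E)\to\Theta_A(\mathcal F)$ such that $U^*(\phi)(U\xi)=\phi(\xi)$ for all $\phi,\xi$, and such that for all $\phi_1,\dots,\phi_k\in\Theta_A(\mathcal E)$ and $\eta\in\mathcal F$ there is $\xi\in\mathcal E$ with $U^*(\phi_i)(\eta)=\phi_i(\xi)$ for all $i$. Let $C$ be the class of all functional modules $\mathcal E$ over algebras $A$ with approximate units such that $\mathcal E$ and $\Theta_A(\mathcal E)$ are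 cofull, $\mathcal K_A(\mathcal E)$ has an approximate unit, and $\mathcal E$ has a functional extension into some plain module $(A\otimes\mathbb C^n,\alpha\otimes\mu)$, $n$ of any cardinality. \textbf{Theorem.} Let $A$, $B$ denote algebras with approximate units. \begin{enumerate} \item $C$ contains all plain modules $(A\otimes\mathbb C^n,\alpha\otimes\mu)$, $n$ of any cardinality. \item If $G$ is finite, $C$ contains all $(A^n,\gamma)$ with an arbitrary $G$-action $\gamma$ for which $A^n$ with its standard functionals is a functional $(A,\alpha)$-module. \item If $\mathcal E_i\in C$ ($i\in I$, $I$ any set) are $A$-modules, then $\bigoplus_{i\in I}\mathcal E_i\in C$, with the functional space $\bigoplus_{i\in I}\Theta_A(\mathcal E_i)$. \item If $\mathcal E\in C$ is an $A$-module and $\pi:A\to B$ is an algebra homomorphism, then $C$ contains the $B$-module $\mathcal E\otimes_\pi B=\mathcal E\otimes B/\mathrm{span}\{\xi a\otimes b-\xi\otimes\pi(a)b\}$ with action $S\otimes\beta$ ($\beta$ the action on $B$) and functional space spanned by $(\phi\otimes c)(\xi\otimes b)=c\,\pi(\phi(\xi))\,b$, $\phi\in\Theta_A(\mathcal E)$,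 $c\in B$. \item If $\mathcal E\in C$ is an $A$-module and $\mathcal G\in C$ is a $B$-module, then the external tensor product $\mathcal E\otimes\mathcal G$, an $A\otimes B$-module with diagonal action and functional space spanned by the $\phi\otimes\psi$, is in $C$. \item Let $\mathcal E\in C$ be an $A$-module, $K=\mathcal K_A(\mathcal E\oplus A)$ (with $A$ having the functionals given by left multiplication by elements of $A$), and let $\mathcal F\in C$ be a $K$-module. Let $M_A=\{m_a: a\in A\}\subseteq K$ with $m_a(\xi\oplus b)=0\oplus ab$, so that $A\cong M_A$. Then $\mathcal F\cdot M_A$, an $A$-module via $A\cong M_A$ with the restricted action and with functional space $\{m_b\,\phi|_{\mathcal F\cdot M_A}: b\in A,\ \phi\in\Theta_K(\mathcal F)\}$, whose values lie in $M_A\cong A$, is in $C$. \end{enumerate} -/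

import Mathlib

open scoped TensorProduct

universe u v

/-- A (discrete, not necessarily unital) algebra over `ℂ` with a `G`-action by algebra
automorphisms. -/
structure GAlgebra (G : Type v) [Group G] where
  carrier : Type u
  [ring : NonUnitalRing carrier]
  [module : Module ℂ carrier]
  [tower : IsScalarTower ℂ carrier carrier]
  [comm : SMulCommClass ℂ carrier carrier]
  act : Representation ℂ G carrier
  act_mul : ∀ g a b, act g (a * b) = act g a * act g b

namespace GAlgebra

instance (G : Type v) [Group G] : CoeSort (GAlgebra.{u, v} G) (Type u) := ⟨GAlgebra.carrier⟩

attribute [instance] GAlgebra.ring GAlgebra.module GAlgebra.tower GAlgebra.comm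

variable {G : Type v} [Group G]

/-- A two-sided approximate unit of a discrete algebra: a net which is eventually a unit for each
element. -/
def HasApproxUnit (A : GAlgebra.{u, v} G) : Prop :=
  ∃ (I : Type u) (_ : Preorder I) (_ : IsDirected I (· ≤ ·)) (_ : Nonempty I) (x : I → A),
    ∀ a : A, ∃ j, ∀ i, j ≤ i → x i * a = a ∧ a * x i = a

theorem HasApproxUnit.exists_unit {A : GAlgebra.{u, v} G} (h : A.HasApproxUnit) (a b : A) :
    ∃ e : A, (e * a = a ∧ a * e = a) ∧ (e * b = b ∧ b * e = b) := by
  obtain ⟨I, _, _, _, x, hx⟩ := h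
  obtain ⟨j, hj⟩ := hx a
  obtain ⟨k, hk⟩ := hx b
  obtain ⟨l, h1, h2⟩ := exists_ge_ge j k
  exact ⟨x l, hj l h1, hk l h2⟩

/-- A local unit for all coordinates of a finitely supported family. -/
theorem HasApproxUnit.exists_unit_finsupp {A : GAlgebra.{u, v} G} (h : A.HasApproxUnit)
    {n : Type u} (ξ : n →₀ A) : ∃ e : A, ∀ i, ξ i * e = ξ i := by
  classical
  obtain ⟨I, _, _, _, x, hx⟩ := h
  choose j hj using hx
  obtain ⟨M, hM⟩ := (ξ.support.image (fun i => j (ξ i))).exists_le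
  refine ⟨x M, fun i => ?_⟩
  by_cases hi : ξ i = 0
  · simp [hi]
  · exact (hj (ξ i) M (hM _ (Finset.mem_image_of_mem _ (Finsupp.mem_support_iff.2 hi)))).2

/-- A `G`-equivariant algebra homomorphism. -/
structure Hom (A B : GAlgebra.{u, v} G) where
  toFun : A →ₙₐ[ℂ] B
  map_act : ∀ g a, toFun (A.act g a) = B.act g (toFun a)

/-- The algebra `A ⊗ B` with the diagonal `G`-action. -/
noncomputable def tensor (A B : GAlgebra.{u, v} G) : GAlgebra.{u, v} G where
  carrier := A ⊗[ℂ] B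
  act := A.act.tprod B.act
  act_mul g x y := by
    induction x with
    | zero => simp
    | add x₁ x₂ h₁ h₂ => simp only [add_mul, map_add, h₁, h₂]
    | tmul a b =>
      induction y with
      | zero => simp
      | add x₁ x₂ h₁ h₂ => simp only [mul_add, map_add, h₁, h₂]
      | tmul c d => simp [Representation.tprod, A.act_mul, B.act_mul]

end GAlgebra

/-- A right functional `A`-module: a complex vector space with a right multiplication by the
`G`-algebra `A`, a compatible `G`-action, and a distinguished space of right `A`-linear maps into
`A` which is a `G`-invariant left `A`-submodule. (If every element is a sum of products `ξ a`, then
additive `A`-linear maps and additive `G`-actions are automatically complex linear.) -/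
structure FunctionalModule {G : Type v} [Group G] (A : GAlgebra.{u, v} G) where
  carrier : Type u
  [addCommGroup : AddCommGroup carrier]
  [module : Module ℂ carrier]
  /-- The right multiplication `(ξ, a) ↦ ξ a`. -/
  rmul : carrier →ₗ[ℂ] A →ₗ[ℂ] carrier
  rmul_mul : ∀ ξ a b, rmul ξ (a * b) = rmul (rmul ξ a) b
  act : Representation ℂ G carrier
  act_rmul : ∀ g ξ a, act g (rmul ξ a) = rmul (act g ξ) (A.act g a)
  /-- The functional space `Θ_A`. -/
  functionals : Submodule ℂ (carrier →ₗ[ℂ] A)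
  functional_rmul : ∀ φ ∈ functionals, ∀ ξ a, φ (rmul ξ a) = φ ξ * a
  lmul_mem : ∀ a : A, ∀ φ ∈ functionals, LinearMap.mulLeft ℂ a ∘ₗ φ ∈ functionals
  act_mem : ∀ g, ∀ φ ∈ functionals, A.act g ∘ₗ φ ∘ₗ act g⁻¹ ∈ functionals

namespace FunctionalModule

variable {G : Type v} [Group G]

attribute [instance] FunctionalModule.addCommGroup FunctionalModule.module

instance (A : GAlgebra.{u, v} G) : CoeSort (FunctionalModule A) (Type u) :=
  ⟨FunctionalModule.carrier⟩

variable {A : GAlgebra.{u, v} G}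

/-- The left multiplication on the functional space, `(a φ)(ξ) = a φ(ξ)`. -/
noncomputable def lmul (E : FunctionalModule A) (a : A) (φ : E.functionals) : E.functionals :=
  ⟨LinearMap.mulLeft ℂ a ∘ₗ φ.1, E.lmul_mem a φ.1 φ.2⟩

/-- The `G`-action on the functional space, `g(φ) = α_g ∘ φ ∘ S_{g⁻¹}`. -/
def dualAct (E : FunctionalModule A) (g : G) (φ : E.functionals) : E.functionals :=
  ⟨A.act g ∘ₗ φ.1 ∘ₗ E.act g⁻¹, E.act_mem g φ.1 φ.2⟩

/-- Every element is a finite sum of elements `ξ φ(η)`. -/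
def Cofull (E : FunctionalModule A) : Prop :=
  ∀ ζ : E, ζ ∈ AddSubmonoid.closure
    {x : E | ∃ ξ : E, ∃ φ : E.functionals, ∃ η : E, x = E.rmul ξ (φ.1 η)}

/-- Every functional is a finite sum of functionals `φ(ξ) τ`. -/
def DualCofull (E : FunctionalModule A) : Prop :=
  ∀ ψ : E.functionals, ψ ∈ AddSubmonoid.closure
    {x : E.functionals | ∃ φ : E.functionals, ∃ ξ : E, ∃ τ : E.functionals,
      x = E.lmul (φ.1 ξ) τ}

/-- The elementary compact operator `ξ ↦ η φ(ξ)`. -/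
def theta (E : FunctionalModule A) (η : E) (φ : E →ₗ[ℂ] A) : Module.End ℂ E := E.rmul η ∘ₗ φ

theorem theta_mul (E : FunctionalModule A) (η η' : E) (φ φ' : E →ₗ[ℂ] A)
    (hφ : φ ∈ E.functionals) :
    E.theta η φ * E.theta η' φ' = E.theta (E.rmul η (φ η')) φ' := by
  ext ξ
  simp [theta, E.functional_rmul φ hφ, E.rmul_mul]

/-- The finite sums of elementary compact operators, as a subalgebra of the endomorphisms. -/
def compactSubalgebra (E : FunctionalModule A) : NonUnitalSubalgebra ℂ (Module.End ℂ E) where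
  __ := Submodule.span ℂ {T | ∃ η : E, ∃ φ ∈ E.functionals, T = E.theta η φ}
  mul_mem' {S T} hS hT := by
    change S * T ∈ Submodule.span ℂ _
    induction hS using Submodule.span_induction with
    | zero => simp
    | add _ _ _ _ h₁ h₂ => rw [add_mul]; exact Submodule.add_mem _ h₁ h₂
    | smul c _ _ h => rw [smul_mul_assoc]; exact Submodule.smul_mem _ c h
    | mem _ hS =>
      obtain ⟨η, φ, hφ, rfl⟩ := hS
      induction hT using Submodule.span_induction with
      | zero => simp
      | add _ _ _ _ h₁ h₂ => rw [mul_add]; exact Submodule.add_mem _ h₁ h₂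
      | smul c _ _ h => rw [mul_smul_comm]; exact Submodule.smul_mem _ c h
      | mem _ hT =>
        obtain ⟨η', φ', hφ', rfl⟩ := hT
        exact Submodule.subset_span ⟨_, φ', hφ', E.theta_mul η η' φ φ' hφ⟩

theorem conj_mem_compact (E : FunctionalModule A) (g : G) (T : Module.End ℂ E)
    (hT : T ∈ E.compactSubalgebra) : E.act g * T * E.act g⁻¹ ∈ E.compactSubalgebra := by
  change _ ∈ Submodule.span ℂ _
  change T ∈ Submodule.span ℂ _ at hT
  induction hT using Submodule.span_induction with
  | zero => simp
  | add _ _ _ _ h₁ h₂ => rw [mul_add, add_mul]; exact Submodule.add_mem _ h₁ h₂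
  | smul c _ _ h => rw [mul_smul_comm, smul_mul_assoc]; exact Submodule.smul_mem _ c h
  | mem _ hT =>
    obtain ⟨η, φ, hφ, rfl⟩ := hT
    refine Submodule.subset_span ⟨E.act g η, _, E.act_mem g φ hφ, ?_⟩
    ext ξ
    simp [theta, E.act_rmul]

theorem compact_rmul (E : FunctionalModule A) (T : Module.End ℂ E)
    (hT : T ∈ E.compactSubalgebra) (ξ : E) (a : A) : T (E.rmul ξ a) = E.rmul (T ξ) a := by
  change T ∈ Submodule.span ℂ _ at hT
  induction hT using Submodule.span_induction with
  | zero => simp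
  | add _ _ _ _ h₁ h₂ => simp only [LinearMap.add_apply, h₁, h₂, map_add]
  | smul c _ _ h => simp only [LinearMap.smul_apply, h, map_smul]
  | mem _ hT =>
    obtain ⟨η, φ, hφ, rfl⟩ := hT
    simp [theta, E.functional_rmul φ hφ, E.rmul_mul]

/-- The `G`-algebra `𝒦_A(E)` of compact operators, with the action `T ↦ S_g ∘ T ∘ S_{g⁻¹}`. -/
def compact (E : FunctionalModule A) : GAlgebra.{u, v} G where
  carrier := E.compactSubalgebra
  act :=
    { toFun := fun g =>
        { toFun := fun T => ⟨E.act g * T.1 * E.act g⁻¹, E.conj_mem_compact g T.1 T.2⟩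
          map_add' := fun S T => Subtype.ext (by simp [mul_add, add_mul])
          map_smul' := fun c T => Subtype.ext (by simp) }
      map_one' := by ext T; simp
      map_mul' := fun g h => by
        ext T
        simp [mul_assoc] }
  act_mul g S T := Subtype.ext (by
    have h : E.act g⁻¹ * E.act g = 1 := by rw [← map_mul]; simp
    change E.act g * (S.1 * T.1) * E.act g⁻¹
      = (E.act g * S.1 * E.act g⁻¹) * (E.act g * T.1 * E.act g⁻¹)
    rw [show (E.act g * S.1 * E.act g⁻¹) * (E.act g * T.1 * E.act g⁻¹)
      = E.act g * S.1 * (E.act g⁻¹ * E.act g) * T.1 * E.act g⁻¹ by simp only [mul_assoc], h]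
    simp only [mul_assoc, one_mul])

/-- A homomorphism `(U, U^*)` of functional modules. -/
structure Hom (E F : FunctionalModule A) where
  toFun : E →ₗ[ℂ] F
  map_rmul : ∀ ξ a, toFun (E.rmul ξ a) = F.rmul (toFun ξ) a
  map_act : ∀ g ξ, toFun (E.act g ξ) = F.act g (toFun ξ)
  dual : E.functionals →ₗ[ℂ] F.functionals
  dual_lmul : ∀ a φ, dual (E.lmul a φ) = F.lmul a (dual φ)
  dual_act : ∀ g φ, dual (E.dualAct g φ) = F.dualAct g (dual φ)
  pairing : ∀ φ ξ, (dual φ).1 (toFun ξ) = φ.1 ξ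

/-- A functional extension: an injective homomorphism such that, against finitely many functionals
of `E`, each element of `F` can be replaced by an element of `E`. -/
def Hom.IsExtension {E F : FunctionalModule A} (U : Hom E F) : Prop :=
  Function.Injective U.toFun ∧
    ∀ (s : Finset E.functionals) (η : F), ∃ ξ : E, ∀ φ ∈ s, (U.dual φ).1 η = φ.1 ξ

/-! ### The modules `A^n` -/

/-- The functional `ξ ↦ ∑ i, b i * ξ i` on `A^n`, as a function of `b`. -/
noncomputable def row (A : GAlgebra.{u, v} G) (n : Type u) :
    (n →₀ A) →ₗ[ℂ] (n →₀ A) →ₗ[ℂ] A :=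
  Finsupp.lsum ℂ fun i => LinearMap.lcomp ℂ A (Finsupp.lapply i) ∘ₗ LinearMap.mul ℂ A

theorem row_single (n : Type u) (i : n) (b : A) (ξ : n →₀ A) :
    row A n (Finsupp.single i b) ξ = b * ξ i := by
  simp [row]

/-- The coordinatewise right multiplication on `A^n`. -/
noncomputable def freeMul (A : GAlgebra.{u, v} G) (n : Type u) :
    (n →₀ A) →ₗ[ℂ] A →ₗ[ℂ] (n →₀ A) :=
  LinearMap.mk₂ ℂ (fun ξ a => Finsupp.mapRange.linearMap (LinearMap.mulRight ℂ a) ξ)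
    (fun _ _ _ => map_add _ _ _) (fun _ _ _ => map_smul _ _ _)
    (fun _ _ _ => by ext; simp [mul_add]) (fun _ _ _ => by ext; simp [mul_smul_comm])

@[simp] theorem freeMul_apply (n : Type u) (ξ : n →₀ A) (a : A) (i : n) :
    freeMul A n ξ a i = ξ i * a := by
  simp [freeMul]

/-- The standard functional module `A^n` (`n` an arbitrary index set), whose functionals are the
finitely supported rows, with an arbitrary `G`-action for which it is a functional module. -/
noncomputable def free (A : GAlgebra.{u, v} G) (n : Type u) (S : Representation ℂ G (n →₀ A))
    (hS : ∀ g ξ a, S g (freeMul A n ξ a) = freeMul A n (S g ξ) (A.act g a))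
    (hrow : ∀ g, ∀ φ ∈ LinearMap.range (row A n),
      A.act g ∘ₗ φ ∘ₗ S g⁻¹ ∈ LinearMap.range (row A n)) :
    FunctionalModule A where
  carrier := n →₀ A
  rmul := freeMul A n
  rmul_mul ξ a b := by ext; simp [mul_assoc]
  act := S
  act_rmul := hS
  functionals := LinearMap.range (row A n)
  functional_rmul := by
    rintro _ ⟨b, rfl⟩ ξ a
    induction b using Finsupp.induction_linear with
    | zero => simp
    | add b c hb hc => simp only [map_add, LinearMap.add_apply, hb, hc, add_mul]
    | single i b => simp [row_single, mul_assoc]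
  lmul_mem := by
    rintro a _ ⟨b, rfl⟩
    refine ⟨Finsupp.mapRange.linearMap (LinearMap.mulLeft ℂ a) b, ?_⟩
    induction b using Finsupp.induction_linear with
    | zero => simp
    | add b c hb hc => rw [map_add, map_add, hb, hc, map_add, LinearMap.comp_add]
    | single i b =>
      refine LinearMap.ext fun ξ => ?_
      rw [Finsupp.mapRange.linearMap_apply, Finsupp.mapRange_single, row_single]
      simp only [LinearMap.comp_apply, row_single, LinearMap.mulLeft_apply, mul_assoc]
  act_mem := hrow

open scoped Classical in
/-- The action `α ⊗ μ` on `A ⊗ ℂ^n`, transported to `A^n`. -/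
noncomputable def tensorAct (A : GAlgebra.{u, v} G) {n : Type u}
    (μ : Representation ℂ G (n →₀ ℂ)) : Representation ℂ G (n →₀ A) where
  toFun g := (TensorProduct.finsuppScalarRight ℂ ℂ A n).toLinearMap ∘ₗ
    (A.act.tprod μ) g ∘ₗ (TensorProduct.finsuppScalarRight ℂ ℂ A n).symm.toLinearMap
  map_one' := by ext; simp [Finsupp.single_apply]
  map_mul' g h := by ext; simp

theorem tensorAct_single {n : Type u} (μ : Representation ℂ G (n →₀ ℂ)) (g : G) (j : n) (a : A)
    (i : n) : tensorAct A μ g (Finsupp.single j a) i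
      = μ g (Finsupp.single j 1) i • A.act g a := by
  simp [tensorAct, Representation.tprod, TensorProduct.finsuppScalarRight_apply_tmul_apply]

/-- The matrices of `μ` have finite rows, that is, the standard functional space `ℂ^n` of the
vector space `ℂ^n` of finitely supported functions is `μ`-invariant. (Finite columns are
automatic.) This is what makes `(A ⊗ ℂ^n, α ⊗ μ)` a functional module. -/
def RowFinite {n : Type u} (μ : Representation ℂ G (n →₀ ℂ)) : Prop :=
  ∀ g i, {j | μ g (Finsupp.single j 1) i ≠ 0}.Finite

theorem tensorAct_freeMul {n : Type u} (μ : Representation ℂ G (n →₀ ℂ)) (g : G) (ξ : n →₀ A)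
    (a : A) : tensorAct A μ g (freeMul A n ξ a)
      = freeMul A n (tensorAct A μ g ξ) (A.act g a) := by
  induction ξ using Finsupp.induction_linear with
  | zero => simp
  | add b c hb hc => simp only [map_add, LinearMap.add_apply, hb, hc]
  | single j b =>
    have h : freeMul A n (Finsupp.single j b) a = Finsupp.single j (b * a) := by
      simp [freeMul]
    ext i
    rw [h, freeMul_apply, tensorAct_single, tensorAct_single, A.act_mul, smul_mul_assoc]

theorem tensorAct_row {n : Type u} (μ : Representation ℂ G (n →₀ ℂ)) (hμ : RowFinite μ) (g : G)
    (φ : (n →₀ A) →ₗ[ℂ] A) (hφ : φ ∈ LinearMap.range (row A n)) :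
    A.act g ∘ₗ φ ∘ₗ tensorAct A μ g⁻¹ ∈ LinearMap.range (row A n) := by
  obtain ⟨b, rfl⟩ := hφ
  induction b using Finsupp.induction_linear with
  | zero => simp
  | add b c hb hc =>
    rw [map_add, LinearMap.add_comp, LinearMap.comp_add]
    exact Submodule.add_mem _ hb hc
  | single i b =>
    refine ⟨Finsupp.ofSupportFinite (fun j => μ g⁻¹ (Finsupp.single j 1) i • A.act g b)
      ((hμ g⁻¹ i).subset fun j hj h => hj (by simp [h])), ?_⟩
    refine Finsupp.lhom_ext fun j x => ?_
    have key : ∀ c : n →₀ A, row A n c (Finsupp.single j x) = c j * x := by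
      intro c
      induction c using Finsupp.induction_linear with
      | zero => simp
      | add b c hb hc => simp only [map_add, LinearMap.add_apply, hb, hc, Finsupp.add_apply, add_mul]
      | single k c =>
        classical
        rw [row_single, Finsupp.single_apply, Finsupp.single_apply]
        by_cases h : k = j
        · simp [h]
        · simp [h, Ne.symm h]
    rw [key]
    simp [row_single, tensorAct_single, A.act_mul, Finsupp.ofSupportFinite_coe, smul_mul_assoc,
      mul_smul_comm]

/-- The plain module `A^n = (A ⊗ ℂ^n, α ⊗ μ)`. -/
noncomputable def plain (A : GAlgebra.{u, v} G) (n : Type u) (μ : Representation ℂ G (n →₀ ℂ))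
    (hμ : RowFinite μ) : FunctionalModule A :=
  free A n (tensorAct A μ) (tensorAct_freeMul μ) (tensorAct_row μ hμ)

/-- A `G`-action `γ` on `A^n` by additive maps, compatible with the module structure; it is
automatically complex linear if `A` has an approximate unit. -/
noncomputable def linearAction (hA : A.HasApproxUnit) {n : Type u}
    (γ : G →* AddMonoid.End (n →₀ A))
    (hγ : ∀ g ξ a, γ g (freeMul A n ξ a) = freeMul A n (γ g ξ) (A.act g a)) :
    Representation ℂ G (n →₀ A) where
  toFun g :=
    { toFun := γ g
      map_add' := map_add (γ g)
      map_smul' := fun c ξ => by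
        obtain ⟨e, he⟩ := hA.exists_unit_finsupp ξ
        have h1 : freeMul A n ξ e = ξ := by ext i; simp [he i]
        have h2 : c • ξ = freeMul A n ξ (c • e) := by rw [map_smul, h1]
        rw [h2, hγ, map_smul, map_smul, ← hγ, h1]
        rfl }
  map_one' := LinearMap.ext fun ξ => by simp
  map_mul' g h := LinearMap.ext fun ξ => by simp

/-! ### Operations on functional modules -/

/-- The algebra `A` as a functional module over itself. -/
noncomputable def self (A : GAlgebra.{u, v} G) : FunctionalModule A where
  carrier := A
  rmul := LinearMap.mul ℂ A
  rmul_mul ξ a b := by simp [mul_assoc]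
  act := A.act
  act_rmul g ξ a := by simp [A.act_mul]
  functionals := LinearMap.range (LinearMap.mul ℂ A)
  functional_rmul := by
    rintro _ ⟨b, rfl⟩ ξ a
    simp [mul_assoc]
  lmul_mem := by
    rintro a _ ⟨b, rfl⟩
    exact ⟨a * b, by ext; simp [mul_assoc]⟩
  act_mem := by
    rintro g _ ⟨b, rfl⟩
    exact ⟨A.act g b, by ext; simp [A.act_mul]⟩

/-- The direct sum of two functional modules. -/
def prod (E F : FunctionalModule A) : FunctionalModule A where
  carrier := E × F
  rmul := LinearMap.mk₂ ℂ (fun ξ a => (E.rmul ξ.1 a, F.rmul ξ.2 a))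
    (by simp) (by simp) (by simp) (by simp)
  rmul_mul ξ a b := by simp [E.rmul_mul, F.rmul_mul]
  act :=
    { toFun := fun g => (E.act g).prodMap (F.act g)
      map_one' := by ext <;> simp
      map_mul' := fun g h => by ext <;> simp }
  act_rmul g ξ a := by simp [E.act_rmul, F.act_rmul]
  functionals := E.functionals.map (LinearMap.lcomp ℂ A (LinearMap.fst ℂ E F)) ⊔
    F.functionals.map (LinearMap.lcomp ℂ A (LinearMap.snd ℂ E F))
  functional_rmul χ hχ ξ a := by
    obtain ⟨_, ⟨φ, hφ, rfl⟩, _, ⟨ψ, hψ, rfl⟩, rfl⟩ := Submodule.mem_sup.1 hχ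
    simp [E.functional_rmul φ hφ, F.functional_rmul ψ hψ, add_mul]
  lmul_mem a χ hχ := by
    obtain ⟨_, ⟨φ, hφ, rfl⟩, _, ⟨ψ, hψ, rfl⟩, rfl⟩ := Submodule.mem_sup.1 hχ
    exact Submodule.mem_sup.2 ⟨_, ⟨_, E.lmul_mem a φ hφ, rfl⟩, _, ⟨_, F.lmul_mem a ψ hψ, rfl⟩,
      by ext <;> simp⟩
  act_mem g χ hχ := by
    obtain ⟨_, ⟨φ, hφ, rfl⟩, _, ⟨ψ, hψ, rfl⟩, rfl⟩ := Submodule.mem_sup.1 hχ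
    exact Submodule.mem_sup.2 ⟨_, ⟨_, E.act_mem g φ hφ, rfl⟩, _, ⟨_, F.act_mem g ψ hψ, rfl⟩,
      by ext <;> simp⟩

theorem snd_mem_prod (E F : FunctionalModule A) (ψ : F →ₗ[ℂ] A) (hψ : ψ ∈ F.functionals) :
    (show E.prod F →ₗ[ℂ] A from ψ ∘ₗ LinearMap.snd ℂ E F) ∈ (E.prod F).functionals := by
  have h : ψ ∘ₗ LinearMap.snd ℂ E F ∈
      E.functionals.map (LinearMap.lcomp ℂ A (LinearMap.fst ℂ E F)) ⊔
        F.functionals.map (LinearMap.lcomp ℂ A (LinearMap.snd ℂ E F)) :=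
    Submodule.mem_sup_right ⟨ψ, hψ, rfl⟩
  exact h

/-- The direct sum of an arbitrary family of functional modules; its functionals are the finite
sums of functionals on the summands. -/
noncomputable def directSum {I : Type u} (E : I → FunctionalModule A) : FunctionalModule A where
  carrier := Π₀ i, E i
  rmul := LinearMap.mk₂ ℂ
    (fun ξ a => DFinsupp.mapRange.linearMap (fun i => (E i).rmul.flip a) ξ)
    (fun _ _ _ => map_add _ _ _) (fun _ _ _ => map_smul _ _ _)
    (fun _ _ _ => by ext; simp) (fun _ _ _ => by ext; simp)
  rmul_mul ξ a b := by ext i; simp [(E i).rmul_mul]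
  act :=
    { toFun := fun g => DFinsupp.mapRange.linearMap (fun i => (E i).act g)
      map_one' := by ext1 ξ; ext i; simp
      map_mul' := fun g h => by ext1 ξ; ext i; simp }
  act_rmul g ξ a := by ext i; simp [(E i).act_rmul]
  functionals := ⨆ i, (E i).functionals.map (LinearMap.lcomp ℂ A (DFinsupp.lapply i))
  functional_rmul φ hφ ξ a := by
    induction hφ using Submodule.iSup_induction' with
    | zero => simp
    | add _ _ _ _ h₁ h₂ => simp only [LinearMap.add_apply, h₁, h₂, add_mul]
    | mem i φ hφ =>
      obtain ⟨φ, hφ, rfl⟩ := hφ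
      simp [(E i).functional_rmul φ hφ]
  lmul_mem a φ hφ := by
    induction hφ using Submodule.iSup_induction' with
    | zero => simp
    | add _ _ _ _ h₁ h₂ => rw [LinearMap.comp_add]; exact Submodule.add_mem _ h₁ h₂
    | mem i φ hφ =>
      obtain ⟨φ, hφ, rfl⟩ := hφ
      exact Submodule.mem_iSup_of_mem i ⟨_, (E i).lmul_mem a φ hφ, by ext; simp⟩
  act_mem g φ hφ := by
    induction hφ using Submodule.iSup_induction' with
    | zero => simp
    | add _ _ _ _ h₁ h₂ =>
      rw [LinearMap.add_comp, LinearMap.comp_add]; exact Submodule.add_mem _ h₁ h₂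
    | mem i φ hφ =>
      obtain ⟨φ, hφ, rfl⟩ := hφ
      exact Submodule.mem_iSup_of_mem i ⟨_, (E i).act_mem g φ hφ, by ext1 ξ; simp⟩

theorem map₂_mul {B : GAlgebra.{u, v} G} (E : FunctionalModule A) (F : FunctionalModule B)
    (ξ : E ⊗[ℂ] F) (a b : A ⊗[ℂ] B) :
    TensorProduct.map₂ E.rmul F.rmul ξ (a * b)
      = TensorProduct.map₂ E.rmul F.rmul (TensorProduct.map₂ E.rmul F.rmul ξ a) b := by
  induction ξ with
  | zero => simp
  | add x y hx hy => simp only [map_add, LinearMap.add_apply, hx, hy]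
  | tmul x y =>
    induction a with
    | zero => simp
    | add a a' h h' => simp only [add_mul, map_add, LinearMap.add_apply, h, h']
    | tmul a a' =>
      induction b with
      | zero => simp
      | add b b' h h' => simp only [mul_add, map_add, h, h']
      | tmul b b' => simp [E.rmul_mul, F.rmul_mul]

theorem map_map₂ {B : GAlgebra.{u, v} G} (E : FunctionalModule A) (F : FunctionalModule B)
    (φ : E →ₗ[ℂ] A) (hφ : φ ∈ E.functionals) (ψ : F →ₗ[ℂ] B) (hψ : ψ ∈ F.functionals)
    (ξ : E ⊗[ℂ] F) (a : A ⊗[ℂ] B) :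
    TensorProduct.map φ ψ (TensorProduct.map₂ E.rmul F.rmul ξ a)
      = TensorProduct.map φ ψ ξ * a := by
  induction ξ with
  | zero => simp
  | add x y hx hy => simp only [map_add, LinearMap.add_apply, add_mul, hx, hy]
  | tmul x y =>
    induction a with
    | zero => simp
    | add a a' h h' => simp only [mul_add, map_add, h, h']
    | tmul a a' => simp [E.functional_rmul φ hφ, F.functional_rmul ψ hψ]

theorem act_map₂ {B : GAlgebra.{u, v} G} (E : FunctionalModule A) (F : FunctionalModule B)
    (g : G) (ξ : E ⊗[ℂ] F) (a : A ⊗[ℂ] B) :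
    TensorProduct.map (E.act g) (F.act g) (TensorProduct.map₂ E.rmul F.rmul ξ a)
      = TensorProduct.map₂ E.rmul F.rmul (TensorProduct.map (E.act g) (F.act g) ξ)
        (TensorProduct.map (A.act g) (B.act g) a) := by
  induction ξ with
  | zero => simp
  | add x y hx hy => simp only [map_add, LinearMap.add_apply, hx, hy]
  | tmul x y =>
    induction a with
    | zero => simp
    | add a a' h h' => simp only [map_add, h, h']
    | tmul a a' => simp [E.act_rmul, F.act_rmul]

/-- The external tensor product `E ⊗ F`, a functional module over `A ⊗ B`, with functional space
spanned by the `φ ⊗ ψ`. -/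
noncomputable def tensor {B : GAlgebra.{u, v} G} (E : FunctionalModule A)
    (F : FunctionalModule B) : FunctionalModule (A.tensor B) where
  carrier := E ⊗[ℂ] F
  rmul := TensorProduct.map₂ E.rmul F.rmul
  rmul_mul := map₂_mul E F
  act := E.act.tprod F.act
  act_rmul := act_map₂ E F
  functionals := Submodule.span ℂ
    {χ | ∃ φ ∈ E.functionals, ∃ ψ ∈ F.functionals, χ = TensorProduct.map φ ψ}
  functional_rmul χ hχ ξ a := by
    induction hχ using Submodule.span_induction with
    | zero => simp
    | add _ _ _ _ h₁ h₂ => simp only [LinearMap.add_apply, h₁, h₂, add_mul]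
    | smul c _ _ h => simp only [LinearMap.smul_apply, h, smul_mul_assoc]
    | mem _ h =>
      obtain ⟨φ, hφ, ψ, hψ, rfl⟩ := h
      exact map_map₂ E F φ hφ ψ hψ ξ a
  lmul_mem a χ hχ := by
    change A ⊗[ℂ] B at a
    induction hχ using Submodule.span_induction with
    | zero => simp
    | add _ _ _ _ h₁ h₂ => rw [LinearMap.comp_add]; exact Submodule.add_mem _ h₁ h₂
    | smul c _ _ h => rw [LinearMap.comp_smul]; exact Submodule.smul_mem _ c h
    | mem _ h =>
      obtain ⟨φ, hφ, ψ, hψ, rfl⟩ := h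
      change LinearMap.mul ℂ (A ⊗[ℂ] B) a ∘ₗ TensorProduct.map φ ψ ∈ _
      induction a with
      | zero =>
        rw [map_zero, LinearMap.zero_comp]
        exact Submodule.zero_mem _
      | add a b h h' =>
        rw [map_add, LinearMap.add_comp]
        exact Submodule.add_mem _ h h'
      | tmul a b =>
        refine Submodule.subset_span ⟨_, E.lmul_mem a φ hφ, _, F.lmul_mem b ψ hψ, ?_⟩
        exact TensorProduct.ext' fun x y => Algebra.TensorProduct.tmul_mul_tmul _ _ _ _
  act_mem g χ hχ := by
    induction hχ using Submodule.span_induction with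
    | zero => simp
    | add _ _ _ _ h₁ h₂ =>
      rw [LinearMap.add_comp, LinearMap.comp_add]; exact Submodule.add_mem _ h₁ h₂
    | smul c _ _ h =>
      rw [LinearMap.smul_comp, LinearMap.comp_smul]; exact Submodule.smul_mem _ c h
    | mem _ h =>
      obtain ⟨φ, hφ, ψ, hψ, rfl⟩ := h
      exact Submodule.subset_span ⟨_, E.act_mem g φ hφ, _, F.act_mem g ψ hψ,
        TensorProduct.ext' fun x y => rfl⟩

/-- The kernel of `E ⊗ B → E ⊗_π B`. -/
def changeRel {B : GAlgebra.{u, v} G} (π : A.Hom B) (E : FunctionalModule A) :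
    Submodule ℂ (E ⊗[ℂ] B) :=
  Submodule.span ℂ {x | ∃ ξ a b, x = E.rmul ξ a ⊗ₜ[ℂ] b - ξ ⊗ₜ[ℂ] (π.toFun a * b)}

theorem lTensor_mem_changeRel {B : GAlgebra.{u, v} G} (π : A.Hom B) (E : FunctionalModule A)
    (c : B) : changeRel π E ≤ (changeRel π E).comap (LinearMap.lTensor E (LinearMap.mulRight ℂ c)) := by
  refine Submodule.span_le.2 ?_
  rintro _ ⟨ξ, a, b, rfl⟩
  exact Submodule.subset_span ⟨ξ, a, b * c, by simp [mul_assoc]⟩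

theorem act_mem_changeRel {B : GAlgebra.{u, v} G} (π : A.Hom B) (E : FunctionalModule A)
    (g : G) : changeRel π E ≤ (changeRel π E).comap (TensorProduct.map (E.act g) (B.act g)) := by
  refine Submodule.span_le.2 ?_
  rintro _ ⟨ξ, a, b, rfl⟩
  exact Submodule.subset_span ⟨E.act g ξ, A.act g a, B.act g b,
    by simp [E.act_rmul, B.act_mul, π.map_act]⟩

/-- The right multiplication `(ξ ⊗ b) c = ξ ⊗ b c` on `E ⊗_π B`. -/
noncomputable def changeMul {B : GAlgebra.{u, v} G} (π : A.Hom B) (E : FunctionalModule A) :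
    (E ⊗[ℂ] B) ⧸ changeRel π E →ₗ[ℂ] B →ₗ[ℂ] (E ⊗[ℂ] B) ⧸ changeRel π E :=
  LinearMap.mk₂ ℂ
    (fun x c => (changeRel π E).mapQ _ (LinearMap.lTensor E (LinearMap.mulRight ℂ c))
      (lTensor_mem_changeRel π E c) x)
    (fun _ _ _ => map_add _ _ _) (fun _ _ _ => map_smul _ _ _)
    (fun x c d => by
      obtain ⟨x, rfl⟩ := Submodule.Quotient.mk_surjective _ x
      induction x with
      | zero => simp
      | add x y hx hy =>
        simp only [Submodule.Quotient.mk_add, map_add, hx, hy]; abel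
      | tmul ξ b =>
        simp [mul_add, TensorProduct.tmul_add])
    (fun t x c => by
      obtain ⟨x, rfl⟩ := Submodule.Quotient.mk_surjective _ x
      induction x with
      | zero => simp
      | add x y hx hy => simp only [Submodule.Quotient.mk_add, map_add, hx, hy, smul_add]
      | tmul ξ b => simp [mul_smul_comm])

/-- The class of `ξ ⊗ b` in `E ⊗_π B`. -/
def changeMk {B : GAlgebra.{u, v} G} (π : A.Hom B) (E : FunctionalModule A) (ξ : E) (b : B) :
    (E ⊗[ℂ] B) ⧸ changeRel π E :=
  (changeRel π E).mkQ (ξ ⊗ₜ[ℂ] b)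

theorem changeMul_mk {B : GAlgebra.{u, v} G} (π : A.Hom B) (E : FunctionalModule A) (ξ : E)
    (b c : B) : changeMul π E (changeMk π E ξ b) c = changeMk π E ξ (b * c) := by
  simp [changeMul, changeMk]

theorem change_induction {B : GAlgebra.{u, v} G} {π : A.Hom B} {E : FunctionalModule A}
    {p : (E ⊗[ℂ] B) ⧸ changeRel π E → Prop} (x : (E ⊗[ℂ] B) ⧸ changeRel π E) (h0 : p 0)
    (hadd : ∀ x y, p x → p y → p (x + y)) (hmk : ∀ ξ b, p (changeMk π E ξ b)) : p x := by
  obtain ⟨x, rfl⟩ := Submodule.Quotient.mk_surjective _ x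
  induction x with
  | zero => exact h0
  | add x y hx hy => exact hadd _ _ hx hy
  | tmul ξ b => exact hmk ξ b

/-- The functional `(φ ⊗ c)(ξ ⊗ b) = c π(φ(ξ)) b` on `E ⊗_π B`. -/
noncomputable def changeFunctional {B : GAlgebra.{u, v} G} (π : A.Hom B) (E : FunctionalModule A)
    (φ : E.functionals) (c : B) : (E ⊗[ℂ] B) ⧸ changeRel π E →ₗ[ℂ] B :=
  (changeRel π E).liftQ
    (TensorProduct.lift (LinearMap.mk₂ ℂ (fun ξ b => c * π.toFun (φ.1 ξ) * b)
      (fun _ _ _ => by simp [mul_add, add_mul]) (fun _ _ _ => by simp [mul_smul_comm, smul_mul_assoc])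
      (fun _ _ _ => mul_add _ _ _) (fun _ _ _ => mul_smul_comm _ _ _)))
    (by
      refine Submodule.span_le.2 ?_
      rintro _ ⟨ξ, a, b, rfl⟩
      simp [E.functional_rmul φ.1 φ.2, mul_assoc])

theorem changeFunctional_mk {B : GAlgebra.{u, v} G} (π : A.Hom B) (E : FunctionalModule A)
    (φ : E.functionals) (c : B) (ξ : E) (b : B) :
    changeFunctional π E φ c (changeMk π E ξ b) = c * π.toFun (φ.1 ξ) * b := by
  simp only [changeFunctional, changeMk, Submodule.mkQ_apply]
  rfl

/-- The `G`-action `S ⊗ β` on `E ⊗_π B`. -/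
noncomputable def changeAct {B : GAlgebra.{u, v} G} (π : A.Hom B) (E : FunctionalModule A) :
    Representation ℂ G ((E ⊗[ℂ] B) ⧸ changeRel π E) where
  toFun g := (changeRel π E).mapQ (changeRel π E) (TensorProduct.map (E.act g) (B.act g))
    (act_mem_changeRel π E g)
  map_one' := by
    refine LinearMap.ext fun x => ?_
    induction x using change_induction with
    | h0 => simp
    | hadd x y hx hy => rw [map_add, hx, hy, map_add]
    | hmk ξ b => simp [changeMk]
  map_mul' g h := by
    refine LinearMap.ext fun x => ?_
    induction x using change_induction with
    | h0 => simp
    | hadd x y hx hy => rw [map_add, hx, hy, map_add]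
    | hmk ξ b => simp [changeMk]

theorem changeAct_mk {B : GAlgebra.{u, v} G} (π : A.Hom B) (E : FunctionalModule A) (g : G) (ξ : E)
    (b : B) : changeAct π E g (changeMk π E ξ b) = changeMk π E (E.act g ξ) (B.act g b) := by
  simp [changeAct, changeMk]

/-- The change of coefficient algebra `E ⊗_π B`. -/
noncomputable def change {B : GAlgebra.{u, v} G} (π : A.Hom B) (E : FunctionalModule A) :
    FunctionalModule B where
  carrier := (E ⊗[ℂ] B) ⧸ changeRel π E
  rmul := changeMul π E
  rmul_mul x c d := by
    induction x using change_induction with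
    | h0 => simp
    | hadd x y hx hy => simp only [map_add, LinearMap.add_apply, hx, hy]
    | hmk ξ b => simp only [changeMul_mk, mul_assoc]
  act := changeAct π E
  act_rmul g x c := by
    induction x using change_induction with
    | h0 => simp
    | hadd x y hx hy => simp only [map_add, LinearMap.add_apply, hx, hy]
    | hmk ξ b => simp only [changeMul_mk, changeAct_mk, B.act_mul]
  functionals := Submodule.span ℂ {χ | ∃ φ c, χ = changeFunctional π E φ c}
  functional_rmul χ hχ x d := by
    induction hχ using Submodule.span_induction with
    | zero => simp
    | add _ _ _ _ h₁ h₂ => simp only [LinearMap.add_apply, h₁, h₂, add_mul]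
    | smul c _ _ h => simp only [LinearMap.smul_apply, h, smul_mul_assoc]
    | mem _ h =>
      obtain ⟨φ, c, rfl⟩ := h
      induction x using change_induction with
      | h0 => simp
      | hadd x y hx hy => simp only [map_add, LinearMap.add_apply, hx, hy, add_mul]
      | hmk ξ b => simp only [changeMul_mk, changeFunctional_mk, mul_assoc]
  lmul_mem d χ hχ := by
    induction hχ using Submodule.span_induction with
    | zero => simp
    | add _ _ _ _ h₁ h₂ => rw [LinearMap.comp_add]; exact Submodule.add_mem _ h₁ h₂
    | smul c _ _ h => rw [LinearMap.comp_smul]; exact Submodule.smul_mem _ c h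
    | mem _ h =>
      obtain ⟨φ, c, rfl⟩ := h
      refine Submodule.subset_span ⟨φ, d * c, LinearMap.ext fun x => ?_⟩
      induction x using change_induction with
      | h0 => simp
      | hadd x y hx hy => rw [map_add, hx, hy, map_add]
      | hmk ξ b => simp [changeFunctional_mk, mul_assoc]
  act_mem g χ hχ := by
    induction hχ using Submodule.span_induction with
    | zero => simp
    | add _ _ _ _ h₁ h₂ =>
      rw [LinearMap.add_comp, LinearMap.comp_add]; exact Submodule.add_mem _ h₁ h₂
    | smul c _ _ h =>
      rw [LinearMap.smul_comp, LinearMap.comp_smul]; exact Submodule.smul_mem _ c h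
    | mem _ h =>
      obtain ⟨φ, c, rfl⟩ := h
      refine Submodule.subset_span ⟨E.dualAct g φ, B.act g c, LinearMap.ext fun x => ?_⟩
      induction x using change_induction with
      | h0 => simp
      | hadd x y hx hy => rw [map_add, hx, hy, map_add]
      | hmk ξ b =>
        simp [changeFunctional_mk, changeAct_mk, dualAct, B.act_mul, π.map_act, mul_assoc]

/-! ### Corner modules -/

/-- The coordinate `ξ ⊕ b ↦ b` of `E ⊕ A`. -/
noncomputable def toAlg (E : FunctionalModule A) : E.prod (self A) →ₗ[ℂ] A := LinearMap.snd ℂ E A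

/-- The inclusion `b ↦ 0 ⊕ b` into `E ⊕ A`. -/
noncomputable def ofAlg (E : FunctionalModule A) : A →ₗ[ℂ] E.prod (self A) := LinearMap.inr ℂ E A

@[simp] theorem toAlg_ofAlg (E : FunctionalModule A) (a : A) : toAlg E (ofAlg E a) = a := rfl

theorem ofAlg_mul (E : FunctionalModule A) (a b : A) :
    ofAlg E (a * b) = (E.prod (self A)).rmul (ofAlg E a) b := by
  change ((0 : E), a * b) = (E.rmul 0 b, a * b)
  simp

theorem toAlg_rmul (E : FunctionalModule A) (x : E.prod (self A)) (a : A) :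
    toAlg E ((E.prod (self A)).rmul x a) = toAlg E x * a := rfl

theorem ofAlg_act (E : FunctionalModule A) (g : G) (a : A) :
    (E.prod (self A)).act g (ofAlg E a) = ofAlg E (A.act g a) := by
  change (E.act g (0 : E), A.act g a) = ((0 : E), A.act g a)
  simp

theorem toAlg_act (E : FunctionalModule A) (g : G) (x : E.prod (self A)) :
    toAlg E ((E.prod (self A)).act g x) = A.act g (toAlg E x) := rfl

/-- The operator `m_a (ξ ⊕ b) = 0 ⊕ a b` on `E ⊕ A`. -/
noncomputable def cornerOp (E : FunctionalModule A) (a : A) : Module.End ℂ (E.prod (self A)) :=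
  ofAlg E ∘ₗ LinearMap.mulLeft ℂ a ∘ₗ toAlg E

theorem cornerOp_apply (E : FunctionalModule A) (a : A) (x : E.prod (self A)) :
    cornerOp E a x = ofAlg E (a * toAlg E x) := rfl

theorem cornerOp_mem (hA : A.HasApproxUnit) (E : FunctionalModule A) (a : A) :
    cornerOp E a ∈ (E.prod (self A)).compactSubalgebra := by
  obtain ⟨e, ⟨-, he⟩, -⟩ := hA.exists_unit a a
  refine Submodule.subset_span ⟨ofAlg E a, LinearMap.mul ℂ A e ∘ₗ toAlg E, ?_, ?_⟩
  · have h : LinearMap.mul ℂ A e ∈ (self A).functionals := ⟨e, rfl⟩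
    exact snd_mem_prod E (self A) _ h
  · refine LinearMap.ext fun x => ?_
    rw [cornerOp_apply, theta, LinearMap.comp_apply, ← ofAlg_mul, LinearMap.comp_apply,
      LinearMap.mul_apply', ← mul_assoc, he]

/-- The corner embedding `a ↦ m_a` of `A` into `𝒦_A(E ⊕ A)`, with image `M_A`. -/
noncomputable def cornerEmb (hA : A.HasApproxUnit) (E : FunctionalModule A) :
    A →ₗ[ℂ] (E.prod (self A)).compact where
  toFun a := (⟨cornerOp E a, cornerOp_mem hA E a⟩ : (E.prod (self A)).compactSubalgebra)
  map_add' a b := Subtype.ext <| LinearMap.ext fun x => by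
    change ofAlg E ((a + b) * toAlg E x) = ofAlg E (a * toAlg E x) + ofAlg E (b * toAlg E x)
    rw [add_mul, map_add]
  map_smul' c a := Subtype.ext <| LinearMap.ext fun x => by
    change ofAlg E ((c • a) * toAlg E x) = c • ofAlg E (a * toAlg E x)
    rw [smul_mul_assoc, map_smul]

theorem cornerEmb_mul (hA : A.HasApproxUnit) (E : FunctionalModule A) (a b : A) :
    cornerEmb hA E (a * b) = cornerEmb hA E a * cornerEmb hA E b :=
  Subtype.ext <| LinearMap.ext fun x => by
    change ofAlg E ((a * b) * toAlg E x) = ofAlg E (a * toAlg E (ofAlg E (b * toAlg E x)))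
    rw [mul_assoc, toAlg_ofAlg]

theorem cornerEmb_act (hA : A.HasApproxUnit) (E : FunctionalModule A) (g : G) (a : A) :
    (E.prod (self A)).compact.act g (cornerEmb hA E a) = cornerEmb hA E (A.act g a) :=
  Subtype.ext <| LinearMap.ext fun x => by
    change (E.prod (self A)).act g (ofAlg E (a * toAlg E ((E.prod (self A)).act g⁻¹ x)))
      = ofAlg E (A.act g a * toAlg E x)
    rw [ofAlg_act, toAlg_act, A.act_mul, ← Module.End.mul_apply (A.act g) (A.act g⁻¹), ← map_mul]
    simp

theorem cornerEmb_injective (hA : A.HasApproxUnit) (E : FunctionalModule A) :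
    Function.Injective (cornerEmb hA E) := by
  refine (injective_iff_map_eq_zero _).2 fun a ha => ?_
  obtain ⟨e, ⟨-, he⟩, -⟩ := hA.exists_unit a a
  have h : toAlg E (cornerOp E a (ofAlg E e)) = 0 :=
    congrArg (fun T : (E.prod (self A)).compactSubalgebra => toAlg E (T.1 (ofAlg E e))) ha
  rwa [cornerOp_apply, toAlg_ofAlg, toAlg_ofAlg, he] at h

/-- `M_A 𝒦_A(E ⊕ A) M_A ⊆ M_A`. -/
theorem cornerEmb_mul_mul (hA : A.HasApproxUnit) (E : FunctionalModule A) (b c : A)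
    (k : (E.prod (self A)).compact) :
    cornerEmb hA E b * k * cornerEmb hA E c ∈ LinearMap.range (cornerEmb hA E) := by
  refine ⟨b * toAlg E (k.1 (ofAlg E c)), Subtype.ext <| LinearMap.ext fun x => ?_⟩
  change ofAlg E ((b * toAlg E (k.1 (ofAlg E c))) * toAlg E x)
    = ofAlg E (b * toAlg E (k.1 (ofAlg E (c * toAlg E x))))
  rw [ofAlg_mul E c, compact_rmul _ k.1 k.2, toAlg_rmul, mul_assoc]

/-- The subspace `F · M_A` of a `𝒦_A(E ⊕ A)`-module `F`. -/
noncomputable def cornerCarrier (hA : A.HasApproxUnit) (E : FunctionalModule A)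
    (F : FunctionalModule (E.prod (self A)).compact) : Submodule ℂ F :=
  Submodule.span ℂ {x | ∃ ξ a, x = F.rmul ξ (cornerEmb hA E a)}

theorem rmul_mem_corner (hA : A.HasApproxUnit) (E : FunctionalModule A)
    (F : FunctionalModule (E.prod (self A)).compact) (ξ : F) (a : A) :
    F.rmul ξ (cornerEmb hA E a) ∈ cornerCarrier hA E F :=
  Submodule.subset_span ⟨ξ, a, rfl⟩

theorem act_mem_corner (hA : A.HasApproxUnit) (E : FunctionalModule A)
    (F : FunctionalModule (E.prod (self A)).compact) (g : G) (x : F)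
    (hx : x ∈ cornerCarrier hA E F) : F.act g x ∈ cornerCarrier hA E F := by
  induction hx using Submodule.span_induction with
  | zero => simp
  | add _ _ _ _ h₁ h₂ => rw [map_add]; exact Submodule.add_mem _ h₁ h₂
  | smul c _ _ h => rw [map_smul]; exact Submodule.smul_mem _ c h
  | mem _ h =>
    obtain ⟨ξ, a, rfl⟩ := h
    rw [F.act_rmul, cornerEmb_act]
    exact rmul_mem_corner hA E F _ _

theorem mul_functional_mem (hA : A.HasApproxUnit) (E : FunctionalModule A)
    (F : FunctionalModule (E.prod (self A)).compact) (b : A) (φ : F.functionals)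
    (x : cornerCarrier hA E F) :
    cornerEmb hA E b * φ.1 x.1 ∈ LinearMap.range (cornerEmb hA E) := by
  obtain ⟨x, hx⟩ := x
  induction hx using Submodule.span_induction with
  | zero => simp
  | add _ _ _ _ h₁ h₂ =>
    simp only [map_add, mul_add]
    exact Submodule.add_mem _ h₁ h₂
  | smul c _ _ h =>
    simp only [map_smul, mul_smul_comm]
    exact Submodule.smul_mem _ c h
  | mem _ h =>
    obtain ⟨ξ, a, rfl⟩ := h
    rw [F.functional_rmul φ.1 φ.2, ← mul_assoc]
    exact cornerEmb_mul_mul hA E b a _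

/-- The functional `m_b φ` restricted to `F · M_A`, with values in `M_A ≅ A`. -/
noncomputable def cornerFunctional (hA : A.HasApproxUnit) (E : FunctionalModule A)
    (F : FunctionalModule (E.prod (self A)).compact) (b : A) (φ : F.functionals) :
    cornerCarrier hA E F →ₗ[ℂ] A :=
  (LinearEquiv.ofInjective (cornerEmb hA E) (cornerEmb_injective hA E)).symm.toLinearMap ∘ₗ
    LinearMap.codRestrict (LinearMap.range (cornerEmb hA E))
      (LinearMap.mulLeft ℂ (cornerEmb hA E b) ∘ₗ φ.1 ∘ₗ (cornerCarrier hA E F).subtype)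
      (mul_functional_mem hA E F b φ)

theorem cornerFunctional_spec (hA : A.HasApproxUnit) (E : FunctionalModule A)
    (F : FunctionalModule (E.prod (self A)).compact) (b : A) (φ : F.functionals)
    (x : cornerCarrier hA E F) :
    cornerEmb hA E (cornerFunctional hA E F b φ x) = cornerEmb hA E b * φ.1 x.1 := by
  have h := LinearEquiv.apply_symm_apply
    (LinearEquiv.ofInjective (cornerEmb hA E) (cornerEmb_injective hA E))
    ⟨cornerEmb hA E b * φ.1 x.1, mul_functional_mem hA E F b φ x⟩
  exact congrArg Subtype.val h

/-- The corner module `F · M_A`, a functional `A`-module via `A ≅ M_A ⊆ 𝒦_A(E ⊕ A)`, with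
functional space spanned by the `m_b φ`. -/
noncomputable def corner (hA : A.HasApproxUnit) (E : FunctionalModule A)
    (F : FunctionalModule (E.prod (self A)).compact) : FunctionalModule A where
  carrier := cornerCarrier hA E F
  rmul := LinearMap.mk₂ ℂ
    (fun x a => ⟨F.rmul x.1 (cornerEmb hA E a), rmul_mem_corner hA E F x.1 a⟩)
    (fun _ _ _ => Subtype.ext (by simp)) (fun _ _ _ => Subtype.ext (by simp))
    (fun _ _ _ => Subtype.ext (by simp)) (fun _ _ _ => Subtype.ext (by simp))
  rmul_mul x a b := Subtype.ext (by simp [cornerEmb_mul, F.rmul_mul])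
  act :=
    { toFun := fun g => (F.act g).restrict (act_mem_corner hA E F g)
      map_one' := LinearMap.ext fun x => Subtype.ext (by simp)
      map_mul' := fun g h => LinearMap.ext fun x => Subtype.ext (by simp) }
  act_rmul g x a := Subtype.ext (by simp [F.act_rmul, cornerEmb_act])
  functionals := Submodule.span ℂ {χ | ∃ b φ, χ = cornerFunctional hA E F b φ}
  functional_rmul χ hχ x a := by
    induction hχ using Submodule.span_induction with
    | zero => simp
    | add _ _ _ _ h₁ h₂ => simp only [LinearMap.add_apply, h₁, h₂, add_mul]
    | smul c _ _ h => simp only [LinearMap.smul_apply, h, smul_mul_assoc]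
    | mem _ h =>
      obtain ⟨b, φ, rfl⟩ := h
      apply cornerEmb_injective hA E
      rw [cornerEmb_mul, cornerFunctional_spec, cornerFunctional_spec, mul_assoc,
        ← F.functional_rmul φ.1 φ.2]
      rfl
  lmul_mem a χ hχ := by
    induction hχ using Submodule.span_induction with
    | zero => simp
    | add _ _ _ _ h₁ h₂ => rw [LinearMap.comp_add]; exact Submodule.add_mem _ h₁ h₂
    | smul c _ _ h => rw [LinearMap.comp_smul]; exact Submodule.smul_mem _ c h
    | mem _ h =>
      obtain ⟨b, φ, rfl⟩ := h
      refine Submodule.subset_span ⟨a * b, φ, LinearMap.ext fun x => ?_⟩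
      apply cornerEmb_injective hA E
      rw [cornerFunctional_spec, LinearMap.comp_apply, LinearMap.mulLeft_apply, cornerEmb_mul,
        cornerFunctional_spec, cornerEmb_mul, mul_assoc]
  act_mem g χ hχ := by
    induction hχ using Submodule.span_induction with
    | zero => simp
    | add _ _ _ _ h₁ h₂ =>
      rw [LinearMap.add_comp, LinearMap.comp_add]; exact Submodule.add_mem _ h₁ h₂
    | smul c _ _ h =>
      rw [LinearMap.smul_comp, LinearMap.comp_smul]; exact Submodule.smul_mem _ c h
    | mem _ h =>
      obtain ⟨b, φ, rfl⟩ := h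
      refine Submodule.subset_span ⟨A.act g b, F.dualAct g φ, LinearMap.ext fun x => ?_⟩
      apply cornerEmb_injective hA E
      rw [cornerFunctional_spec, LinearMap.comp_apply, ← cornerEmb_act, LinearMap.comp_apply,
        cornerFunctional_spec, GAlgebra.act_mul, cornerEmb_act]
      rfl

/-! ### The class `C` -/

/-- The class `C`: the cofull functional modules with cofull functional space, over algebras with
approximate unit, such that `𝒦_A(E)` has an approximate unit and `E` has a functional extension
into some `A^n = (A ⊗ ℂ^n, α ⊗ μ)`. -/
structure InClassC (E : FunctionalModule A) : Prop where
  approxUnit : A.HasApproxUnit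
  cofull : E.Cofull
  dualCofull : E.DualCofull
  compact_approxUnit : E.compact.HasApproxUnit
  exists_extension : ∃ (n : Type u) (μ : Representation ℂ G (n →₀ ℂ)) (hμ : RowFinite μ)
    (U : Hom E (plain A n μ hμ)), U.IsExtension

end FunctionalModule

/- The two cofullness conditions and the approximate unit of `𝒦_A(E)` hold together exactly when
finitely many elements, and finitely many functionals, are always fixed by a single compact
operator `T`, that is `T ξ = ξ` and `φ ∘ T = φ`. Since this only has to be tested on spanning
families, it passes easily to each of the constructed modules. For the embedding into a plain
module, `U^*` need not be constructed: the density clause forces a functional on the larger module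
to be determined by its restriction along `U`, so `U^*` is the inverse of the restriction. Hence
every construction takes functional extensions to functional extensions, and it remains to treat
plain modules, where direct sums, change of algebra, tensor products and corners embed into the
plain modules on disjoint unions of index sets, the same index set, and products of index sets.
For the corner, `E ⊕ A` is identified with the left ideal `K M_A` of `K = 𝒦_A(E ⊕ A)`, so that
`K^n M_A = (E ⊕ A)^n` embeds because `E ⊕ A` does. For finite `G`, an arbitrary action on `A^n` is
a summand of the plain module on `n × G`, on which `G` translates the second factor, by averaging
over `G`. -/

section LinearAlgebra

variable {R M ι J : Type*} [Semiring R] [AddCommMonoid M] [Module R M]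

theorem exists_finset_subset_span_image {x : J → M} {s : Finset M}
    (hs : (s : Set M) ⊆ Submodule.span R (Set.range x)) :
    ∃ t : Finset J, (s : Set M) ⊆ Submodule.span R (x '' t) := by
  classical
  obtain ⟨r, hr, hsr⟩ := Submodule.subset_span_finite_of_subset_span hs
  rw [← Set.image_univ] at hr
  obtain ⟨t, -, rfl⟩ := Finset.subset_set_image_iff.1 hr
  exact ⟨t, by simpa only [Finset.coe_image] using hsr⟩

theorem exists_subset_of_subset_span (P : ι → Submodule R M) {x : J → M}
    (h : ∀ t : Finset J, ∃ i, ∀ j ∈ t, x j ∈ P i) {s : Finset M}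
    (hs : (s : Set M) ⊆ Submodule.span R (Set.range x)) : ∃ i, (s : Set M) ⊆ P i := by
  obtain ⟨t, ht⟩ := exists_finset_subset_span_image hs
  obtain ⟨i, hi⟩ := h t
  exact ⟨i, ht.trans (Submodule.span_le.2 (Set.image_subset_iff.2 hi))⟩

theorem mem_addSubmonoidClosure_iff_mem_span {S : Set M} (hS : ∀ (r : R), ∀ x ∈ S, r • x ∈ S)
    {x : M} : x ∈ AddSubmonoid.closure S ↔ x ∈ Submodule.span R S := by
  refine ⟨fun hx => Submodule.closure_subset_span hx, fun hx => ?_⟩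
  induction hx using Submodule.closure_induction with
  | zero => exact zero_mem _
  | add _ _ _ _ hx hy => exact add_mem hx hy
  | smul_mem r x hx => exact AddSubmonoid.subset_closure (hS r x hx)

theorem span_range_single {R n M : Type*} [Semiring R] [AddCommMonoid M] [Module R M] :
    Submodule.span R (Set.range fun p : n × M => Finsupp.single p.1 p.2) = ⊤ := by
  refine top_unique fun ξ _ => ?_
  induction ξ using Finsupp.induction_linear with
  | zero => exact zero_mem _
  | add _ _ h₁ h₂ => exact add_mem (h₁ trivial) (h₂ trivial)
  | single i a => exact Submodule.subset_span ⟨(i, a), rfl⟩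

theorem span_range_tmul {R M N : Type*} [CommSemiring R] [AddCommMonoid M] [AddCommMonoid N]
    [Module R M] [Module R N] :
    Submodule.span R (Set.range fun p : M × N => p.1 ⊗ₜ[R] p.2) = ⊤ := by
  rw [← TensorProduct.span_tmul_eq_top R M N]
  exact congrArg _ (Set.ext fun x => Prod.exists)

theorem exists_forall_apply_eq_of_span {R V W X J L : Type*} [CommSemiring R] [AddCommMonoid V]
    [Module R V] [AddCommMonoid W] [Module R W] [AddCommMonoid X] [Module R X] (U : V →ₗ[R] W)
    {p : J → W →ₗ[R] X} {y : L → W} (hy : Submodule.span R (Set.range y) = ⊤)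
    (h : ∀ (t : Finset J) (l : L), ∃ ξ, ∀ j ∈ t, p j (U ξ) = p j (y l)) (s : Finset (W →ₗ[R] X))
    (hs : (s : Set (W →ₗ[R] X)) ⊆ Submodule.span R (Set.range p)) (η : W) :
    ∃ ξ, ∀ ψ ∈ s, ψ (U ξ) = ψ η := by
  classical
  obtain ⟨t, ht⟩ := exists_finset_subset_span_image hs
  have hη : η ∈ Submodule.span R (Set.range y) := hy ▸ Submodule.mem_top
  obtain ⟨ξ, hξ⟩ : ∃ ξ, ∀ j ∈ t, p j (U ξ) = p j η := by
    induction hη using Submodule.span_induction with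
    | mem _ hx => obtain ⟨l, rfl⟩ := hx; exact h t l
    | zero => exact ⟨0, by simp⟩
    | add _ _ _ _ h₁ h₂ =>
      obtain ⟨ξ₁, h₁⟩ := h₁
      obtain ⟨ξ₂, h₂⟩ := h₂
      exact ⟨ξ₁ + ξ₂, fun j hj => by simp only [map_add, h₁ j hj, h₂ j hj]⟩
    | smul c _ _ h =>
      obtain ⟨ξ, h⟩ := h
      exact ⟨c • ξ, fun j hj => by simp only [map_smul, h j hj]⟩
  refine ⟨ξ, fun ψ hψ => ?_⟩
  have hle : Submodule.span R (p '' t) ≤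
      LinearMap.eqLocus (LinearMap.applyₗ (U ξ)) (LinearMap.applyₗ η) :=
    Submodule.span_le.2 (Set.image_subset_iff.2 hξ)
  exact hle (ht hψ)

theorem exists_linearEquiv_apply_eq {R V W X : Type*} [CommRing R] [AddCommGroup V] [Module R V]
    [AddCommGroup W] [Module R W] [AddCommGroup X] [Module R X] (U : V →ₗ[R] W)
    {P : Submodule R (W →ₗ[R] X)} {Q : Submodule R (V →ₗ[R] X)}
    (hmap : P.map (LinearMap.lcomp R X U) = Q)
    (dense : ∀ ψ ∈ P, ∀ η, ∃ ξ, ψ (U ξ) = ψ η) :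
    ∃ e : Q ≃ₗ[R] P, ∀ φ ξ, (e φ).1 (U ξ) = φ.1 ξ := by
  let restr : P →ₗ[R] Q := (LinearMap.lcomp R X U).restrict fun ψ hψ => by
    rw [← hmap]
    exact Submodule.mem_map_of_mem hψ
  have restr_injective : Function.Injective restr :=
    (injective_iff_map_eq_zero restr).2 fun ψ h => Subtype.ext <| LinearMap.ext fun η => by
      obtain ⟨ξ, hξ⟩ := dense ψ.1 ψ.2 η
      exact hξ.symm.trans (LinearMap.congr_fun (congrArg Subtype.val h) ξ)
  have restr_surjective : Function.Surjective restr := fun φ => by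
    obtain ⟨ψ, hψ, h⟩ := (hmap ▸ φ.2 : φ.1 ∈ P.map (LinearMap.lcomp R X U))
    exact ⟨⟨ψ, hψ⟩, Subtype.ext h⟩
  let e := LinearEquiv.ofBijective restr ⟨restr_injective, restr_surjective⟩
  exact ⟨e.symm, fun φ ξ =>
    LinearMap.congr_fun (congrArg Subtype.val (e.apply_symm_apply φ)) ξ⟩

end LinearAlgebra

section BoolEquiv

variable (R : Type*) [CommSemiring R] (M : ULift.{u} Bool → Type*) [∀ i, AddCommMonoid (M i)]
  [∀ i, Module R (M i)]

/-- The sum of two modules, as a finitely supported family indexed by a two-element type in the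
universe of the index sets of direct sums. -/
noncomputable def boolEquiv : (M ⟨true⟩ × M ⟨false⟩) ≃ₗ[R] Π₀ i, M i :=
  .ofLinearMap
    ((DFinsupp.lsingle (R := R) (M := M) ⟨true⟩).coprod
      (DFinsupp.lsingle (R := R) (M := M) ⟨false⟩))
    ((DFinsupp.lapply (R := R) (M := M) ⟨true⟩).prod (DFinsupp.lapply (R := R) (M := M) ⟨false⟩))
    (by ext ⟨_ | _⟩ x ⟨_ | _⟩ <;> simp)
    (by ext x <;> simp)

theorem boolEquiv_apply_true (ξ : M ⟨true⟩ × M ⟨false⟩) : boolEquiv R M ξ ⟨true⟩ = ξ.1 := by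
  simp [boolEquiv]

theorem boolEquiv_apply_false (ξ : M ⟨true⟩ × M ⟨false⟩) : boolEquiv R M ξ ⟨false⟩ = ξ.2 := by
  simp [boolEquiv]

variable {R M} in
theorem boolEquiv_eq_iff {ξ : M ⟨true⟩ × M ⟨false⟩} {η : Π₀ i, M i} :
    boolEquiv R M ξ = η ↔ ξ.1 = η ⟨true⟩ ∧ ξ.2 = η ⟨false⟩ := by
  rw [← LinearEquiv.eq_symm_apply]
  exact Prod.ext_iff

theorem map_iSup_map_lapply_boolEquiv {X : Type*} [AddCommMonoid X] [Module R X]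
    (P : ∀ i, Submodule R (M i →ₗ[R] X)) :
    (⨆ i, (P i).map (LinearMap.lcomp R X (DFinsupp.lapply i))).map
        (LinearMap.lcomp R X (boolEquiv R M).toLinearMap) =
      (P ⟨true⟩).map (LinearMap.lcomp R X (LinearMap.fst R _ _)) ⊔
        (P ⟨false⟩).map (LinearMap.lcomp R X (LinearMap.snd R _ _)) := by
  rw [← Equiv.ulift.symm.iSup_comp, iSup_bool_eq, Submodule.map_sup, ← Submodule.map_comp,
    ← Submodule.map_comp]
  congr 2 <;> refine LinearMap.ext fun φ => LinearMap.ext fun ξ => congrArg φ ?_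
  · exact boolEquiv_apply_true R M ξ
  · exact boolEquiv_apply_false R M ξ

end BoolEquiv

namespace GAlgebra

variable {G : Type v} [Group G] {A : GAlgebra.{u, v} G}

theorem hasApproxUnit_iff_forall_finset :
    A.HasApproxUnit ↔ ∀ s : Finset A, ∃ e : A, ∀ a ∈ s, e * a = a ∧ a * e = a := by
  classical
  constructor
  · rintro ⟨I, _, _, _, x, hx⟩ s
    choose j hj using hx
    obtain ⟨i, hi⟩ := (s.image j).exists_le
    exact ⟨x i, fun a ha => hj a i (hi _ (Finset.mem_image_of_mem j ha))⟩
  · intro h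
    choose e he using h
    exact ⟨Finset A, inferInstance, inferInstance, inferInstance, e,
      fun a => ⟨{a}, fun s hs => he s a (Finset.singleton_subset_iff.1 hs)⟩⟩

theorem HasApproxUnit.of_span {J : Type*} {x : J → A} (hx : Submodule.span ℂ (Set.range x) = ⊤)
    (h : ∀ t : Finset J, ∃ e : A, ∀ j ∈ t, e * x j = x j ∧ x j * e = x j) : A.HasApproxUnit :=
  hasApproxUnit_iff_forall_finset.2 fun _ =>
    exists_subset_of_subset_span
      (fun e : A => LinearMap.eqLocus (LinearMap.mulLeft ℂ e) LinearMap.id ⊓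
        LinearMap.eqLocus (LinearMap.mulRight ℂ e) LinearMap.id)
      h (by rw [hx]; exact Set.subset_univ _)

theorem HasApproxUnit.exists_mul_eq_of_finite (h : A.HasApproxUnit) {J : Type*} (t : Finset J)
    (a : J → A) : ∃ e : A, ∀ j ∈ t, e * a j = a j ∧ a j * e = a j := by
  classical
  obtain ⟨e, he⟩ := hasApproxUnit_iff_forall_finset.1 h (t.image a)
  exact ⟨e, fun j hj => he _ (Finset.mem_image_of_mem a hj)⟩

theorem HasApproxUnit.tensor {B : GAlgebra.{u, v} G}
    (hA : A.HasApproxUnit) (hB : B.HasApproxUnit) : (A.tensor B).HasApproxUnit := by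
  refine .of_span (x := fun p : A × B => p.1 ⊗ₜ[ℂ] p.2) span_range_tmul fun t => ?_
  obtain ⟨e, he⟩ := hA.exists_mul_eq_of_finite t Prod.fst
  obtain ⟨f, hf⟩ := hB.exists_mul_eq_of_finite t Prod.snd
  exact ⟨e ⊗ₜ[ℂ] f, fun p hp =>
    ⟨(Algebra.TensorProduct.tmul_mul_tmul ..).trans (by rw [(he p hp).1, (hf p hp).1]),
      (Algebra.TensorProduct.tmul_mul_tmul ..).trans (by rw [(he p hp).2, (hf p hp).2])⟩⟩

end GAlgebra

namespace FunctionalModule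

variable {G : Type v} [Group G] {A : GAlgebra.{u, v} G}

section LocalUnits

variable {E : FunctionalModule A}

theorem theta_apply (η ξ : E) (φ : E →ₗ[ℂ] A) : E.theta η φ ξ = E.rmul η (φ ξ) := rfl

theorem theta_mem_compact (η : E) {φ : E →ₗ[ℂ] A} (hφ : φ ∈ E.functionals) :
    E.theta η φ ∈ E.compactSubalgebra :=
  Submodule.subset_span ⟨η, φ, hφ, rfl⟩

theorem compact_induction {p : (T : Module.End ℂ E) → T ∈ E.compactSubalgebra → Prop}
    (zero : p 0 (zero_mem _))
    (add : ∀ S T hS hT, p S hS → p T hT → p (S + T) (add_mem hS hT))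
    (theta : ∀ η φ hφ, p (E.theta η φ) (theta_mem_compact η hφ))
    {T : Module.End ℂ E} (hT : T ∈ E.compactSubalgebra) : p T hT := by
  refine Submodule.closure_induction (s := {T | ∃ η : E, ∃ φ ∈ E.functionals, T = E.theta η φ})
    (p := p) zero add ?_ hT
  rintro c _ ⟨η, φ, hφ, rfl⟩
  have hc : c • E.theta η φ = E.theta (c • η) φ := by ext; simp [theta_apply]
  simpa only [hc] using theta (c • η) φ hφ

theorem mul_theta {T : Module.End ℂ E} (hT : T ∈ E.compactSubalgebra) (η : E) (φ : E →ₗ[ℂ] A) :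
    T * E.theta η φ = E.theta (T η) φ :=
  LinearMap.ext fun ξ => E.compact_rmul T hT η (φ ξ)

theorem theta_mul_end (η : E) (φ : E →ₗ[ℂ] A) (T : Module.End ℂ E) :
    E.theta η φ * T = E.theta η (φ ∘ₗ T) := rfl

theorem functional_comp_compact {φ : E →ₗ[ℂ] A} (hφ : φ ∈ E.functionals) {T : Module.End ℂ E}
    (hT : T ∈ E.compactSubalgebra) : φ ∘ₗ T ∈ E.functionals := by
  induction hT using compact_induction with
  | zero => simp
  | add S T _ _ hS hT => rw [LinearMap.comp_add]; exact add_mem hS hT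
  | theta η ψ hψ =>
    convert E.lmul_mem (φ η) ψ hψ using 1
    ext ξ
    simp [theta_apply, E.functional_rmul φ hφ]

/-- `E` and its functional space have local units among the compact operators: every finite set of
elements is fixed by some `T ∈ 𝒦_A(E)`, and every finite set of functionals is fixed by
precomposition with some `T ∈ 𝒦_A(E)`. -/
structure LocallyUnital (E : FunctionalModule A) : Prop where
  left : ∀ s : Finset E, ∃ T ∈ E.compactSubalgebra, ∀ ξ ∈ s, T ξ = ξ
  right : ∀ s : Finset E.functionals, ∃ T ∈ E.compactSubalgebra, ∀ φ ∈ s, φ.1 ∘ₗ T = φ.1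

theorem LocallyUnital.of_span {J L : Type*} {x : J → E} {p : L → E →ₗ[ℂ] A}
    (hx : Submodule.span ℂ (Set.range x) = ⊤)
    (hp : E.functionals ≤ Submodule.span ℂ (Set.range p))
    (left : ∀ t : Finset J, ∃ T ∈ E.compactSubalgebra, ∀ j ∈ t, T (x j) = x j)
    (right : ∀ t : Finset L, ∃ T ∈ E.compactSubalgebra, ∀ l ∈ t, p l ∘ₗ T = p l) :
    E.LocallyUnital where
  left s := by
    obtain ⟨T, hT⟩ := exists_subset_of_subset_span
      (fun T : E.compactSubalgebra => LinearMap.eqLocus T.1 LinearMap.id)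
      (fun t => let ⟨T, hT, h⟩ := left t; ⟨⟨T, hT⟩, h⟩)
      (show (s : Set E) ⊆ _ by rw [hx]; exact Set.subset_univ _)
    exact ⟨T.1, T.2, hT⟩
  right s := by
    classical
    obtain ⟨T, hT⟩ := exists_subset_of_subset_span
      (fun T : E.compactSubalgebra => LinearMap.eqLocus (LinearMap.lcomp ℂ A T.1) LinearMap.id)
      (fun t => let ⟨T, hT, h⟩ := right t; ⟨⟨T, hT⟩, h⟩)
      (s := s.image Subtype.val)
      (by rw [Finset.coe_image]; exact Set.image_subset_iff.2 fun φ _ => hp φ.2)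
    exact ⟨T.1, T.2, fun φ hφ => hT (Finset.mem_coe.2 (Finset.mem_image_of_mem _ hφ))⟩

theorem LocallyUnital.exists_left (hE : E.LocallyUnital) {J : Type*} (t : Finset J) (x : J → E) :
    ∃ T ∈ E.compactSubalgebra, ∀ j ∈ t, T (x j) = x j := by
  classical
  obtain ⟨T, hT, h⟩ := hE.left (t.image x)
  exact ⟨T, hT, fun j hj => h _ (Finset.mem_image_of_mem x hj)⟩

theorem LocallyUnital.exists_right (hE : E.LocallyUnital) {J : Type*} (t : Finset J)
    (p : J → E.functionals) : ∃ T ∈ E.compactSubalgebra, ∀ j ∈ t, (p j).1 ∘ₗ T = (p j).1 := by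
  classical
  obtain ⟨T, hT, h⟩ := hE.right (t.image p)
  exact ⟨T, hT, fun j hj => h _ (Finset.mem_image_of_mem p hj)⟩

theorem smul_rmul (c : ℂ) (ξ : E) (a : A) : c • E.rmul ξ a = E.rmul (c • ξ) a := by simp

theorem smul_lmul (c : ℂ) (a : A) (φ : E.functionals) : c • E.lmul a φ = E.lmul a (c • φ) :=
  Subtype.ext <| LinearMap.ext fun ξ => by simp [lmul]

theorem cofull_iff_span_eq_top :
    E.Cofull ↔ Submodule.span ℂ
      (Set.range fun p : E × E.functionals × E => E.rmul p.1 (p.2.1.1 p.2.2)) = ⊤ := by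
  have hrange : {x : E | ∃ ξ : E, ∃ φ : E.functionals, ∃ η : E, x = E.rmul ξ (φ.1 η)} =
      Set.range fun p : E × E.functionals × E => E.rmul p.1 (p.2.1.1 p.2.2) := by
    ext; simp [eq_comm]
  rw [Cofull, Submodule.eq_top_iff', hrange]
  refine forall_congr' fun ζ => mem_addSubmonoidClosure_iff_mem_span ?_
  rintro c _ ⟨⟨ξ, φ, η⟩, rfl⟩
  exact ⟨(c • ξ, φ, η), (smul_rmul c ξ _).symm⟩

theorem dualCofull_iff_span_eq_top :
    E.DualCofull ↔ Submodule.span ℂ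
      (Set.range fun p : E.functionals × E × E.functionals =>
        E.lmul (p.1.1 p.2.1) p.2.2) = ⊤ := by
  have hrange : {x : E.functionals | ∃ φ : E.functionals, ∃ ξ : E, ∃ τ : E.functionals,
      x = E.lmul (φ.1 ξ) τ} = Set.range fun p : E.functionals × E × E.functionals =>
        E.lmul (p.1.1 p.2.1) p.2.2 := by
    ext; simp [eq_comm]
  rw [DualCofull, Submodule.eq_top_iff', hrange]
  refine forall_congr' fun ψ => mem_addSubmonoidClosure_iff_mem_span ?_
  rintro c _ ⟨⟨φ, ξ, τ⟩, rfl⟩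
  exact ⟨(φ, ξ, c • τ), (smul_lmul c _ τ).symm⟩

theorem LocallyUnital.cofull (hE : E.LocallyUnital) : E.Cofull := by
  refine cofull_iff_span_eq_top.2 (Submodule.eq_top_iff'.2 fun ζ => ?_)
  obtain ⟨T, hT, h⟩ := hE.left {ζ}
  rw [← h ζ (Finset.mem_singleton_self ζ)]
  clear h
  induction hT using compact_induction with
  | zero => simp
  | add S T _ _ hS hT => exact add_mem hS hT
  | theta η φ hφ => exact Submodule.subset_span ⟨(η, ⟨φ, hφ⟩, ζ), rfl⟩

theorem LocallyUnital.dualCofull (hE : E.LocallyUnital) : E.DualCofull := by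
  refine dualCofull_iff_span_eq_top.2 (Submodule.eq_top_iff'.2 fun ψ => ?_)
  obtain ⟨T, hT, h⟩ := hE.right {ψ}
  suffices hψ : ψ.1 ∘ₗ T ∈ (Submodule.span ℂ _).map E.functionals.subtype by
    rw [h ψ (Finset.mem_singleton_self ψ)] at hψ
    exact (E.functionals.injective_subtype.mem_set_image).1 hψ
  clear h
  induction hT using compact_induction with
  | zero => simp
  | add S T _ _ hS hT => rw [LinearMap.comp_add]; exact add_mem hS hT
  | theta η φ hφ =>
    refine ⟨E.lmul (ψ.1 η) ⟨φ, hφ⟩, Submodule.subset_span ⟨(ψ, η, ⟨φ, hφ⟩), rfl⟩, ?_⟩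
    ext ξ
    simp [lmul, theta_apply, E.functional_rmul ψ.1 ψ.2]

theorem LocallyUnital.compact_approxUnit (hE : E.LocallyUnital) : E.compact.HasApproxUnit := by
  let x : E × E.functionals → E.compact := fun p =>
    (⟨E.theta p.1 p.2.1, theta_mem_compact p.1 p.2.2⟩ : E.compactSubalgebra)
  refine GAlgebra.HasApproxUnit.of_span (x := x) ?_ fun t => ?_
  · rw [Submodule.eq_top_iff']
    rintro ⟨T, hT⟩
    induction hT using compact_induction with
    | zero => exact zero_mem _
    | add S T _ _ hS hT => exact add_mem hS hT
    | theta η φ hφ => exact Submodule.subset_span ⟨(η, ⟨φ, hφ⟩), rfl⟩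
  · obtain ⟨S, hS, hSt⟩ := hE.exists_left t Prod.fst
    obtain ⟨T, hT, hTt⟩ := hE.exists_right t Prod.snd
    let S' : E.compactSubalgebra := ⟨S, hS⟩
    let T' : E.compactSubalgebra := ⟨T, hT⟩
    refine ⟨S' + T' - T' * S', fun p hp => ⟨Subtype.ext ?_, Subtype.ext ?_⟩⟩
    · have hSp : S p.1 = p.1 := hSt p hp
      change (S + T - T * S) * E.theta p.1 p.2.1 = E.theta p.1 p.2.1
      rw [mul_theta (sub_mem (add_mem hS hT) (mul_mem hT hS))]
      simp [hSp]
    · have hTp : p.2.1 ∘ₗ T = p.2.1 := hTt p hp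
      change E.theta p.1 p.2.1 * (S + T - T * S) = E.theta p.1 p.2.1
      rw [theta_mul_end]
      simp [LinearMap.comp_sub, ← LinearMap.comp_assoc, Module.End.mul_eq_comp, hTp,
        LinearMap.comp_add]

theorem exists_compact_mul_theta_eq (hK : E.compact.HasApproxUnit) {L : Type*} (t : Finset L)
    (ξ : L → E) (φ : L → E.functionals) :
    ∃ T ∈ E.compactSubalgebra, ∀ l ∈ t, T * E.theta (ξ l) (φ l).1 = E.theta (ξ l) (φ l).1 ∧
      E.theta (ξ l) (φ l).1 * T = E.theta (ξ l) (φ l).1 := by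
  obtain ⟨⟨T, hT⟩, h⟩ := hK.exists_mul_eq_of_finite t fun l =>
    (⟨_, theta_mem_compact (ξ l) (φ l).2⟩ : E.compactSubalgebra)
  exact ⟨T, hT, fun l hl => (h l hl).imp (congrArg Subtype.val) (congrArg Subtype.val)⟩

theorem locallyUnital_iff :
    E.LocallyUnital ↔ E.Cofull ∧ E.DualCofull ∧ E.compact.HasApproxUnit := by
  refine ⟨fun hE => ⟨hE.cofull, hE.dualCofull, hE.compact_approxUnit⟩, fun ⟨hE, hE', hK⟩ => ?_⟩
  refine .of_span (cofull_iff_span_eq_top.1 hE)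
    (p := fun p : E.functionals × E × E.functionals => (E.lmul (p.1.1 p.2.1) p.2.2).1)
    (fun ψ hψ => ?_) (fun t => ?_) (fun t => ?_)
  · have h := Submodule.mem_map_of_mem (f := E.functionals.subtype)
      (dualCofull_iff_span_eq_top.1 hE' ▸ Submodule.mem_top : (⟨ψ, hψ⟩ : E.functionals) ∈ _)
    rwa [Submodule.map_span, ← Set.range_comp] at h
  · obtain ⟨T, hT, h⟩ := exists_compact_mul_theta_eq hK t (fun p => p.1) (fun p => p.2.1)
    exact ⟨T, hT, fun p hp => LinearMap.congr_fun (h p hp).1 p.2.2⟩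
  · obtain ⟨T, hT, h⟩ := exists_compact_mul_theta_eq hK t (fun p => p.2.1) (fun p => p.2.2)
    refine ⟨T, hT, fun ⟨φ, ξ, τ⟩ hp => LinearMap.ext fun ζ => ?_⟩
    have hζ : E.rmul ξ (τ.1 (T ζ)) = E.rmul ξ (τ.1 ζ) := LinearMap.congr_fun (h _ hp).2 ζ
    simpa [lmul, E.functional_rmul φ.1 φ.2] using congrArg φ.1 hζ

end LocalUnits

section Extensions

variable {E F : FunctionalModule A}

/-- The composition of homomorphisms of functional modules, used to compose functional
extensions. -/
def Hom.comp {H : FunctionalModule A} (V : Hom F H) (U : Hom E F) : Hom E H where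
  toFun := V.toFun ∘ₗ U.toFun
  map_rmul ξ a := by simp [U.map_rmul, V.map_rmul]
  map_act g ξ := by simp [U.map_act, V.map_act]
  dual := V.dual ∘ₗ U.dual
  dual_lmul a φ := by simp [U.dual_lmul, V.dual_lmul]
  dual_act g φ := by simp [U.dual_act, V.dual_act]
  pairing φ ξ := by simp [U.pairing, V.pairing]

theorem Hom.IsExtension.comp {H : FunctionalModule A} {V : Hom F H} {U : Hom E F}
    (hV : V.IsExtension) (hU : U.IsExtension) : (V.comp U).IsExtension := by
  classical
  refine ⟨hV.1.comp hU.1, fun s ζ => ?_⟩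
  obtain ⟨η, hη⟩ := hV.2 (s.image U.dual) ζ
  obtain ⟨ξ, hξ⟩ := hU.2 s η
  exact ⟨ξ, fun φ hφ => (hη _ (Finset.mem_image_of_mem _ hφ)).trans (hξ φ hφ)⟩

/-- `E` has a functional extension into some plain module `(A ⊗ ℂ^n, α ⊗ μ)`. -/
def EmbedsInPlain (E : FunctionalModule A) : Prop :=
  ∃ (n : Type u) (μ : Representation ℂ G (n →₀ ℂ)) (hμ : RowFinite μ)
    (U : Hom E (plain A n μ hμ)), U.IsExtension

theorem Hom.IsExtension.embedsInPlain {U : Hom E F} (hU : U.IsExtension) (hF : F.EmbedsInPlain) :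
    E.EmbedsInPlain :=
  let ⟨n, μ, hμ, _, hV⟩ := hF
  ⟨n, μ, hμ, _, hV.comp hU⟩

theorem inClassC_iff :
    E.InClassC ↔ A.HasApproxUnit ∧ E.LocallyUnital ∧ E.EmbedsInPlain :=
  ⟨fun h => ⟨h.approxUnit, locallyUnital_iff.2 ⟨h.cofull, h.dualCofull, h.compact_approxUnit⟩,
    h.exists_extension⟩,
  fun ⟨hA, hE, hU⟩ => ⟨hA, hE.cofull, hE.dualCofull, hE.compact_approxUnit, hU⟩⟩

/- By density a functional in `P` is determined by its restriction along `U`, so that `U^*` can be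
defined as the inverse of the restriction; density also makes it left `A`-linear. -/
theorem exists_isExtension_of_submodule (U : E →ₗ[ℂ] F) (hU : Function.Injective U)
    (map_rmul : ∀ ξ a, U (E.rmul ξ a) = F.rmul (U ξ) a)
    (map_act : ∀ g ξ, U (E.act g ξ) = F.act g (U ξ))
    {P : Submodule ℂ (F →ₗ[ℂ] A)} (hP : P ≤ F.functionals)
    (hmap : P.map (LinearMap.lcomp ℂ A U) = E.functionals)
    (hact : ∀ g, ∀ ψ ∈ P, A.act g ∘ₗ ψ ∘ₗ F.act g⁻¹ ∈ P)
    (dense : ∀ s : Finset (F →ₗ[ℂ] A), (s : Set (F →ₗ[ℂ] A)) ⊆ P →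
      ∀ η, ∃ ξ, ∀ ψ ∈ s, ψ (U ξ) = ψ η) :
    ∃ V : Hom E F, V.IsExtension := by
  classical
  have dense₂ (ψ ψ' : P) (η : F) : ∃ ξ, ψ.1 (U ξ) = ψ.1 η ∧ ψ'.1 (U ξ) = ψ'.1 η := by
    obtain ⟨ξ, hξ⟩ := dense {ψ.1, ψ'.1} (by simp [Set.insert_subset_iff]) η
    exact ⟨ξ, hξ _ (by simp), hξ _ (by simp)⟩
  obtain ⟨e, pairing⟩ := exists_linearEquiv_apply_eq U hmap fun ψ hψ η =>
    (dense₂ ⟨ψ, hψ⟩ ⟨ψ, hψ⟩ η).imp fun _ => And.left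
  let V : Hom E F :=
    { toFun := U
      map_rmul := map_rmul
      map_act := map_act
      dual := Submodule.inclusion hP ∘ₗ e.toLinearMap
      dual_lmul := fun a φ => Subtype.ext <| LinearMap.ext fun η => by
        obtain ⟨ξ, hξ, hξ'⟩ := dense₂ (e φ) (e (E.lmul a φ)) η
        change (e (E.lmul a φ)).1 η = a * (e φ).1 η
        rw [← hξ', ← hξ, pairing, pairing]
        rfl
      dual_act := fun g φ => by
        refine congrArg (Submodule.inclusion hP) (?_ : _ = ⟨_, hact g (e φ).1 (e φ).2⟩)
        refine e.eq_symm_apply.1 (Subtype.ext <| LinearMap.ext fun ξ => ?_)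
        rw [← pairing (e.symm _), e.apply_symm_apply]
        change A.act g (φ.1 (E.act g⁻¹ ξ)) = A.act g ((e φ).1 (F.act g⁻¹ (U ξ)))
        rw [← map_act, pairing]
      pairing := pairing }
  refine ⟨V, hU, fun s η => ?_⟩
  obtain ⟨ξ, hξ⟩ := dense (s.image fun φ => (e φ).1)
    (by rw [Finset.coe_image]; exact Set.image_subset_iff.2 fun φ _ => (e φ).2) η
  exact ⟨ξ, fun φ hφ =>
    (hξ _ (Finset.mem_image_of_mem _ hφ)).symm.trans (pairing φ ξ)⟩

theorem exists_isExtension {J L : Type*} (U : E →ₗ[ℂ] F) (hU : Function.Injective U)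
    (map_rmul : ∀ ξ a, U (E.rmul ξ a) = F.rmul (U ξ) a)
    (map_act : ∀ g ξ, U (E.act g ξ) = F.act g (U ξ))
    {p : J → F →ₗ[ℂ] A} (hp : ∀ j, p j ∈ F.functionals)
    (hspan : E.functionals = Submodule.span ℂ (Set.range fun j => p j ∘ₗ U))
    (hact : ∀ g j, A.act g ∘ₗ p j ∘ₗ F.act g⁻¹ ∈ Submodule.span ℂ (Set.range p))
    {y : L → F} (hy : Submodule.span ℂ (Set.range y) = ⊤)
    (dense : ∀ (t : Finset J) (l : L), ∃ ξ, ∀ j ∈ t, p j (U ξ) = p j (y l)) :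
    ∃ V : Hom E F, V.IsExtension := by
  refine exists_isExtension_of_submodule U hU map_rmul map_act
    (Submodule.span_le.2 (Set.range_subset_iff.2 hp)) ?_ (fun g => ?_)
    (exists_forall_apply_eq_of_span U hy dense)
  · rw [hspan, Submodule.map_span, ← Set.range_comp]
    rfl
  · have hle : Submodule.span ℂ (Set.range p) ≤ (Submodule.span ℂ (Set.range p)).comap
        (LinearMap.llcomp ℂ F A A (A.act g) ∘ₗ LinearMap.lcomp ℂ A (F.act g⁻¹)) :=
      Submodule.span_le.2 (Set.range_subset_iff.2 (hact g))
    exact hle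

theorem exists_isExtension_of_equiv (U : E ≃ₗ[ℂ] F)
    (map_rmul : ∀ ξ a, U (E.rmul ξ a) = F.rmul (U ξ) a)
    (map_act : ∀ g ξ, U (E.act g ξ) = F.act g (U ξ))
    (hmap : F.functionals.map (LinearMap.lcomp ℂ A U.toLinearMap) = E.functionals) :
    ∃ V : Hom E F, V.IsExtension :=
  exists_isExtension_of_submodule U.toLinearMap U.injective map_rmul map_act le_rfl hmap F.act_mem
    fun _ _ η => ⟨U.symm η, fun ψ _ => congrArg ψ (U.apply_symm_apply η)⟩

theorem LocallyUnital.injective_of_functionals (hE : E.LocallyUnital) (U : E →ₗ[ℂ] F) {J : Type*}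
    {p : J → F →ₗ[ℂ] A}
    (hspan : E.functionals = Submodule.span ℂ (Set.range fun j => p j ∘ₗ U)) :
    Function.Injective U := by
  refine (injective_iff_map_eq_zero U).2 fun ξ hξ => ?_
  have functional_eq_zero : ∀ φ ∈ E.functionals, φ ξ = 0 := by
    have hle : E.functionals ≤ LinearMap.ker (LinearMap.applyₗ (R := ℂ) (M₂ := A) ξ) := by
      rw [hspan, Submodule.span_le, Set.range_subset_iff]
      simp [hξ]
    exact hle
  obtain ⟨T, hT, h⟩ := hE.left {ξ}
  rw [← h ξ (Finset.mem_singleton_self ξ)]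
  clear h
  induction hT using compact_induction with
  | zero => rfl
  | add S T _ _ hS hT => rw [LinearMap.add_apply, hS, hT, add_zero]
  | theta η φ hφ => rw [theta_apply, functional_eq_zero φ hφ, map_zero]

end Extensions

section Free

variable {n : Type u}

theorem freeMul_single (i : n) (a b : A) :
    freeMul A n (Finsupp.single i a) b = Finsupp.single i (a * b) := by
  simp [freeMul]

theorem row_single_right (b : n →₀ A) (i : n) (a : A) :
    row A n b (Finsupp.single i a) = b i * a := by
  have row_eq_sum : row A n b (Finsupp.single i a) =
      b.sum fun j c => c * (Finsupp.single i a : n →₀ A) j := by simp [row]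
  rw [row_eq_sum, Finsupp.sum_eq_single i, Finsupp.single_eq_same]
  · intro j _ hj
    rw [Finsupp.single_eq_of_ne hj, mul_zero]
  · simp

theorem range_row : LinearMap.range (row A n) =
    Submodule.span ℂ (Set.range fun p : n × A => row A n (Finsupp.single p.1 p.2)) := by
  rw [← Submodule.map_top, ← span_range_single, Submodule.map_span, ← Set.range_comp]
  rfl

theorem span_range_rangeRestrict_row : Submodule.span ℂ
    (Set.range fun j : n × A => (row A n).rangeRestrict (Finsupp.single j.1 j.2)) = ⊤ := by
  refine .trans ?_ (LinearMap.range_rangeRestrict (row A n))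
  rw [LinearMap.range_eq_map (row A n).rangeRestrict, ← span_range_single, Submodule.map_span,
    ← Set.range_comp]
  rfl

theorem tensorAct_apply {μ : Representation ℂ G (n →₀ ℂ)} (hμ : RowFinite μ) (g : G) (x : n →₀ A)
    (i : n) : tensorAct A μ g x i =
      ∑ j ∈ (hμ g i).toFinset, μ g (Finsupp.single j 1) i • A.act g (x j) := by
  classical
  induction x using Finsupp.induction_linear with
  | zero => simp
  | add x y hx hy => simp [hx, hy, Finset.sum_add_distrib]
  | single j a =>
    rw [tensorAct_single, Finset.sum_eq_single j]
    · simp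
    · intro k _ hk
      simp [Finsupp.single_eq_of_ne hk]
    · intro hj
      simp_all

theorem row_mapDomain {m : Type u} {f : n → m} (hf : Function.Injective f) (b : n →₀ A)
    (x : m →₀ A) :
    row A m (b.mapDomain f) x = row A n b (Finsupp.lcomapDomain (R := ℂ) f hf x) := by
  induction b using Finsupp.induction_linear with
  | zero => simp
  | add b c hb hc => simp only [map_add, LinearMap.add_apply, hb, hc, Finsupp.mapDomain_add]
  | single i b => rw [Finsupp.mapDomain_single, row_single, row_single]; rfl

variable {S : Representation ℂ G (n →₀ A)}
  {hS : ∀ g ξ a, S g (freeMul A n ξ a) = freeMul A n (S g ξ) (A.act g a)}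
  {hrow : ∀ g, ∀ φ ∈ LinearMap.range (row A n),
    A.act g ∘ₗ φ ∘ₗ S g⁻¹ ∈ LinearMap.range (row A n)}

open scoped Classical in
theorem exists_compact_free_apply (t : Finset n) (e : A) :
    ∃ T : Module.End ℂ (n →₀ A), T ∈ (free A n S hS hrow).compactSubalgebra ∧
      ∀ ξ i, T ξ i = if i ∈ t then e * (e * ξ i) else 0 := by
  let T : Module.End ℂ (n →₀ A) :=
    ∑ i ∈ t, freeMul A n (Finsupp.single i e) ∘ₗ row A n (Finsupp.single i e)
  refine ⟨T, sum_mem fun i _ => theta_mem_compact _ ⟨_, rfl⟩, fun ξ i => ?_⟩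
  simp [T, row_single, freeMul_single, Finsupp.finsetSum_apply, Finsupp.single_apply]

theorem free_locallyUnital (hA : A.HasApproxUnit) : (free A n S hS hrow).LocallyUnital := by
  classical
  refine .of_span (x := fun p : n × A => (Finsupp.single p.1 p.2 : n →₀ A))
    (p := fun p : n × A => row A n (Finsupp.single p.1 p.2)) span_range_single range_row.le
    (fun t => ?_) (fun t => ?_)
  · obtain ⟨e, he⟩ := hA.exists_mul_eq_of_finite t Prod.snd
    obtain ⟨T, hT, T_apply⟩ := exists_compact_free_apply (hS := hS) (hrow := hrow)
      (t.image Prod.fst) e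
    refine ⟨T, hT, fun p hp => Finsupp.ext fun i => (T_apply _ i).trans ?_⟩
    obtain rfl | hi := eq_or_ne p.1 i
    · rw [if_pos (Finset.mem_image_of_mem _ hp), Finsupp.single_eq_same, (he p hp).1, (he p hp).1]
    · simp [Finsupp.single_eq_of_ne hi.symm]
  · obtain ⟨e, he⟩ := hA.exists_mul_eq_of_finite t Prod.snd
    obtain ⟨T, hT, T_apply⟩ := exists_compact_free_apply (hS := hS) (hrow := hrow)
      (t.image Prod.fst) e
    refine ⟨T, hT, fun p hp => LinearMap.ext fun (ξ : n →₀ A) => ?_⟩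
    change row A n (Finsupp.single p.1 p.2) (T ξ) = row A n (Finsupp.single p.1 p.2) ξ
    rw [row_single, row_single, T_apply, if_pos (Finset.mem_image_of_mem _ hp), ← mul_assoc,
      ← mul_assoc, (he p hp).2, (he p hp).2]

theorem plain_embedsInPlain (μ : Representation ℂ G (n →₀ ℂ)) (hμ : RowFinite μ) :
    (plain A n μ hμ).EmbedsInPlain :=
  ⟨n, μ, hμ, exists_isExtension_of_equiv (.refl ℂ _) (fun _ _ => rfl) (fun _ _ => rfl)
    (Submodule.map_id _)⟩

theorem plain_inClassC (hA : A.HasApproxUnit) (μ : Representation ℂ G (n →₀ ℂ))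
    (hμ : RowFinite μ) : (plain A n μ hμ).InClassC :=
  inClassC_iff.2 ⟨hA, free_locallyUnital hA, plain_embedsInPlain μ hμ⟩

end Free

section FiniteGroup

/-- The linear representation on `ℂ^n` of a permutation action on `n`. -/
noncomputable def permRep {n : Type u} (σ : G →* Equiv.Perm n) : Representation ℂ G (n →₀ ℂ) where
  toFun g := Finsupp.lmapDomain ℂ ℂ (σ g)
  map_one' := by ext; simp
  map_mul' g h := by ext; simp

theorem rowFinite_permRep {n : Type u} (σ : G →* Equiv.Perm n) : RowFinite (permRep σ) := by
  classical
  refine fun g i => (Set.finite_singleton (σ g⁻¹ i)).subset fun j hj => ?_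
  have : σ g j = i := by
    by_contra h
    exact hj (by simp [permRep, h])
  simp [← this]

theorem tensorAct_permRep {n : Type u} (σ : G →* Equiv.Perm n) (g : G) (x : n →₀ A) (i : n) :
    tensorAct A (permRep σ) g x i = A.act g (x (σ g⁻¹ i)) := by
  classical
  induction x using Finsupp.induction_linear with
  | zero => simp
  | add x y hx hy => simp only [map_add, Finsupp.add_apply, hx, hy]
  | single j a =>
    obtain rfl | h := eq_or_ne (σ g j) i
    · simp [tensorAct_single, permRep]
    · have h' : (σ g).symm i ≠ j := by rwa [ne_eq, Equiv.symm_apply_eq, eq_comm]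
      simp [tensorAct_single, permRep, Finsupp.single_eq_of_ne h.symm,
        Finsupp.single_eq_of_ne h']

variable {n : Type u} {J : Type} (e : G ≃ J)

/-- The action of `G` on `n × J` by left translation in the second factor, which a bijection with
`G` identifies with `G` itself. -/
def translation (n : Type u) {J : Type} (e : G ≃ J) : G →* Equiv.Perm (n × J) where
  toFun g := (Equiv.refl n).prodCongr (e.permCongr (Equiv.mulLeft g))
  map_one' := by ext x <;> simp
  map_mul' g h := by ext x <;> simp

theorem translation_apply (n : Type u) {J : Type} (e : G ≃ J) (g : G) (i : n) (t : J) :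
    translation n e g (i, t) = (i, e (g * e.symm t)) := by
  simp [translation]

/-- The restriction of a function on `n × J` to the slice `n × {t}`. -/
noncomputable def slice (A : GAlgebra.{u, v} G) (n : Type u) {J : Type} (t : J) :
    (n × J →₀ A) →ₗ[ℂ] (n →₀ A) :=
  Finsupp.lcomapDomain (fun i => (i, t)) (Prod.mk_left_injective t)

theorem slice_apply (t : J) (x : n × J →₀ A) (i : n) : slice A n t x i = x (i, t) := rfl

variable [Fintype J] (S : Representation ℂ G (n →₀ A))

/-- The embedding `ξ ↦ ∑ h, (α_h ⊗ 1) S_{h⁻¹} ξ ⊗ δ_h` of a module `A^n` with `G`-action `S` into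
`A^n ⊗ ℂ^G` with the action `α ⊗ 1 ⊗ λ`, where `λ` is left translation. -/
noncomputable def orbitEmb : (n →₀ A) →ₗ[ℂ] (n × J →₀ A) :=
  ∑ t, Finsupp.lmapDomain A ℂ (fun i => (i, t)) ∘ₗ
    Finsupp.mapRange.linearMap (A.act (e.symm t)) ∘ₗ S (e.symm t)⁻¹

/-- The equivariant left inverse of `orbitEmb` which averages over `G`. -/
noncomputable def orbitAvg : (n × J →₀ A) →ₗ[ℂ] (n →₀ A) :=
  (Fintype.card J : ℂ)⁻¹ • ∑ t, S (e.symm t) ∘ₗ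
    Finsupp.mapRange.linearMap (A.act (e.symm t)⁻¹) ∘ₗ slice A n t

theorem orbitEmb_apply (ξ : n →₀ A) (i : n) (t : J) :
    orbitEmb e S ξ (i, t) = A.act (e.symm t) (S (e.symm t)⁻¹ ξ i) := by
  classical
  rw [orbitEmb, LinearMap.sum_apply, Finsupp.finsetSum_apply,
    Finset.sum_eq_single_of_mem t (Finset.mem_univ t)]
  · simp [Finsupp.mapDomain_apply (Prod.mk_left_injective t)]
  · refine fun s _ hs => Finsupp.mapDomain_of_notMem_range _ _ ?_
    rintro ⟨k, hk⟩
    exact hs (congrArg Prod.snd hk)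

theorem slice_orbitEmb (ξ : n →₀ A) (t : J) :
    slice A n t (orbitEmb e S ξ) =
      Finsupp.mapRange.linearMap (A.act (e.symm t)) (S (e.symm t)⁻¹ ξ) :=
  Finsupp.ext fun i => orbitEmb_apply e S ξ i t

theorem orbitAvg_orbitEmb (ξ : n →₀ A) : orbitAvg e S (orbitEmb e S ξ) = ξ := by
  have summand_eq (t : J) : S (e.symm t) (Finsupp.mapRange.linearMap (A.act (e.symm t)⁻¹)
      (slice A n t (orbitEmb e S ξ))) = ξ := by
    have mapRange_inv (η : n →₀ A) : Finsupp.mapRange.linearMap (A.act (e.symm t)⁻¹)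
        (Finsupp.mapRange.linearMap (A.act (e.symm t)) η) = η := by ext; simp
    rw [slice_orbitEmb, mapRange_inv, Representation.self_inv_apply]
  have : Nonempty J := ⟨e 1⟩
  simp only [orbitAvg, LinearMap.smul_apply, LinearMap.sum_apply, LinearMap.comp_apply,
    summand_eq, Finset.sum_const, Finset.card_univ]
  rw [← Nat.cast_smul_eq_nsmul ℂ, smul_smul, inv_mul_cancel₀ (by simp), one_smul]

theorem orbitAvg_act (g : G) (x : n × J →₀ A) :
    orbitAvg e S (tensorAct A (permRep (translation n e)) g x) = S g (orbitAvg e S x) := by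
  simp only [orbitAvg, LinearMap.smul_apply, LinearMap.sum_apply, LinearMap.comp_apply, map_smul,
    map_sum]
  congr 1
  refine (Equiv.sum_comp (e.permCongr (Equiv.mulLeft g)) _).symm.trans
    (Finset.sum_congr rfl fun t _ => ?_)
  have symm_apply : e.symm (e.permCongr (Equiv.mulLeft g) t) = g * e.symm t := by simp
  rw [symm_apply, map_mul, Module.End.mul_apply]
  congr 2
  ext i
  simp only [Finsupp.mapRange.linearMap_apply, Finsupp.mapRange_apply, slice_apply,
    tensorAct_permRep, translation_apply, symm_apply]
  rw [← Module.End.mul_apply, ← map_mul]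
  simp

theorem orbitEmb_act (g : G) (ξ : n →₀ A) :
    orbitEmb e S (S g ξ) = tensorAct A (permRep (translation n e)) g (orbitEmb e S ξ) := by
  ext ⟨i, t⟩
  rw [orbitEmb_apply, tensorAct_permRep, translation_apply, orbitEmb_apply,
    ← Module.End.mul_apply (A.act g), ← map_mul, ← Module.End.mul_apply (S _) (S g), ← map_mul]
  simp

variable {S}

theorem orbitEmb_freeMul
    (hS : ∀ g ξ a, S g (freeMul A n ξ a) = freeMul A n (S g ξ) (A.act g a)) (ξ : n →₀ A) (a : A) :
    orbitEmb e S (freeMul A n ξ a) = freeMul A (n × J) (orbitEmb e S ξ) a := by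
  ext ⟨i, t⟩
  rw [freeMul_apply, orbitEmb_apply, orbitEmb_apply, hS, freeMul_apply, A.act_mul,
    Representation.self_inv_apply]

theorem row_mapRange_act (g : G) (b x : n →₀ A) :
    row A n (Finsupp.mapRange.linearMap (A.act g) b) x
      = A.act g (row A n b (Finsupp.mapRange.linearMap (A.act g⁻¹) x)) := by
  induction b using Finsupp.induction_linear with
  | zero => simp
  | add b c hb hc => simp only [map_add, LinearMap.add_apply, hb, hc]
  | single i b =>
    rw [Finsupp.mapRange.linearMap_apply, Finsupp.mapRange_single, row_single, row_single,
      A.act_mul, Finsupp.mapRange.linearMap_apply, Finsupp.mapRange_apply,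
      Representation.self_inv_apply]

theorem row_comp_orbitAvg_mem (hrow : ∀ g, ∀ φ ∈ LinearMap.range (row A n),
      A.act g ∘ₗ φ ∘ₗ S g⁻¹ ∈ LinearMap.range (row A n)) (b : n →₀ A) :
    row A n b ∘ₗ orbitAvg e S ∈ LinearMap.range (row A (n × J)) := by
  rw [orbitAvg, LinearMap.comp_smul, ← LinearMap.compRight_apply ℂ, map_sum]
  refine Submodule.smul_mem _ _ (Submodule.sum_mem _ fun t _ => ?_)
  obtain ⟨c, hc⟩ := hrow (e.symm t)⁻¹ (row A n b) ⟨b, rfl⟩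
  refine ⟨Finsupp.mapDomain (fun i => (i, t))
    (Finsupp.mapRange.linearMap (A.act (e.symm t)) c), LinearMap.ext fun x => ?_⟩
  refine (row_mapDomain (Prod.mk_left_injective t) _ x).trans ?_
  rw [row_mapRange_act, hc]
  simp [slice]

theorem free_inClassC [Finite G] (hA : A.HasApproxUnit)
    (hS : ∀ g ξ a, S g (freeMul A n ξ a) = freeMul A n (S g ξ) (A.act g a))
    (hrow : ∀ g, ∀ φ ∈ LinearMap.range (row A n),
      A.act g ∘ₗ φ ∘ₗ S g⁻¹ ∈ LinearMap.range (row A n)) :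
    (free A n S hS hrow).InClassC := by
  obtain ⟨k, ⟨e⟩⟩ := Finite.exists_equiv_fin G
  have orbitEmb_injective : Function.Injective (orbitEmb e S) :=
    Function.LeftInverse.injective (orbitAvg_orbitEmb e S)
  refine inClassC_iff.2 ⟨hA, free_locallyUnital hA,
    n × Fin k, permRep (translation n e), rowFinite_permRep _, ?_⟩
  refine exists_isExtension_of_submodule (E := free A n S hS hrow)
    (P := (LinearMap.range (row A n)).map (LinearMap.lcomp ℂ A (orbitAvg e S)))
    (orbitEmb e S) orbitEmb_injective (orbitEmb_freeMul e hS) (orbitEmb_act e S) ?_ ?_ ?_ ?_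
  · rintro _ ⟨_, ⟨b, rfl⟩, rfl⟩
    exact row_comp_orbitAvg_mem e hrow b
  · have : LinearMap.lcomp ℂ A (orbitEmb e S) ∘ₗ LinearMap.lcomp ℂ A (orbitAvg e S) =
        LinearMap.id :=
      LinearMap.ext fun φ => LinearMap.ext fun ξ => congrArg φ (orbitAvg_orbitEmb e S ξ)
    exact (Submodule.map_comp _ _ _).symm.trans (this ▸ Submodule.map_id _)
  · rintro g _ ⟨φ, hφ, rfl⟩
    exact ⟨_, hrow g φ hφ, LinearMap.ext fun x =>
      congrArg (fun y => A.act g (φ y)) (orbitAvg_act e S g⁻¹ x).symm⟩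
  · intro s hs η
    refine ⟨orbitAvg e S η, fun ψ hψ => ?_⟩
    obtain ⟨φ, -, rfl⟩ := hs hψ
    exact congrArg φ (orbitAvg_orbitEmb e S _)

end FiniteGroup

section DirectSum

variable {I : Type u} {E F : I → FunctionalModule A}

/-- The functional on `⨁ i, E i` given by a functional on one summand; these span the functional
space of the direct sum. -/
noncomputable def summandFunctional (E : I → FunctionalModule A) (j : Σ i, (E i).functionals) :
    (Π₀ i, E i) →ₗ[ℂ] A :=
  j.2.1 ∘ₗ DFinsupp.lapply j.1

theorem directSum_functionals :
    (directSum E).functionals = Submodule.span ℂ (Set.range (summandFunctional E)) := by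
  have iSup_eq_span : (⨆ i, (E i).functionals.map (LinearMap.lcomp ℂ A (DFinsupp.lapply i)) :
      Submodule ℂ ((Π₀ i, E i) →ₗ[ℂ] A)) = Submodule.span ℂ (Set.range (summandFunctional E)) := by
    refine le_antisymm (iSup_le ?_) (Submodule.span_le.2 ?_)
    · rintro i _ ⟨φ, hφ, rfl⟩
      exact Submodule.subset_span ⟨⟨i, φ, hφ⟩, rfl⟩
    · rintro _ ⟨⟨i, φ⟩, rfl⟩
      exact Submodule.mem_iSup_of_mem i ⟨φ.1, φ.2, rfl⟩
  exact iSup_eq_span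

theorem summandFunctional_mem (j : Σ i, (E i).functionals) :
    (show directSum E →ₗ[ℂ] A from summandFunctional E j) ∈ (directSum E).functionals :=
  Submodule.mem_iSup_of_mem (p := fun i => (E i).functionals.map
    (LinearMap.lcomp ℂ A (DFinsupp.lapply (R := ℂ) (M := fun i => E i) i))) j.1 ⟨j.2.1, j.2.2, rfl⟩

theorem span_range_dfinsuppSingle [DecidableEq I] :
    Submodule.span ℂ (Set.range fun p : Σ i, E i =>
      (DFinsupp.single p.1 p.2 : Π₀ i, E i)) = ⊤ := by
  refine top_unique fun ξ _ => ?_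
  induction ξ using DFinsupp.induction with
  | h0 => exact zero_mem _
  | ha i ξ _ _ _ h => exact add_mem (Submodule.subset_span ⟨⟨i, ξ⟩, rfl⟩) (h trivial)

theorem exists_compact_single_apply [DecidableEq I] {i : I} {T : Module.End ℂ (E i)}
    (hT : T ∈ (E i).compactSubalgebra) :
    ∃ R : Module.End ℂ (Π₀ i, E i), R ∈ (directSum E).compactSubalgebra ∧
      ∀ ξ, R ξ = DFinsupp.single i (T (ξ i)) := by
  induction hT using compact_induction with
  | zero => exact ⟨0, zero_mem (directSum E).compactSubalgebra, by simp⟩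
  | add S T _ _ hS hT =>
    obtain ⟨R, hR, R_apply⟩ := hS
    obtain ⟨R', hR', R'_apply⟩ := hT
    exact ⟨R + R', add_mem (S := NonUnitalSubalgebra ℂ (Module.End ℂ (directSum E))) hR hR',
      by simp [R_apply, R'_apply]⟩
  | theta η φ hφ =>
    refine ⟨_, theta_mem_compact (E := directSum E) (DFinsupp.single i η : Π₀ i, E i)
      (summandFunctional_mem (E := E) ⟨i, φ, hφ⟩), fun ξ => ?_⟩
    change DFinsupp.mapRange.linearMap (fun j => (E j).rmul.flip (φ (ξ i)))
      (DFinsupp.single i η) = DFinsupp.single i ((E i).rmul η (φ (ξ i)))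
    simp

open scoped Classical in
theorem exists_compact_directSum_apply {T : ∀ i, Module.End ℂ (E i)}
    (hT : ∀ i, T i ∈ (E i).compactSubalgebra) (s : Finset I) :
    ∃ R : Module.End ℂ (Π₀ i, E i), R ∈ (directSum E).compactSubalgebra ∧
      ∀ ξ i, R ξ i = if i ∈ s then T i (ξ i) else 0 := by
  choose R hR R_apply using fun i => exists_compact_single_apply (hT i)
  refine ⟨∑ i ∈ s, R i, sum_mem (S := (directSum E).compactSubalgebra) fun i _ => hR i,
    fun ξ i => ?_⟩
  simp [R_apply, DFinsupp.finsetSum_apply, DFinsupp.single_apply]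

theorem directSum_locallyUnital (hE : ∀ i, (E i).LocallyUnital) :
    (directSum E).LocallyUnital := by
  classical
  refine .of_span (span_range_dfinsuppSingle (E := E)) directSum_functionals.le (fun t => ?_)
    fun t => ?_
  · choose T hT T_apply using fun i =>
      (hE i).exists_left (t.preimage (Sigma.mk i) sigma_mk_injective.injOn) id
    obtain ⟨R, hR, R_apply⟩ := exists_compact_directSum_apply hT (t.image Sigma.fst)
    refine ⟨R, hR, fun ⟨i, ξ⟩ h => DFinsupp.ext fun j => (R_apply _ j).trans ?_⟩
    obtain rfl | hj := eq_or_ne i j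
    · rw [if_pos (Finset.mem_image_of_mem _ h), DFinsupp.single_eq_same]
      exact T_apply i ξ (by simpa using h)
    · simp [DFinsupp.single_eq_of_ne hj.symm]
  · choose T hT T_comp using fun i =>
      (hE i).exists_right (t.preimage (Sigma.mk i) sigma_mk_injective.injOn) id
    obtain ⟨R, hR, R_apply⟩ := exists_compact_directSum_apply hT (t.image Sigma.fst)
    refine ⟨R, hR, fun ⟨i, φ⟩ h => LinearMap.ext fun (ξ : Π₀ i, E i) => ?_⟩
    change φ.1 (R ξ i) = φ.1 (ξ i)
    rw [R_apply, if_pos (Finset.mem_image_of_mem _ h)]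
    exact LinearMap.congr_fun (T_comp i φ (by simpa using h)) (ξ i)

theorem directSum_exists_isExtension {U : ∀ i, Hom (E i) (F i)} (hU : ∀ i, (U i).IsExtension) :
    ∃ V : Hom (directSum E) (directSum F), V.IsExtension := by
  classical
  let W : (Π₀ i, E i) →ₗ[ℂ] Π₀ i, F i := DFinsupp.mapRange.linearMap fun i => (U i).toFun
  refine exists_isExtension (E := directSum E) (F := directSum F) W
    ((DFinsupp.mapRange_injective _ fun i => map_zero _).2 fun i => (hU i).1)
    (fun ξ a => DFinsupp.ext fun i => (U i).map_rmul _ a)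
    (fun g ξ => DFinsupp.ext fun i => (U i).map_act g _)
    (p := fun j : Σ i, (E i).functionals => summandFunctional F ⟨j.1, (U j.1).dual j.2⟩)
    (fun j => summandFunctional_mem _) ?_ ?_ (span_range_dfinsuppSingle (E := F)) ?_
  · rw [directSum_functionals]
    refine congrArg (fun p => Submodule.span ℂ (Set.range p)) (funext fun j => ?_)
    exact LinearMap.ext fun (ξ : Π₀ i, E i) => ((U j.1).pairing j.2 (ξ j.1)).symm
  · rintro g ⟨i, φ⟩
    refine Submodule.subset_span ⟨⟨i, (E i).dualAct g φ⟩, ?_⟩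
    exact congrArg (fun ψ => summandFunctional F ⟨i, ψ⟩) ((U i).dual_act g φ)
  · rintro t ⟨i, η⟩
    obtain ⟨ξ, hξ⟩ := (hU i).2
      (t.preimage (fun φ => ⟨i, φ⟩) (sigma_mk_injective (β := fun i => (E i).functionals)).injOn) η
    refine ⟨(DFinsupp.single i ξ : Π₀ i, E i), fun ⟨j, φ⟩ h => ?_⟩
    change ((U j).dual φ).1 ((U j).toFun ((DFinsupp.single i ξ : Π₀ i, E i) j)) =
      ((U j).dual φ).1 ((DFinsupp.single i η : Π₀ i, F i) j)
    obtain rfl | hj := eq_or_ne i j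
    · rw [DFinsupp.single_eq_same, DFinsupp.single_eq_same, (U i).pairing]
      exact (hξ φ (by simpa using h)).symm
    · rw [DFinsupp.single_eq_of_ne hj.symm, DFinsupp.single_eq_of_ne hj.symm, map_zero]

end DirectSum

section DirectSumPlain

variable {I : Type u} {n : I → Type u}

/-- The direct sum of the representations `μ i` of `G` on finitely supported functions, as a
representation on the functions on the disjoint union; a direct sum of plain modules is the plain
module of this representation. -/
noncomputable def sigmaRep (μ : ∀ i, Representation ℂ G (n i →₀ ℂ)) :
    Representation ℂ G ((Σ i, n i) →₀ ℂ) where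
  toFun g := (sigmaFinsuppLequivDFinsupp ℂ).symm.conj
    (DFinsupp.mapRange.linearMap fun i => μ i g)
  map_one' := by
    simp [Module.End.one_eq_id, DFinsupp.mapRange.linearMap_id]
  map_mul' g h := by
    rw [Module.End.mul_eq_comp, ← LinearEquiv.conj_comp, ← DFinsupp.mapRange.linearMap_comp]
    simp only [map_mul, Module.End.mul_eq_comp]

theorem sigmaFinsuppLequivDFinsupp_single {M : Type*} [AddCommGroup M] [Module ℂ M]
    [DecidableEq I] (s : Σ i, n i) (x : M) :
    sigmaFinsuppLequivDFinsupp ℂ (Finsupp.single s x) =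
      DFinsupp.single s.1 (Finsupp.single s.2 x) :=
  sigmaFinsuppEquivDFinsupp_single s x

theorem sigmaRep_single [DecidableEq I] (μ : ∀ i, Representation ℂ G (n i →₀ ℂ)) (g : G)
    (s t : Σ i, n i) : sigmaRep μ g (Finsupp.single s 1) t =
      (DFinsupp.single s.1 (μ s.1 g (Finsupp.single s.2 1)) : Π₀ i, n i →₀ ℂ) t.1 t.2 := by
  change DFinsupp.mapRange.linearMap (fun i => μ i g)
    (sigmaFinsuppLequivDFinsupp ℂ (Finsupp.single s 1)) t.1 t.2 = _
  rw [sigmaFinsuppLequivDFinsupp_single, DFinsupp.mapRange.linearMap_apply,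
    DFinsupp.mapRange_single]

theorem rowFinite_sigmaRep {μ : ∀ i, Representation ℂ G (n i →₀ ℂ)} (hμ : ∀ i, RowFinite (μ i)) :
    RowFinite (sigmaRep μ) := by
  classical
  rintro g ⟨i, k⟩
  refine ((hμ i g k).image (Sigma.mk i)).subset ?_
  rintro ⟨j, l⟩ (h : sigmaRep μ g _ _ ≠ 0)
  rw [sigmaRep_single] at h
  obtain rfl | hj := eq_or_ne j i
  · exact ⟨l, by simpa using h, rfl⟩
  · simp [DFinsupp.single_eq_of_ne hj.symm] at h

theorem sigmaFinsuppLequivDFinsupp_symm_act (μ : ∀ i, Representation ℂ G (n i →₀ ℂ)) (g : G) :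
    (sigmaFinsuppLequivDFinsupp ℂ).symm.toLinearMap ∘ₗ
        DFinsupp.mapRange.linearMap (fun i => tensorAct A (μ i) g) =
      tensorAct A (sigmaRep μ) g ∘ₗ (sigmaFinsuppLequivDFinsupp ℂ).symm.toLinearMap := by
  classical
  refine DFinsupp.lhom_ext' fun i => Finsupp.lhom_ext fun k a => ?_
  have symm_single : (sigmaFinsuppLequivDFinsupp ℂ).symm
      (DFinsupp.single i (Finsupp.single k a) : Π₀ i, n i →₀ A) = Finsupp.single ⟨i, k⟩ a :=
    (LinearEquiv.symm_apply_eq _).2 (sigmaFinsuppLequivDFinsupp_single ⟨i, k⟩ a).symm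
  refine Finsupp.ext fun ⟨j, l⟩ => ?_
  simp only [LinearMap.comp_apply, LinearEquiv.coe_coe, DFinsupp.lsingle_apply, symm_single]
  rw [tensorAct_single, sigmaRep_single, DFinsupp.mapRange.linearMap_apply,
    DFinsupp.mapRange_single]
  change (DFinsupp.single i (tensorAct A (μ i) g (Finsupp.single k a)) : Π₀ i, n i →₀ A) j l = _
  obtain rfl | hj := eq_or_ne i j
  · rw [DFinsupp.single_eq_same, DFinsupp.single_eq_same, tensorAct_single]
  · simp [DFinsupp.single_eq_of_ne hj.symm]

theorem map_range_row_sigma :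
    (LinearMap.range (row A (Σ i, n i))).map
        (LinearMap.lcomp ℂ A (sigmaFinsuppLequivDFinsupp ℂ).symm.toLinearMap) =
      ⨆ i, (LinearMap.range (row A (n i))).map (LinearMap.lcomp ℂ A (DFinsupp.lapply i)) := by
  simp only [range_row, Submodule.map_span, ← Set.range_comp, ← Submodule.span_iUnion]
  congr 1
  ext φ
  simp only [Set.mem_iUnion, Set.mem_range, Function.comp_apply]
  have row_comp (i : I) (k : n i) (a : A) : LinearMap.lcomp ℂ A
      (sigmaFinsuppLequivDFinsupp ℂ).symm.toLinearMap (row A _ (Finsupp.single ⟨i, k⟩ a)) =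
      LinearMap.lcomp ℂ A (DFinsupp.lapply i) (row A (n i) (Finsupp.single k a)) :=
    LinearMap.ext fun ξ => by
      change row A _ _ ((sigmaFinsuppLequivDFinsupp ℂ).symm ξ) = row A _ _ (ξ i)
      rw [row_single, row_single]
      rfl
  constructor
  · rintro ⟨⟨⟨i, k⟩, a⟩, rfl⟩
    exact ⟨i, ⟨k, a⟩, (row_comp i k a).symm⟩
  · rintro ⟨i, ⟨k, a⟩, rfl⟩
    exact ⟨⟨⟨i, k⟩, a⟩, row_comp i k a⟩

theorem directSum_plain_embedsInPlain (μ : ∀ i, Representation ℂ G (n i →₀ ℂ))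
    (hμ : ∀ i, RowFinite (μ i)) :
    (directSum fun i => plain A (n i) (μ i) (hμ i)).EmbedsInPlain :=
  ⟨_, sigmaRep μ, rowFinite_sigmaRep hμ, exists_isExtension_of_equiv
    (E := directSum fun i => plain A (n i) (μ i) (hμ i))
    (F := plain A _ (sigmaRep μ) (rowFinite_sigmaRep hμ))
    (show (Π₀ i, n i →₀ A) ≃ₗ[ℂ] ((Σ i, n i) →₀ A) from (sigmaFinsuppLequivDFinsupp ℂ).symm)
    (fun _ _ => Finsupp.ext fun _ => (freeMul_apply _ _ _ _).trans (freeMul_apply _ _ _ _).symm)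
    (fun g => LinearMap.congr_fun (sigmaFinsuppLequivDFinsupp_symm_act μ g)) map_range_row_sigma⟩

theorem directSum_embedsInPlain {E : I → FunctionalModule A} (hE : ∀ i, (E i).EmbedsInPlain) :
    (directSum E).EmbedsInPlain := by
  choose n μ hμ U hU using hE
  obtain ⟨V, hV⟩ := directSum_exists_isExtension hU
  exact hV.embedsInPlain (directSum_plain_embedsInPlain μ hμ)

theorem directSum_inClassC (hA : A.HasApproxUnit) {E : I → FunctionalModule A}
    (hE : ∀ i, (E i).InClassC) : (directSum E).InClassC :=
  inClassC_iff.2 ⟨hA, directSum_locallyUnital fun i => (inClassC_iff.1 (hE i)).2.1,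
    directSum_embedsInPlain fun i => (hE i).exists_extension⟩

end DirectSumPlain

section Change

variable {B : GAlgebra.{u, v} G} {π : A.Hom B} {E F : FunctionalModule A}

theorem changeMk_add_left (ξ η : E) (b : B) :
    changeMk π E (ξ + η) b = changeMk π E ξ b + changeMk π E η b := by
  simp [changeMk, TensorProduct.add_tmul]

theorem changeMk_zero_left (b : B) : changeMk π E 0 b = 0 := by
  simp [changeMk]

theorem changeMk_rmul (ξ : E) (a : A) (b : B) :
    changeMk π E (E.rmul ξ a) b = changeMk π E ξ (π.toFun a * b) :=
  (Submodule.Quotient.eq _).2 (Submodule.subset_span ⟨ξ, a, b, rfl⟩)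

theorem span_range_changeMk :
    Submodule.span ℂ (Set.range fun p : E × B => changeMk π E p.1 p.2) = ⊤ := by
  refine top_unique fun x _ => ?_
  induction x using change_induction with
  | h0 => exact zero_mem _
  | hadd x y hx hy => exact add_mem (hx trivial) (hy trivial)
  | hmk ξ b => exact Submodule.subset_span ⟨(ξ, b), rfl⟩

theorem change_hom_ext {M : Type*} [AddCommMonoid M] [Module ℂ M]
    {f h : ((E ⊗[ℂ] B) ⧸ changeRel π E) →ₗ[ℂ] M}
    (H : ∀ ξ b, f (changeMk π E ξ b) = h (changeMk π E ξ b)) : f = h :=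
  LinearMap.ext_on_range span_range_changeMk fun p => H p.1 p.2

theorem changeFunctional_mem (φ : E.functionals) (c : B) :
    (show change π E →ₗ[ℂ] B from changeFunctional π E φ c) ∈ (change π E).functionals := by
  have h : changeFunctional π E φ c ∈
      Submodule.span ℂ {χ | ∃ φ c, χ = changeFunctional π E φ c} :=
    Submodule.subset_span ⟨φ, c, rfl⟩
  exact h

theorem act_comp_changeFunctional (g : G) (φ : E.functionals) (c : B) :
    B.act g ∘ₗ changeFunctional π E φ c ∘ₗ changeAct π E g⁻¹ =
      changeFunctional π E (E.dualAct g φ) (B.act g c) :=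
  change_hom_ext fun ξ b => by
    simp [changeFunctional_mk, changeAct_mk, dualAct, B.act_mul, π.map_act]

theorem change_functionals {J : Type*} {p : J → E.functionals}
    (hp : Submodule.span ℂ (Set.range p) = ⊤) :
    (change π E).functionals =
      Submodule.span ℂ (Set.range fun j : J × B => changeFunctional π E (p j.1) j.2) := by
  have span_eq : Submodule.span ℂ {χ | ∃ φ c, χ = changeFunctional π E φ c} =
      Submodule.span ℂ (Set.range fun j : J × B => changeFunctional π E (p j.1) j.2) := by
    refine le_antisymm (Submodule.span_le.2 ?_) (Submodule.span_mono ?_)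
    · rintro _ ⟨φ, c, rfl⟩
      let f : E.functionals →ₗ[ℂ] ((E ⊗[ℂ] B) ⧸ changeRel π E) →ₗ[ℂ] B :=
        { toFun := fun φ => changeFunctional π E φ c
          map_add' := fun φ ψ => change_hom_ext fun ξ b => by
            simp [changeFunctional_mk, mul_add, add_mul]
          map_smul' := fun r φ => change_hom_ext fun ξ b => by
            simp [changeFunctional_mk, mul_smul_comm, smul_mul_assoc] }
      have mem_range : f φ ∈ LinearMap.range f := ⟨φ, rfl⟩
      rw [LinearMap.range_eq_map, ← hp, Submodule.map_span, ← Set.range_comp] at mem_range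
      refine Submodule.span_mono ?_ mem_range
      exact Set.range_subset_iff.2 fun j => ⟨(j, c), rfl⟩
    · rintro _ ⟨j, rfl⟩
      exact ⟨_, _, rfl⟩
  exact span_eq

theorem theta_change_apply (η ξ : E) (d b c : B) (φ : E.functionals) :
    (change π E).theta (changeMk π E η d) (changeFunctional π E φ c) (changeMk π E ξ b) =
      changeMk π E η (d * (c * π.toFun (φ.1 ξ) * b)) := by
  refine Eq.trans ?_ (changeMul_mk π E η d _)
  rw [← changeFunctional_mk]
  rfl

/- On finitely many elements, `T ⊗ id` agrees with a compact operator: `θ_{η, φ} ⊗ id` agrees with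
`θ_{η ⊗ e, φ ⊗ e}` as soon as `e` is a unit for the values of `π ∘ φ`. -/
theorem exists_compact_changeMk_apply (hB : B.HasApproxUnit) {T : Module.End ℂ E}
    (hT : T ∈ E.compactSubalgebra) {J : Type*} (t : Finset J) (ξ : J → E) :
    ∃ S ∈ (change π E).compactSubalgebra,
      ∀ j ∈ t, ∀ b, S (changeMk π E (ξ j) b) = changeMk π E (T (ξ j)) b := by
  induction hT using compact_induction with
  | zero => exact ⟨0, zero_mem _, fun j _ b => (changeMk_zero_left b).symm⟩
  | add T T' _ _ hT hT' =>
    obtain ⟨S, hS, S_mk⟩ := hT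
    obtain ⟨S', hS', S'_mk⟩ := hT'
    exact ⟨S + S', add_mem hS hS', fun j hj b =>
      (congrArg₂ (· + ·) (S_mk j hj b) (S'_mk j hj b)).trans (changeMk_add_left _ _ b).symm⟩
  | theta η φ hφ =>
    obtain ⟨e, he⟩ := hB.exists_mul_eq_of_finite t fun j => π.toFun (φ (ξ j))
    refine ⟨_, theta_mem_compact (changeMk π E η e) (changeFunctional_mem ⟨φ, hφ⟩ e),
      fun j hj b => ?_⟩
    rw [theta_change_apply, (he j hj).1, ← mul_assoc, (he j hj).1, theta_apply, changeMk_rmul]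

theorem exists_compact_changeFunctional_comp (hB : B.HasApproxUnit) {T : Module.End ℂ E}
    (hT : T ∈ E.compactSubalgebra) {J : Type*} (t : Finset J) (φ : J → E.functionals) :
    ∃ S ∈ (change π E).compactSubalgebra, ∀ j ∈ t, ∀ c ξ b,
      changeFunctional π E (φ j) c (S (changeMk π E ξ b)) = c * π.toFun ((φ j).1 (T ξ)) * b := by
  induction hT using compact_induction with
  | zero =>
    refine ⟨0, zero_mem _, fun j _ c ξ b => (map_zero (changeFunctional π E (φ j) c)).trans ?_⟩
    simp
  | add T T' _ _ hT hT' =>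
    obtain ⟨S, hS, S_mk⟩ := hT
    obtain ⟨S', hS', S'_mk⟩ := hT'
    refine ⟨S + S', add_mem hS hS', fun j hj c ξ b =>
      (map_add (changeFunctional π E (φ j) c) _ _).trans ?_⟩
    rw [S_mk j hj, S'_mk j hj]
    simp [mul_add, add_mul]
  | theta η ψ hψ =>
    obtain ⟨e, he⟩ := hB.exists_mul_eq_of_finite t fun j => π.toFun ((φ j).1 η)
    refine ⟨_, theta_mem_compact (changeMk π E η e) (changeFunctional_mem ⟨ψ, hψ⟩ e),
      fun j hj c ξ b => ?_⟩
    rw [theta_change_apply, changeFunctional_mk, theta_apply, E.functional_rmul _ (φ j).2, map_mul]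
    calc c * π.toFun ((φ j).1 η) * (e * (e * π.toFun (ψ ξ) * b))
        = c * (π.toFun ((φ j).1 η) * e * e) * π.toFun (ψ ξ) * b := by simp only [mul_assoc]
      _ = c * (π.toFun ((φ j).1 η) * π.toFun (ψ ξ)) * b := by
        rw [(he j hj).2, (he j hj).2]; simp only [mul_assoc]

theorem change_locallyUnital (hB : B.HasApproxUnit) (hE : E.LocallyUnital) :
    (change π E).LocallyUnital := by
  refine .of_span span_range_changeMk (change_functionals (p := id) (by simp)).le (fun t => ?_)
    fun t => ?_
  · obtain ⟨T, hT, T_fix⟩ := hE.exists_left t Prod.fst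
    obtain ⟨S, hS, S_mk⟩ := exists_compact_changeMk_apply (π := π) hB hT t Prod.fst
    exact ⟨S, hS, fun j hj => (S_mk j hj j.2).trans (by rw [T_fix j hj])⟩
  · obtain ⟨T, hT, T_fix⟩ := hE.exists_right t Prod.fst
    obtain ⟨S, hS, S_mk⟩ := exists_compact_changeFunctional_comp (π := π) hB hT t Prod.fst
    refine ⟨S, hS, fun j hj => change_hom_ext fun ξ b => (S_mk j hj _ _ _).trans ?_⟩
    rw [← LinearMap.comp_apply, T_fix j hj]
    exact (changeFunctional_mk π E j.1 j.2 ξ b).symm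

/-- The linear map out of `E ⊗_π B` induced by a `π`-balanced bilinear map. -/
noncomputable def changeLift {M : Type*} [AddCommGroup M] [Module ℂ M] (f : E →ₗ[ℂ] B →ₗ[ℂ] M)
    (hf : ∀ ξ a b, f (E.rmul ξ a) b = f ξ (π.toFun a * b)) :
    ((E ⊗[ℂ] B) ⧸ changeRel π E) →ₗ[ℂ] M :=
  (changeRel π E).liftQ (TensorProduct.lift f) <| Submodule.span_le.2 <| by
    rintro _ ⟨ξ, a, b, rfl⟩
    simp [hf]

theorem changeLift_mk {M : Type*} [AddCommGroup M] [Module ℂ M] (f : E →ₗ[ℂ] B →ₗ[ℂ] M)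
    (hf : ∀ ξ a b, f (E.rmul ξ a) b = f ξ (π.toFun a * b)) (ξ : E) (b : B) :
    changeLift f hf (changeMk π E ξ b) = f ξ b :=
  ((changeRel π E).liftQ_apply _ _).trans (TensorProduct.lift.tmul ξ b)

/-- The map `U ⊗ id : E ⊗_π B → F ⊗_π B` induced by a homomorphism `U`. -/
noncomputable def changeMap (π : A.Hom B) (U : Hom E F) :
    ((E ⊗[ℂ] B) ⧸ changeRel π E) →ₗ[ℂ] (F ⊗[ℂ] B) ⧸ changeRel π F :=
  changeLift ((TensorProduct.mk ℂ F B).compr₂ (changeRel π F).mkQ ∘ₗ U.toFun) fun ξ a b =>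
    (congrArg (changeMk π F · b) (U.map_rmul ξ a)).trans (changeMk_rmul _ a b)

theorem changeMap_mk (U : Hom E F) (ξ : E) (b : B) :
    changeMap π U (changeMk π E ξ b) = changeMk π F (U.toFun ξ) b :=
  changeLift_mk _ _ ξ b

theorem changeMap_changeMul (U : Hom E F) (x : (E ⊗[ℂ] B) ⧸ changeRel π E) (c : B) :
    changeMap π U (changeMul π E x c) = changeMul π F (changeMap π U x) c := by
  refine LinearMap.congr_fun (f := changeMap π U ∘ₗ (changeMul π E).flip c)
    (g := (changeMul π F).flip c ∘ₗ changeMap π U) (change_hom_ext fun ξ b => ?_) x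
  simp only [LinearMap.comp_apply, LinearMap.flip_apply, changeMul_mk, changeMap_mk]

theorem changeMap_changeAct (U : Hom E F) (g : G) (x : (E ⊗[ℂ] B) ⧸ changeRel π E) :
    changeMap π U (changeAct π E g x) = changeAct π F g (changeMap π U x) := by
  refine LinearMap.congr_fun (f := changeMap π U ∘ₗ changeAct π E g)
    (g := changeAct π F g ∘ₗ changeMap π U) (change_hom_ext fun ξ b => ?_) x
  simp only [LinearMap.comp_apply, changeAct_mk, changeMap_mk, U.map_act]

theorem changeFunctional_comp_changeMap (U : Hom E F) (φ : E.functionals) (c : B) :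
    changeFunctional π F (U.dual φ) c ∘ₗ changeMap π U = changeFunctional π E φ c :=
  change_hom_ext fun ξ b => by
    rw [LinearMap.comp_apply, changeMap_mk, changeFunctional_mk, changeFunctional_mk, U.pairing]

theorem change_exists_isExtension (hB : B.HasApproxUnit) (hE : E.LocallyUnital) {U : Hom E F}
    (hU : U.IsExtension) : ∃ V : Hom (change π E) (change π F), V.IsExtension := by
  classical
  have hspan : (change π E).functionals = Submodule.span ℂ (Set.range
      fun j : E.functionals × B => changeFunctional π F (U.dual j.1) j.2 ∘ₗ changeMap π U) := by
    rw [change_functionals (p := id) (by simp)]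
    exact congrArg (fun p => Submodule.span ℂ (Set.range p))
      (funext fun j => (changeFunctional_comp_changeMap U j.1 j.2).symm)
  refine exists_isExtension (E := change π E) (F := change π F) (changeMap π U)
    ((change_locallyUnital hB hE).injective_of_functionals (F := change π F) _ hspan)
    (changeMap_changeMul U) (changeMap_changeAct U)
    (fun j => changeFunctional_mem _ _) hspan ?_ span_range_changeMk ?_
  · rintro g ⟨φ, c⟩
    refine Submodule.subset_span ⟨(E.dualAct g φ, B.act g c), ?_⟩
    exact (congrArg (changeFunctional π F · _) (U.dual_act g φ)).trans
      (act_comp_changeFunctional g _ c).symm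
  · rintro t ⟨η, b⟩
    obtain ⟨ξ, hξ⟩ := hU.2 (t.image Prod.fst) η
    refine ⟨changeMk π E ξ b, fun ⟨φ, c⟩ hj => ?_⟩
    calc changeFunctional π F (U.dual φ) c (changeMap π U (changeMk π E ξ b))
        = c * π.toFun (φ.1 ξ) * b :=
          (LinearMap.congr_fun (changeFunctional_comp_changeMap U φ c) _).trans
            (changeFunctional_mk ..)
      _ = c * π.toFun ((U.dual φ).1 η) * b := by rw [hξ φ (Finset.mem_image_of_mem _ hj)]
      _ = changeFunctional π F (U.dual φ) c (changeMk π F η b) := (changeFunctional_mk ..).symm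

end Change

section ChangePlain

variable {B : GAlgebra.{u, v} G} (π : A.Hom B) {n : Type u}

theorem act_comp_row_single {μ : Representation ℂ G (n →₀ ℂ)} (hμ : RowFinite μ) (g : G) (i : n)
    (a : A) : A.act g ∘ₗ row A n (Finsupp.single i a) ∘ₗ tensorAct A μ g⁻¹ ∈
      Submodule.span ℂ (Set.range fun j => row A n (Finsupp.single j (A.act g a))) := by
  have expand : A.act g ∘ₗ row A n (Finsupp.single i a) ∘ₗ tensorAct A μ g⁻¹ =
      ∑ j ∈ (hμ g⁻¹ i).toFinset,
        μ g⁻¹ (Finsupp.single j 1) i • row A n (Finsupp.single j (A.act g a)) := by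
    refine LinearMap.ext fun x => ?_
    simp [row_single, tensorAct_apply hμ, A.act_mul, Finset.mul_sum, mul_smul_comm]
  rw [expand]
  exact sum_mem fun j _ => Submodule.smul_mem _ _ (Submodule.subset_span ⟨j, rfl⟩)

/-- The map `A^n → B^n` applying `π` to every coordinate. -/
noncomputable def mapCoeff (n : Type u) : (n →₀ A) →ₗ[ℂ] (n →₀ B) :=
  Finsupp.mapRange.linearMap (π.toFun : A →ₗ[ℂ] B)

theorem mapCoeff_apply (x : n →₀ A) (i : n) : mapCoeff π n x i = π.toFun (x i) := by
  simp [mapCoeff]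

theorem mapCoeff_single (i : n) (a : A) :
    mapCoeff π n (Finsupp.single i a) = Finsupp.single i (π.toFun a) := by
  simp [mapCoeff]

theorem mapCoeff_tensorAct (μ : Representation ℂ G (n →₀ ℂ)) (g : G) (x : n →₀ A) :
    mapCoeff π n (tensorAct A μ g x) = tensorAct B μ g (mapCoeff π n x) := by
  refine LinearMap.congr_fun (f := mapCoeff π n ∘ₗ tensorAct A μ g)
    (g := tensorAct B μ g ∘ₗ mapCoeff π n) (Finsupp.lhom_ext fun j a => Finsupp.ext fun i => ?_) x
  simp only [LinearMap.comp_apply, mapCoeff_apply, mapCoeff_single, tensorAct_single, map_smul,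
    π.map_act]

variable {π}

/-- The map `A^n ⊗_π B → B^n`, `x ⊗ b ↦ π(x) b`. -/
noncomputable def changePlainMap (π : A.Hom B) (μ : Representation ℂ G (n →₀ ℂ))
    (hμ : RowFinite μ) :
    ((plain A n μ hμ ⊗[ℂ] B) ⧸ changeRel π (plain A n μ hμ)) →ₗ[ℂ] (n →₀ B) :=
  changeLift (E := plain A n μ hμ) (freeMul B n ∘ₗ mapCoeff π n) fun (x : n →₀ A) a b =>
    Finsupp.ext fun i => by
      change freeMul B n (mapCoeff π n (freeMul A n x a)) b i =
        freeMul B n (mapCoeff π n x) (π.toFun a * b) i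
      simp only [freeMul_apply, mapCoeff_apply, map_mul, mul_assoc]

variable {μ : Representation ℂ G (n →₀ ℂ)} {hμ : RowFinite μ}

theorem changePlainMap_mk (x : plain A n μ hμ) (b : B) :
    changePlainMap π μ hμ (changeMk π (plain A n μ hμ) x b) = freeMul B n (mapCoeff π n x) b :=
  changeLift_mk (E := plain A n μ hμ) _ _ x b

theorem row_single_changePlainMap (i : n) (d : B) (x : n →₀ A) (b : B) :
    row B n (Finsupp.single i d) (changePlainMap π μ hμ (changeMk π (plain A n μ hμ) x b)) =
      d * (π.toFun (x i) * b) := by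
  refine (congrArg _ (changePlainMap_mk x b)).trans ?_
  rw [row_single, freeMul_apply, mapCoeff_apply]

theorem changePlainMap_changeMul (x) (c : B) :
    changePlainMap π μ hμ (changeMul π (plain A n μ hμ) x c) =
      freeMul B n (changePlainMap π μ hμ x) c := by
  refine LinearMap.congr_fun (f := changePlainMap π μ hμ ∘ₗ (changeMul π _).flip c)
    (g := (freeMul B n).flip c ∘ₗ changePlainMap π μ hμ)
    (change_hom_ext fun y b => Finsupp.ext fun i => ?_) x
  simp only [LinearMap.comp_apply, LinearMap.flip_apply, changeMul_mk, changePlainMap_mk,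
    freeMul_apply, mul_assoc]

theorem changePlainMap_changeAct (g : G) (x) :
    changePlainMap π μ hμ (changeAct π (plain A n μ hμ) g x) =
      tensorAct B μ g (changePlainMap π μ hμ x) := by
  refine LinearMap.congr_fun (f := changePlainMap π μ hμ ∘ₗ changeAct π _ g)
    (g := tensorAct B μ g ∘ₗ changePlainMap π μ hμ) (change_hom_ext fun y b => ?_) x
  simp only [LinearMap.comp_apply, changeAct_mk, changePlainMap_mk, tensorAct_freeMul]
  exact congrArg (fun z => freeMul B n z (B.act g b)) (mapCoeff_tensorAct π μ g y)

theorem change_plain_functionals :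
    (change π (plain A n μ hμ)).functionals = Submodule.span ℂ (Set.range
      fun j : (n × A) × B => row B n (Finsupp.single j.1.1 (j.2 * π.toFun j.1.2)) ∘ₗ
        changePlainMap π μ hμ) := by
  rw [change_functionals (E := plain A n μ hμ) span_range_rangeRestrict_row]
  refine congrArg (fun p => Submodule.span ℂ (Set.range p)) (funext fun j =>
    change_hom_ext fun (x : n →₀ A) b => (changeFunctional_mk ..).trans ?_)
  calc j.2 * π.toFun (row A n (Finsupp.single j.1.1 j.1.2) x) * b
      = j.2 * π.toFun j.1.2 * (π.toFun (x j.1.1) * b) := by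
        rw [row_single, map_mul]; simp only [mul_assoc]
    _ = _ := (row_single_changePlainMap j.1.1 _ x b).symm

theorem change_plain_embedsInPlain (hA : A.HasApproxUnit) (hB : B.HasApproxUnit) :
    (change π (plain A n μ hμ)).EmbedsInPlain := by
  refine ⟨n, μ, hμ, exists_isExtension (E := change π (plain A n μ hμ)) (F := plain B n μ hμ)
    (changePlainMap π μ hμ)
    (LocallyUnital.injective_of_functionals (F := plain B n μ hμ)
      (change_locallyUnital hB (free_locallyUnital hA)) _ change_plain_functionals)
    changePlainMap_changeMul changePlainMap_changeAct (fun j => ⟨_, rfl⟩) change_plain_functionals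
    ?_ (span_range_single (R := ℂ) (n := n) (M := B)) ?_⟩
  · rintro g ⟨⟨i, a⟩, c⟩
    refine Submodule.span_mono ?_ (act_comp_row_single hμ g i (c * π.toFun a))
    rintro _ ⟨j, rfl⟩
    exact ⟨((j, A.act g a), B.act g c), congrArg (fun d => row B n (Finsupp.single j d))
      (by simp only [B.act_mul, π.map_act])⟩
  · classical
    rintro t ⟨k, x⟩
    obtain ⟨e, he⟩ := hA.exists_mul_eq_of_finite t fun j => j.1.2
    refine ⟨changeMk π (plain A n μ hμ) (Finsupp.single k e : n →₀ A) x, fun ⟨⟨i, a⟩, c⟩ hj => ?_⟩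
    refine (row_single_changePlainMap i _ (Finsupp.single k e) x).trans
      (.trans ?_ (row_single n i _ _).symm)
    obtain rfl | hi := eq_or_ne k i
    · rw [Finsupp.single_eq_same, Finsupp.single_eq_same, ← mul_assoc, mul_assoc c, ← map_mul,
        (he _ hj).2]
    · rw [Finsupp.single_eq_of_ne hi.symm, Finsupp.single_eq_of_ne hi.symm, map_zero, zero_mul]

theorem change_inClassC (hB : B.HasApproxUnit) {E : FunctionalModule A} (hE : E.InClassC) :
    (change π E).InClassC := by
  obtain ⟨hA, hE, n, μ, hμ, U, hU⟩ := inClassC_iff.1 hE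
  obtain ⟨V, hV⟩ := change_exists_isExtension (π := π) hB hE hU
  exact inClassC_iff.2 ⟨hB, change_locallyUnital hB hE,
    hV.embedsInPlain (change_plain_embedsInPlain hA hB)⟩

end ChangePlain

section Tensor

variable {B : GAlgebra.{u, v} G}
variable {E E' : FunctionalModule A} {F F' : FunctionalModule B}

theorem tensor_functionals : (E.tensor F).functionals = Submodule.span ℂ
    (Set.range fun j : E.functionals × F.functionals => TensorProduct.map j.1.1 j.2.1) := by
  refine congrArg (Submodule.span ℂ) (Set.ext fun χ => ⟨?_, ?_⟩)
  · rintro ⟨φ, hφ, ψ, hψ, rfl⟩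
    exact ⟨(⟨φ, hφ⟩, ⟨ψ, hψ⟩), rfl⟩
  · rintro ⟨⟨φ, ψ⟩, rfl⟩
    exact ⟨φ.1, φ.2, ψ.1, ψ.2, rfl⟩

theorem map_mem_tensor_functionals (φ : E.functionals) (ψ : F.functionals) :
    (show E.tensor F →ₗ[ℂ] A.tensor B from TensorProduct.map φ.1 ψ.1) ∈
      (E.tensor F).functionals := by
  have mem_span : TensorProduct.map φ.1 ψ.1 ∈ Submodule.span ℂ
      {χ | ∃ φ ∈ E.functionals, ∃ ψ ∈ F.functionals, χ = TensorProduct.map φ ψ} :=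
    Submodule.subset_span ⟨φ.1, φ.2, ψ.1, ψ.2, rfl⟩
  exact mem_span

theorem act_comp_map (g : G) (φ : E.functionals) (ψ : F.functionals) :
    TensorProduct.map (A.act g) (B.act g) ∘ₗ TensorProduct.map φ.1 ψ.1 ∘ₗ
        TensorProduct.map (E.act g⁻¹) (F.act g⁻¹) =
      TensorProduct.map (E.dualAct g φ).1 (F.dualAct g ψ).1 :=
  TensorProduct.ext' fun _ _ => rfl

theorem map_mem_tensor_compact {S : Module.End ℂ E} (hS : S ∈ E.compactSubalgebra)
    {T : Module.End ℂ F} (hT : T ∈ F.compactSubalgebra) :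
    (show Module.End ℂ (E.tensor F) from TensorProduct.map S T) ∈
      (E.tensor F).compactSubalgebra := by
  induction hS using compact_induction with
  | zero => rw [TensorProduct.map_zero_left]; exact zero_mem _
  | add S S' _ _ hS hS' => rw [TensorProduct.map_add_left]; exact add_mem hS hS'
  | theta η φ hφ =>
    induction hT using compact_induction with
    | zero => rw [TensorProduct.map_zero_right]; exact zero_mem _
    | add T T' _ _ hT hT' => rw [TensorProduct.map_add_right]; exact add_mem hT hT'
    | theta ζ ψ hψ =>
      have theta_tmul : TensorProduct.map (E.theta η φ) (F.theta ζ ψ) =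
          (E.tensor F).theta (η ⊗ₜ ζ) (TensorProduct.map φ ψ) :=
        TensorProduct.ext' fun _ _ => rfl
      rw [theta_tmul]
      exact theta_mem_compact _ (map_mem_tensor_functionals ⟨φ, hφ⟩ ⟨ψ, hψ⟩)

theorem tensor_locallyUnital (hE : E.LocallyUnital) (hF : F.LocallyUnital) :
    (E.tensor F).LocallyUnital := by
  refine .of_span (x := fun p : E × F => p.1 ⊗ₜ[ℂ] p.2) span_range_tmul
    tensor_functionals.le (fun t => ?_) (fun t => ?_)
  · obtain ⟨S, hS, S_fix⟩ := hE.exists_left t Prod.fst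
    obtain ⟨T, hT, T_fix⟩ := hF.exists_left t Prod.snd
    exact ⟨_, map_mem_tensor_compact hS hT, fun j hj =>
      congrArg₂ (· ⊗ₜ[ℂ] ·) (S_fix j hj) (T_fix j hj)⟩
  · obtain ⟨S, hS, S_fix⟩ := hE.exists_right t Prod.fst
    obtain ⟨T, hT, T_fix⟩ := hF.exists_right t Prod.snd
    exact ⟨_, map_mem_tensor_compact hS hT, fun j hj =>
      (TensorProduct.map_comp ..).symm.trans
        (congrArg₂ TensorProduct.map (S_fix j hj) (T_fix j hj))⟩

theorem map_map₂_rmul (U : Hom E E') (V : Hom F F') (x : E ⊗[ℂ] F) (c : A ⊗[ℂ] B) :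
    TensorProduct.map U.toFun V.toFun (TensorProduct.map₂ E.rmul F.rmul x c) =
      TensorProduct.map₂ E'.rmul F'.rmul (TensorProduct.map U.toFun V.toFun x) c := by
  have H : (TensorProduct.map₂ E.rmul F.rmul).compr₂ (TensorProduct.map U.toFun V.toFun) =
      TensorProduct.map₂ E'.rmul F'.rmul ∘ₗ TensorProduct.map U.toFun V.toFun :=
    TensorProduct.ext' fun ξ η => TensorProduct.ext' fun a b => by
      simp [U.map_rmul, V.map_rmul]
  exact LinearMap.congr_fun₂ H x c

theorem tensor_exists_isExtension (hE : E.LocallyUnital) (hF : F.LocallyUnital) {U : Hom E E'}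
    (hU : U.IsExtension) {V : Hom F F'} (hV : V.IsExtension) :
    ∃ W : Hom (E.tensor F) (E'.tensor F'), W.IsExtension := by
  classical
  have hspan : (E.tensor F).functionals = Submodule.span ℂ (Set.range
      fun j : E.functionals × F.functionals => TensorProduct.map (U.dual j.1).1 (V.dual j.2).1 ∘ₗ
        TensorProduct.map U.toFun V.toFun) := by
    rw [tensor_functionals]
    exact congrArg (fun p => Submodule.span ℂ (Set.range p)) (funext fun j =>
      TensorProduct.ext' fun ξ η =>
        congrArg₂ (· ⊗ₜ[ℂ] ·) (U.pairing j.1 ξ).symm (V.pairing j.2 η).symm)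
  refine exists_isExtension (E := E.tensor F) (F := E'.tensor F')
    (TensorProduct.map U.toFun V.toFun)
    ((tensor_locallyUnital hE hF).injective_of_functionals (F := E'.tensor F') _ hspan)
    (map_map₂_rmul U V) (fun g => LinearMap.congr_fun (f := TensorProduct.map U.toFun V.toFun ∘ₗ
      TensorProduct.map (E.act g) (F.act g)) (g := TensorProduct.map (E'.act g) (F'.act g) ∘ₗ
      TensorProduct.map U.toFun V.toFun) ?_)
    (fun j => map_mem_tensor_functionals _ _) hspan ?_ span_range_tmul ?_
  · exact TensorProduct.ext' fun ξ η =>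
      congrArg₂ (· ⊗ₜ[ℂ] ·) (U.map_act g ξ) (V.map_act g η)
  · rintro g ⟨φ, ψ⟩
    refine Submodule.subset_span ⟨(E.dualAct g φ, F.dualAct g ψ), ?_⟩
    have dual_eq : TensorProduct.map (U.dual (E.dualAct g φ)).1 (V.dual (F.dualAct g ψ)).1 =
        TensorProduct.map (A.act g) (B.act g) ∘ₗ TensorProduct.map (U.dual φ).1 (V.dual ψ).1 ∘ₗ
          TensorProduct.map (E'.act g⁻¹) (F'.act g⁻¹) := by
      rw [act_comp_map, U.dual_act, V.dual_act]
    exact dual_eq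
  · rintro t ⟨ξ', η'⟩
    obtain ⟨ξ, hξ⟩ := hU.2 (t.image Prod.fst) ξ'
    obtain ⟨η, hη⟩ := hV.2 (t.image Prod.snd) η'
    refine ⟨ξ ⊗ₜ[ℂ] η, fun ⟨φ, ψ⟩ hj => congrArg₂ (· ⊗ₜ[ℂ] ·) ?_ ?_⟩
    · exact (U.pairing φ ξ).trans (hξ φ (Finset.mem_image_of_mem _ hj)).symm
    · exact (V.pairing ψ η).trans (hη ψ (Finset.mem_image_of_mem _ hj)).symm

end Tensor

section TensorPlain

variable {B : GAlgebra.{u, v} G}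
variable {n m : Type u}

/-- The tensor product `μ ⊗ ν` of linear representations on `ℂ^n` and `ℂ^m`, as a representation on
`ℂ^(n × m)`. -/
noncomputable def prodRep (μ : Representation ℂ G (n →₀ ℂ)) (ν : Representation ℂ G (m →₀ ℂ)) :
    Representation ℂ G (n × m →₀ ℂ) where
  toFun g := (finsuppTensorFinsupp' ℂ n m).toLinearMap ∘ₗ TensorProduct.map (μ g) (ν g) ∘ₗ
    (finsuppTensorFinsupp' ℂ n m).symm.toLinearMap
  map_one' := LinearMap.ext fun x => by simp
  map_mul' g h := LinearMap.ext fun x => by simp [TensorProduct.map_mul]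

variable {μ : Representation ℂ G (n →₀ ℂ)} {ν : Representation ℂ G (m →₀ ℂ)}

theorem prodRep_single (g : G) (j i : n) (l k : m) :
    prodRep μ ν g (Finsupp.single (j, l) 1) (i, k) =
      μ g (Finsupp.single j 1) i * ν g (Finsupp.single l 1) k := by
  have symm_single : (finsuppTensorFinsupp' ℂ n m).symm (Finsupp.single (j, l) 1) =
      Finsupp.single j 1 ⊗ₜ Finsupp.single l 1 := by
    rw [LinearEquiv.symm_apply_eq, finsuppTensorFinsupp'_single_tmul_single, mul_one]
  simp [prodRep, symm_single]

theorem rowFinite_prodRep (hμ : RowFinite μ) (hν : RowFinite ν) : RowFinite (prodRep μ ν) := by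
  rintro g ⟨i, k⟩
  refine ((hμ g i).prod (hν g k)).subset ?_
  rintro ⟨j, l⟩ h
  rw [Set.mem_ofPred_eq, prodRep_single] at h
  exact ⟨left_ne_zero_of_mul h, right_ne_zero_of_mul h⟩

theorem finsuppTensorFinsupp_rmul (x : (n →₀ A) ⊗[ℂ] (m →₀ B)) (c : A ⊗[ℂ] B) :
    finsuppTensorFinsupp ℂ ℂ A B n m (TensorProduct.map₂ (freeMul A n) (freeMul B m) x c) =
      freeMul (A.tensor B) (n × m) (finsuppTensorFinsupp ℂ ℂ A B n m x) c := by
  have H : (TensorProduct.map₂ (freeMul A n) (freeMul B m)).compr₂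
        (finsuppTensorFinsupp ℂ ℂ A B n m).toLinearMap =
      freeMul (A.tensor B) (n × m) ∘ₗ (finsuppTensorFinsupp ℂ ℂ A B n m).toLinearMap :=
    TensorProduct.ext' fun x y => TensorProduct.ext' fun a b => Finsupp.ext fun ⟨i, k⟩ =>
      (finsuppTensorFinsupp_apply ..).trans <|
      (congrArg₂ (· ⊗ₜ[ℂ] ·) (freeMul_apply n x a i) (freeMul_apply m y b k)).trans <|
      (Algebra.TensorProduct.tmul_mul_tmul ..).symm.trans <|
      (congrArg (· * _) (finsuppTensorFinsupp_apply ..).symm).trans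
        (freeMul_apply (A := A.tensor B) ..).symm
  exact LinearMap.congr_fun₂ H x c

theorem finsuppTensorFinsupp_act (g : G) (x : (n →₀ A) ⊗[ℂ] (m →₀ B)) :
    finsuppTensorFinsupp ℂ ℂ A B n m
        (TensorProduct.map (tensorAct A μ g) (tensorAct B ν g) x) =
      tensorAct (A.tensor B) (prodRep μ ν) g (finsuppTensorFinsupp ℂ ℂ A B n m x) := by
  have H : (finsuppTensorFinsupp ℂ ℂ A B n m).toLinearMap ∘ₗ
        TensorProduct.map (tensorAct A μ g) (tensorAct B ν g) =
      tensorAct (A.tensor B) (prodRep μ ν) g ∘ₗ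
        (finsuppTensorFinsupp ℂ ℂ A B n m).toLinearMap := by
    refine TensorProduct.ext (Finsupp.lhom_ext fun j a => Finsupp.lhom_ext fun l b =>
      Finsupp.ext fun ⟨i, k⟩ => ?_)
    have coeff_eq : tensorAct A μ g (Finsupp.single j a) i ⊗ₜ[ℂ]
          tensorAct B ν g (Finsupp.single l b) k =
        prodRep μ ν g (Finsupp.single (j, l) 1) (i, k) • A.act g a ⊗ₜ[ℂ] B.act g b := by
      rw [tensorAct_single, tensorAct_single, prodRep_single, TensorProduct.smul_tmul_smul]
    refine (finsuppTensorFinsupp_apply ..).trans <| coeff_eq.trans <|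
      (tensorAct_single (A := A.tensor B) (prodRep μ ν) g (j, l) (a ⊗ₜ[ℂ] b) (i, k)).symm.trans ?_
    exact congrArg (fun y => tensorAct (A.tensor B) (prodRep μ ν) g y (i, k))
      (finsuppTensorFinsupp_single ..).symm
  exact LinearMap.congr_fun H x

theorem row_finsuppTensorFinsupp (b : n →₀ A) (c : m →₀ B) :
    row (A.tensor B) (n × m) (finsuppTensorFinsupp ℂ ℂ A B n m (b ⊗ₜ[ℂ] c)) ∘ₗ
        (finsuppTensorFinsupp ℂ ℂ A B n m).toLinearMap =
      TensorProduct.map (row A n b) (row B m c) := by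
  refine TensorProduct.ext (Finsupp.lhom_ext fun i x => Finsupp.lhom_ext fun k y => ?_)
  refine (congrArg (row (A.tensor B) (n × m) _) (finsuppTensorFinsupp_single ..)).trans <|
    (row_single_right (A := A.tensor B) ..).trans <|
    (congrArg (fun d : A ⊗[ℂ] B => d * (x ⊗ₜ[ℂ] y)) (finsuppTensorFinsupp_apply ..)).trans <|
    (Algebra.TensorProduct.tmul_mul_tmul ..).trans ?_
  exact congrArg₂ (· ⊗ₜ[ℂ] ·) (row_single_right b i x).symm (row_single_right c k y).symm

theorem map_range_row_prod :
    (LinearMap.range (row (A.tensor B) (n × m))).map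
        (LinearMap.lcomp ℂ (A.tensor B) (finsuppTensorFinsupp ℂ ℂ A B n m).toLinearMap) =
      Submodule.span ℂ {χ | ∃ φ ∈ LinearMap.range (row A n), ∃ ψ ∈ LinearMap.range (row B m),
        χ = TensorProduct.map φ ψ} := by
  let e : (n →₀ A) ⊗[ℂ] (m →₀ B) ≃ₗ[ℂ] (n × m →₀ A.tensor B) := finsuppTensorFinsupp ℂ ℂ A B n m
  have top_eq : (⊤ : Submodule ℂ (n × m →₀ A.tensor B)) =
      Submodule.span ℂ (Set.range fun p : (n →₀ A) × (m →₀ B) => e (p.1 ⊗ₜ[ℂ] p.2)) := by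
    rw [← LinearEquiv.range e, LinearMap.range_eq_map,
      ← span_range_tmul, Submodule.map_span, ← Set.range_comp]
    rfl
  change (LinearMap.range (row (A.tensor B) (n × m))).map
    (LinearMap.lcomp ℂ (A.tensor B) e.toLinearMap) = _
  rw [LinearMap.range_eq_map, top_eq, Submodule.map_span, Submodule.map_span, ← Set.range_comp,
    ← Set.range_comp]
  refine congrArg (Submodule.span ℂ) (Set.ext fun χ => ⟨?_, ?_⟩)
  · rintro ⟨⟨b, c⟩, rfl⟩
    exact ⟨_, ⟨b, rfl⟩, _, ⟨c, rfl⟩, row_finsuppTensorFinsupp b c⟩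
  · rintro ⟨_, ⟨b, rfl⟩, _, ⟨c, rfl⟩, rfl⟩
    exact ⟨(b, c), row_finsuppTensorFinsupp b c⟩

theorem tensor_plain_embedsInPlain (hμ : RowFinite μ) (hν : RowFinite ν) :
    ((plain A n μ hμ).tensor (plain B m ν hν)).EmbedsInPlain :=
  ⟨n × m, prodRep μ ν, rowFinite_prodRep hμ hν, exists_isExtension_of_equiv
    (E := (plain A n μ hμ).tensor (plain B m ν hν)) (F := plain (A.tensor B) (n × m) _ _)
    (finsuppTensorFinsupp ℂ ℂ A B n m) finsuppTensorFinsupp_rmul finsuppTensorFinsupp_act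
    map_range_row_prod⟩

theorem tensor_inClassC {E : FunctionalModule A} {F : FunctionalModule B} (hE : E.InClassC)
    (hF : F.InClassC) : (E.tensor F).InClassC := by
  obtain ⟨hA, hE, n, μ, hμ, U, hU⟩ := inClassC_iff.1 hE
  obtain ⟨hB, hF, m, ν, hν, V, hV⟩ := inClassC_iff.1 hF
  obtain ⟨W, hW⟩ := tensor_exists_isExtension hE hF hU hV
  exact inClassC_iff.2 ⟨hA.tensor hB, tensor_locallyUnital hE hF,
    hW.embedsInPlain (tensor_plain_embedsInPlain hμ hν)⟩

end TensorPlain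

section Prod

variable {E F : FunctionalModule A}

theorem rowFinite_one {n : Type u} : RowFinite (1 : Representation ℂ G (n →₀ ℂ)) := by
  classical
  refine fun g i => (Set.finite_singleton i).subset fun j hj => ?_
  by_contra hij
  exact hj (Finsupp.single_eq_of_ne (Ne.symm hij))

theorem self_embedsInPlain : (self A).EmbedsInPlain := by
  let U : A ≃ₗ[ℂ] (PUnit.{u + 1} →₀ A) := (Finsupp.uniqueLinearEquiv ℂ A PUnit.unit).symm
  have U_apply (x : A) : U x = Finsupp.single PUnit.unit x :=
    Finsupp.uniqueLinearEquiv_symm_apply ..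
  have U_mul (x a : A) : U (x * a) = freeMul A PUnit (U x) a := by
    rw [U_apply, U_apply, freeMul_single]
  have U_act (g : G) (x : A) : U (A.act g x) = tensorAct A 1 g (U x) := by
    refine Finsupp.ext fun i => ?_
    rw [U_apply, U_apply, tensorAct_single]
    simp
  have row_U (b : A) : row A PUnit (U b) ∘ₗ U.toLinearMap = LinearMap.mul ℂ A b :=
    LinearMap.ext fun x => by
      change row A PUnit (U b) (U x) = _
      rw [U_apply, U_apply, row_single, Finsupp.single_eq_same, LinearMap.mul_apply']
  have map_range_row : (LinearMap.range (row A PUnit)).map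
      (LinearMap.lcomp ℂ A U.toLinearMap) = LinearMap.range (LinearMap.mul ℂ A) := by
    rw [← LinearMap.range_comp, ← LinearEquiv.range_comp U]
    exact congrArg LinearMap.range (LinearMap.ext row_U)
  exact ⟨PUnit, 1, rowFinite_one, exists_isExtension_of_equiv (E := self A)
    (F := plain A PUnit 1 rowFinite_one) U U_mul U_act map_range_row⟩

/-- The family consisting of `E` and `F`, whose direct sum is isomorphic to `E ⊕ F`. -/
def pair (E F : FunctionalModule A) (i : ULift.{u} Bool) : FunctionalModule A :=
  cond i.down E F

theorem prod_embedsInPlain (hE : E.EmbedsInPlain) (hF : F.EmbedsInPlain) :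
    (E.prod F).EmbedsInPlain := by
  let M (i : ULift.{u} Bool) := (pair E F i).carrier
  obtain ⟨U, hU⟩ := exists_isExtension_of_equiv (E := E.prod F) (F := directSum (pair E F))
    (boolEquiv ℂ M)
    (fun ξ a => boolEquiv_eq_iff.2
      ⟨congrArg (E.rmul.flip a) (boolEquiv_apply_true ℂ M ξ).symm,
        congrArg (F.rmul.flip a) (boolEquiv_apply_false ℂ M ξ).symm⟩)
    (fun g ξ => boolEquiv_eq_iff.2
      ⟨congrArg (E.act g) (boolEquiv_apply_true ℂ M ξ).symm,
        congrArg (F.act g) (boolEquiv_apply_false ℂ M ξ).symm⟩)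
    (map_iSup_map_lapply_boolEquiv ℂ M fun i => (pair E F i).functionals)
  refine hU.embedsInPlain (directSum_embedsInPlain ?_)
  rintro ⟨_ | _⟩
  exacts [hF, hE]

end Prod

section Linking

variable {E : FunctionalModule A}

/-- Every element of the module is fixed by the right multiplication with some element of the
algebra; this makes `ξ ⊕ b ↦ (η ⊕ c ↦ ξ c ⊕ b c)` an operator in `𝒦_A(E ⊕ A)`. -/
def HasRightUnits (E : FunctionalModule A) : Prop :=
  ∀ ξ : E, ∃ a : A, E.rmul ξ a = ξ

theorem EmbedsInPlain.hasRightUnits (hE : E.EmbedsInPlain) (hA : A.HasApproxUnit) :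
    E.HasRightUnits := fun ξ => by
  obtain ⟨n, μ, hμ, U, hU⟩ := hE
  obtain ⟨e, he⟩ := hA.exists_unit_finsupp (show n →₀ A from U.toFun ξ)
  refine ⟨e, hU.1 ((U.map_rmul ξ e).trans (Finsupp.ext fun i => ?_))⟩
  exact (freeMul_apply n _ e i).trans (he i)

theorem mul_toAlg_mem (E : FunctionalModule A) (b : A) :
    LinearMap.mul ℂ A b ∘ₗ toAlg E ∈ (E.prod (self A)).functionals :=
  snd_mem_prod E (self A) _ (show LinearMap.mul ℂ A b ∈ (self A).functionals from ⟨b, rfl⟩)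

theorem theta_toAlg_mem (hH : (E.prod (self A)).HasRightUnits) (x : E.prod (self A)) :
    (E.prod (self A)).theta x (toAlg E) ∈ (E.prod (self A)).compactSubalgebra := by
  obtain ⟨e, he⟩ := hH x
  convert theta_mem_compact x (mul_toAlg_mem E e) using 1
  refine LinearMap.ext fun y => ?_
  rw [theta_apply, theta_apply, LinearMap.comp_apply, LinearMap.mul_apply', rmul_mul, he]

/-- The embedding `x ↦ (y ↦ x · toAlg y)` of `E ⊕ A` into `𝒦_A(E ⊕ A)`, which identifies `E ⊕ A`
with the left ideal `𝒦_A(E ⊕ A) · M_A`. -/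
noncomputable def linkEmb (hH : (E.prod (self A)).HasRightUnits) :
    E.prod (self A) →ₗ[ℂ] (E.prod (self A)).compact :=
  (LinearMap.lcomp ℂ (E.prod (self A)) (toAlg E) ∘ₗ
    ((E.prod (self A)).rmul)).codRestrict (E.prod (self A)).compactSubalgebra.toSubmodule
      (theta_toAlg_mem hH)

variable (hA : A.HasApproxUnit) (hH : (E.prod (self A)).HasRightUnits)

theorem linkEmb_val_apply (x y : E.prod (self A)) :
    (linkEmb hH x).1 y = (E.prod (self A)).rmul x (toAlg E y) := rfl

theorem linkEmb_injective : Function.Injective (linkEmb hH) := by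
  refine (injective_iff_map_eq_zero (linkEmb hH)).2 fun x hx => ?_
  obtain ⟨e, he⟩ := hH x
  rw [← he]
  exact congrArg (fun k : (E.prod (self A)).compactSubalgebra => k.1 (ofAlg E e)) hx

theorem linkEmb_act (g : G) (x : E.prod (self A)) :
    (E.prod (self A)).compact.act g (linkEmb hH x) = linkEmb hH ((E.prod (self A)).act g x) :=
  Subtype.ext <| LinearMap.ext fun y => by
    change (E.prod (self A)).act g ((E.prod (self A)).rmul x
      (toAlg E ((E.prod (self A)).act g⁻¹ y))) = (E.prod (self A)).rmul _ (toAlg E y)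
    rw [act_rmul, toAlg_act, Representation.self_inv_apply]

theorem mul_linkEmb (k : (E.prod (self A)).compact) (x : E.prod (self A)) :
    k * linkEmb hH x = linkEmb hH (k.1 x) :=
  Subtype.ext <| LinearMap.ext fun y => compact_rmul _ k.1 k.2 x (toAlg E y)

theorem linkEmb_mul_cornerEmb (x : E.prod (self A)) (a : A) :
    linkEmb hH x * cornerEmb hA E a = linkEmb hH ((E.prod (self A)).rmul x a) :=
  Subtype.ext <| LinearMap.ext fun y => by
    exact (E.prod (self A)).rmul_mul x a (toAlg E y)

theorem mul_cornerEmb (k : (E.prod (self A)).compact) (a : A) :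
    k * cornerEmb hA E a = linkEmb hH (k.1 (ofAlg E a)) :=
  Subtype.ext <| LinearMap.ext fun y => by
    change k.1 (ofAlg E (a * toAlg E y)) = _
    rw [ofAlg_mul, compact_rmul _ k.1 k.2, linkEmb_val_apply]

theorem cornerEmb_mul_linkEmb (b : A) (x : E.prod (self A)) :
    cornerEmb hA E b * linkEmb hH x = cornerEmb hA E (b * toAlg E x) :=
  Subtype.ext <| LinearMap.ext fun y => by
    change ofAlg E (b * (toAlg E x * toAlg E y)) = ofAlg E (b * toAlg E x * toAlg E y)
    rw [mul_assoc]

theorem exists_linkEmb_mul_cornerEmb_eq (x : E.prod (self A)) :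
    ∃ e, linkEmb hH x * cornerEmb hA E e = linkEmb hH x :=
  (hH x).imp fun e he => by rw [linkEmb_mul_cornerEmb, he]

theorem span_range_linkEmb_mul :
    Submodule.span ℂ (Set.range fun p : E.prod (self A) × (E.prod (self A)).compact =>
      linkEmb hH p.1 * p.2) = ⊤ := by
  refine Submodule.eq_top_iff'.2 fun ⟨k, hk⟩ => ?_
  induction hk using compact_induction with
  | zero => exact zero_mem _
  | add S T hS hT h h' => exact add_mem h h'
  | theta η τ hτ =>
    obtain ⟨e, he⟩ := hH η
    refine Submodule.subset_span ⟨⟨η, ⟨_, theta_mem_compact (ofAlg E e) hτ⟩⟩,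
      Subtype.ext <| LinearMap.ext fun y => ?_⟩
    change (E.prod (self A)).rmul η (e * τ y) = (E.prod (self A)).rmul η (τ y)
    rw [rmul_mul, he]

/-- The functional `y ↦ b · toAlg (k y)` on `E ⊕ A`, which is `y ↦ m_b k y` under the
identification of `E ⊕ A` with a left ideal of `𝒦_A(E ⊕ A)`. -/
noncomputable def pairFunctional (b : A) (k : (E.prod (self A)).compact) :
    (E.prod (self A)).functionals :=
  ⟨(LinearMap.mul ℂ A b ∘ₗ toAlg E) ∘ₗ k.1, functional_comp_compact (mul_toAlg_mem E b) k.2⟩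

theorem cornerEmb_pairFunctional (b : A) (k : (E.prod (self A)).compact) (x : E.prod (self A)) :
    cornerEmb hA E ((pairFunctional b k).1 x) = cornerEmb hA E b * (k * linkEmb hH x) := by
  rw [mul_linkEmb, cornerEmb_mul_linkEmb]
  rfl

theorem dualAct_pairFunctional (g : G) (b : A) (k : (E.prod (self A)).compact) :
    (E.prod (self A)).dualAct g (pairFunctional b k) =
      pairFunctional (A.act g b) ((E.prod (self A)).compact.act g k) :=
  Subtype.ext <| LinearMap.ext fun _ => A.act_mul g b _

end Linking

section Corner

variable {E : FunctionalModule A} {hA : A.HasApproxUnit}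
  {F : FunctionalModule (E.prod (self A)).compact}

theorem cornerFunctional_mem (b : A) (φ : F.functionals) :
    (show corner hA E F →ₗ[ℂ] A from cornerFunctional hA E F b φ) ∈
      (corner hA E F).functionals :=
  Submodule.subset_span (s := {χ | ∃ b φ, χ = cornerFunctional hA E F b φ}) ⟨b, φ, rfl⟩

theorem corner_functionals : (corner hA E F).functionals = Submodule.span ℂ
    (Set.range fun j : A × F.functionals => cornerFunctional hA E F j.1 j.2) := by
  refine congrArg (Submodule.span ℂ) (Set.ext fun χ => ?_)
  simp [eq_comm]

theorem cornerFunctional_eq_iff {b : A} {φ : F.functionals} {ζ : cornerCarrier hA E F} {a : A} :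
    cornerFunctional hA E F b φ ζ = a ↔ cornerEmb hA E b * φ.1 ζ.1 = cornerEmb hA E a := by
  rw [← cornerFunctional_spec, (cornerEmb_injective hA E).eq_iff]

theorem cornerFunctional_congr (b : A) {φ ψ : F.functionals} {ζ ξ : cornerCarrier hA E F}
    (h : φ.1 ζ.1 = ψ.1 ξ.1) : cornerFunctional hA E F b φ ζ = cornerFunctional hA E F b ψ ξ := by
  rw [cornerFunctional_eq_iff, h, cornerFunctional_spec]

theorem rmul_linkEmb_mem_corner (hH : (E.prod (self A)).HasRightUnits) (ξ : F)
    (x : E.prod (self A)) : F.rmul ξ (linkEmb hH x) ∈ cornerCarrier hA E F := by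
  obtain ⟨e, he⟩ := exists_linkEmb_mul_cornerEmb_eq hA hH x
  rw [← he, F.rmul_mul]
  exact rmul_mem_corner hA E F _ e

theorem span_range_lmul_linkEmb_mul (hH : (E.prod (self A)).HasRightUnits) (hF : F.DualCofull) :
    Submodule.span ℂ (Set.range
      fun p : E.prod (self A) × (E.prod (self A)).compact × F.functionals =>
        F.lmul (linkEmb hH p.1 * p.2.1) p.2.2) = ⊤ := by
  rw [eq_top_iff, ← dualCofull_iff_span_eq_top.1 hF, Submodule.span_le, Set.range_subset_iff]
  rintro ⟨φ, ξ, τ⟩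
  let lmulRight : (E.prod (self A)).compact →ₗ[ℂ] F.functionals :=
    { toFun := fun k => F.lmul k τ
      map_add' := fun k l => Subtype.ext <| LinearMap.ext fun ζ => add_mul k l (τ.1 ζ)
      map_smul' := fun c k => Subtype.ext <| LinearMap.ext fun ζ => smul_mul_assoc c k (τ.1 ζ) }
  have hle := Submodule.map_span lmulRight _ ▸
    Submodule.mem_map_of_mem (f := lmulRight) (span_range_linkEmb_mul hH ▸ Submodule.mem_top :
      φ.1 ξ ∈ _)
  refine Submodule.span_mono ?_ hle
  rintro _ ⟨_, ⟨⟨x, κ⟩, rfl⟩, rfl⟩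
  exact ⟨(x, κ, τ), rfl⟩

/- If `x m_e = x`, then `η (x κ τ) = (η x) (m_e κ τ)` with `η x` in `F · M_A`. -/
theorem exists_compact_corner_theta (hH : (E.prod (self A)).HasRightUnits) (η : F)
    (x : E.prod (self A)) (κ : (E.prod (self A)).compact) (τ : F.functionals) :
    ∃ S : Module.End ℂ (cornerCarrier hA E F), S ∈ (corner hA E F).compactSubalgebra ∧
      ∀ ζ, (S ζ).1 = F.rmul η (linkEmb hH x * κ * τ.1 ζ.1) := by
  obtain ⟨e, he⟩ := exists_linkEmb_mul_cornerEmb_eq hA hH x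
  refine ⟨_, theta_mem_compact (E := corner hA E F) ⟨_, rmul_linkEmb_mem_corner hH η x⟩
    (cornerFunctional_mem e (F.lmul κ τ)), fun ζ => ?_⟩
  change F.rmul (F.rmul η (linkEmb hH x))
    (cornerEmb hA E (cornerFunctional hA E F e (F.lmul κ τ) ζ)) = _
  rw [cornerFunctional_spec, ← F.rmul_mul, ← mul_assoc, he, mul_assoc]
  rfl

theorem exists_compact_corner (hH : (E.prod (self A)).HasRightUnits) (hF : F.DualCofull)
    {T : Module.End ℂ F} (hT : T ∈ F.compactSubalgebra) :
    ∃ S : Module.End ℂ (cornerCarrier hA E F), S ∈ (corner hA E F).compactSubalgebra ∧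
      ∀ ζ, (S ζ).1 = T ζ.1 := by
  let restricting : Submodule ℂ (Module.End ℂ F) :=
    { carrier := {T | ∃ S : Module.End ℂ (cornerCarrier hA E F),
        S ∈ (corner hA E F).compactSubalgebra ∧ ∀ ζ, (S ζ).1 = T ζ.1}
      zero_mem' := ⟨0, zero_mem (corner hA E F).compactSubalgebra, fun _ => rfl⟩
      add_mem' := fun ⟨S, hS, h⟩ ⟨S', hS', h'⟩ =>
        ⟨S + S', add_mem (S := NonUnitalSubalgebra ℂ (Module.End ℂ (corner hA E F))) hS hS',
          fun ζ => congrArg₂ (· + ·) (h ζ) (h' ζ)⟩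
      smul_mem' := fun c T ⟨S, hS, h⟩ =>
        ⟨c • S, (corner hA E F).compactSubalgebra.smul_mem c hS, fun ζ => congrArg (c • ·) (h ζ)⟩ }
  suffices h : T ∈ restricting from h
  induction hT using compact_induction with
  | zero => exact zero_mem _
  | add S T _ _ hS hT => exact add_mem hS hT
  | theta η φ hφ =>
    have hle : ⊤ ≤ restricting.comap
        (LinearMap.llcomp ℂ F _ F (F.rmul η) ∘ₗ F.functionals.subtype) := by
      rw [← span_range_lmul_linkEmb_mul hH hF, Submodule.span_le]
      rintro _ ⟨⟨x, κ, τ⟩, rfl⟩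
      exact exists_compact_corner_theta hH η x κ τ
    exact hle (Submodule.mem_top (x := ⟨φ, hφ⟩))

theorem corner_locallyUnital (hH : (E.prod (self A)).HasRightUnits) (hF : F.LocallyUnital) :
    (corner hA E F).LocallyUnital := by
  have span_id : Submodule.span ℂ (Set.range (id : cornerCarrier hA E F → _)) = ⊤ := by simp
  refine LocallyUnital.of_span (E := corner hA E F) (J := cornerCarrier hA E F)
    (L := A × F.functionals) (x := id) span_id corner_functionals.le (fun t => ?_) fun t => ?_
  · obtain ⟨T, hT, T_apply⟩ := hF.exists_left t Subtype.val
    obtain ⟨S, hS, S_apply⟩ := exists_compact_corner hH hF.dualCofull hT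
    exact ⟨S, hS, fun ζ hζ => Subtype.ext ((S_apply ζ).trans (T_apply ζ hζ))⟩
  · obtain ⟨T, hT, comp_T⟩ := hF.exists_right t Prod.snd
    obtain ⟨S, hS, S_apply⟩ := exists_compact_corner hH hF.dualCofull hT
    refine ⟨S, hS, fun ⟨b, φ⟩ hj => LinearMap.ext fun (ζ : cornerCarrier hA E F) => ?_⟩
    have functional_S_apply : φ.1 (S ζ).1 = φ.1 ζ.1 :=
      (congrArg φ.1 (S_apply ζ)).trans (LinearMap.congr_fun (comp_T _ hj) ζ.1)
    change cornerFunctional hA E F b φ (S ζ) = cornerFunctional hA E F b φ ζ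
    exact cornerFunctional_congr b functional_S_apply

end Corner

section CornerFunctoriality

variable {E : FunctionalModule A} {hA : A.HasApproxUnit}
  {F F' : FunctionalModule (E.prod (self A)).compact}

theorem cornerFunctional_dualAct (g : G) (b : A) (φ : F.functionals) (ζ : cornerCarrier hA E F) :
    cornerFunctional hA E F (A.act g b) (F.dualAct g φ) ζ = A.act g (cornerFunctional hA E F b φ
      ⟨F.act g⁻¹ ζ.1, act_mem_corner hA E F g⁻¹ ζ.1 ζ.2⟩) := by
  apply cornerEmb_injective hA E
  rw [cornerFunctional_spec, ← cornerEmb_act, ← cornerEmb_act, cornerFunctional_spec,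
    GAlgebra.act_mul]
  rfl

theorem Hom.map_mem_corner (V : Hom F F') {ζ : F} (hζ : ζ ∈ cornerCarrier hA E F) :
    V.toFun ζ ∈ cornerCarrier hA E F' := by
  have hle : cornerCarrier hA E F ≤ (cornerCarrier hA E F').comap V.toFun := by
    refine Submodule.span_le.2 ?_
    rintro _ ⟨ξ, a, rfl⟩
    exact Submodule.subset_span ⟨V.toFun ξ, a, V.map_rmul ξ _⟩
  exact hle hζ

theorem span_range_rmul_cornerEmb : Submodule.span ℂ (Set.range fun l : F × A =>
    (⟨F.rmul l.1 (cornerEmb hA E l.2), rmul_mem_corner hA E F l.1 l.2⟩ : cornerCarrier hA E F)) =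
      ⊤ := by
  refine Submodule.map_injective_of_injective (cornerCarrier hA E F).injective_subtype ?_
  rw [Submodule.map_span, ← Set.range_comp, Submodule.map_subtype_top]
  exact congrArg (Submodule.span ℂ) (Set.ext fun ζ => by simp [eq_comm])

theorem Hom.IsExtension.exists_corner {V : Hom F F'} (hV : V.IsExtension) :
    ∃ W : Hom (corner hA E F) (corner hA E F'), W.IsExtension := by
  classical
  let U : cornerCarrier hA E F →ₗ[ℂ] cornerCarrier hA E F' :=
    V.toFun.restrict fun _ => V.map_mem_corner
  let p : A × F.functionals → cornerCarrier hA E F' →ₗ[ℂ] A := fun j =>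
    cornerFunctional hA E F' j.1 (V.dual j.2)
  have p_comp_U (j : A × F.functionals) : p j ∘ₗ U = cornerFunctional hA E F j.1 j.2 :=
    LinearMap.ext fun ζ => by
      change cornerFunctional hA E F' j.1 (V.dual j.2) (U ζ) = _
      rw [cornerFunctional_eq_iff, cornerFunctional_spec]
      exact congrArg (cornerEmb hA E j.1 * ·) (V.pairing j.2 ζ.1)
  have p_act (g : G) (j : A × F.functionals) :
      A.act g ∘ₗ p j ∘ₗ (corner hA E F').act g⁻¹ = p (A.act g j.1, F.dualAct g j.2) :=
    LinearMap.ext fun (ζ : cornerCarrier hA E F') => by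
      change _ = cornerFunctional hA E F' (A.act g j.1) (V.dual (F.dualAct g j.2)) ζ
      rw [V.dual_act]
      exact (cornerFunctional_dualAct g j.1 (V.dual j.2) ζ).symm
  refine exists_isExtension (E := corner hA E F) (F := corner hA E F') (J := A × F.functionals)
    (L := F' × A) U ?_ ?_ ?_ (p := p) ?_ ?_ ?_ span_range_rmul_cornerEmb ?_
  · exact fun ζ ξ h => Subtype.ext (hV.1 (congrArg Subtype.val h))
  · exact fun ξ a => Subtype.ext (V.map_rmul ξ.1 (cornerEmb hA E a))
  · exact fun g ξ => Subtype.ext (V.map_act g ξ.1)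
  · exact fun j => cornerFunctional_mem j.1 (V.dual j.2)
  · exact corner_functionals.trans (congrArg (fun q => Submodule.span ℂ (Set.range q))
      (funext p_comp_U).symm)
  · exact fun g j => Submodule.subset_span ⟨_, (p_act g j).symm⟩
  · rintro t ⟨η, a⟩
    obtain ⟨ξ, hξ⟩ := hV.2 (t.image Prod.snd) η
    refine ⟨⟨F.rmul ξ (cornerEmb hA E a), rmul_mem_corner hA E F ξ a⟩, fun j hj => ?_⟩
    refine cornerFunctional_congr j.1 ?_
    change (V.dual j.2).1 (V.toFun (F.rmul ξ (cornerEmb hA E a))) =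
      (V.dual j.2).1 (F'.rmul η (cornerEmb hA E a))
    rw [V.pairing, F.functional_rmul _ j.2.2, F'.functional_rmul _ (V.dual j.2).2,
      hξ _ (Finset.mem_image_of_mem _ hj)]

end CornerFunctoriality

section Block

variable {n m : Type u}

/-- The coordinates of an element of `A^(n × m)` in the block `{i} × m`. -/
noncomputable def block (A : GAlgebra.{u, v} G) (i : n) : (n × m →₀ A) →ₗ[ℂ] (m →₀ A) :=
  Finsupp.lcomapDomain (Prod.mk i) (Prod.mk_right_injective i)

theorem block_apply (i : n) (x : n × m →₀ A) (k : m) : block A i x k = x (i, k) := rfl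

theorem ext_block {x y : n × m →₀ A} (h : ∀ i, block A i x = block A i y) : x = y :=
  Finsupp.ext fun j => DFunLike.congr_fun (h j.1) j.2

theorem comp_block_mem_range_row {φ : (m →₀ A) →ₗ[ℂ] A} (hφ : φ ∈ LinearMap.range (row A m))
    (i : n) : φ ∘ₗ block A i ∈ LinearMap.range (row A (n × m)) := by
  obtain ⟨b, rfl⟩ := hφ
  exact ⟨b.mapDomain (Prod.mk i), LinearMap.ext (row_mapDomain (Prod.mk_right_injective i) b)⟩

theorem block_single_self (i : n) (k : m) (a : A) :
    block A i (Finsupp.single (i, k) a) = Finsupp.single k a := by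
  refine Finsupp.ext fun l => ?_
  classical simp [block_apply, Finsupp.single_apply]

theorem block_single_of_ne {i j : n} (h : i ≠ j) (k : m) (a : A) :
    block A i (Finsupp.single (j, k) a) = 0 :=
  Finsupp.ext fun _ => Finsupp.single_eq_of_ne fun hp => h (congrArg Prod.fst hp)

theorem block_tensorAct {ν : Representation ℂ G (n →₀ ℂ)} (hν : RowFinite ν)
    (μ : Representation ℂ G (m →₀ ℂ)) (g : G) (i : n) (x : n × m →₀ A) :
    block A i (tensorAct A (prodRep ν μ) g x) = ∑ j ∈ (hν g i).toFinset,
      ν g (Finsupp.single j 1) i • tensorAct A μ g (block A j x) := by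
  classical
  suffices H : block A i ∘ₗ tensorAct A (prodRep ν μ) g = ∑ j ∈ (hν g i).toFinset,
      ν g (Finsupp.single j 1) i • (tensorAct A μ g ∘ₗ block A j) by
    simpa using LinearMap.congr_fun H x
  refine Finsupp.lhom_ext fun ⟨k, l⟩ a => Finsupp.ext fun r => ?_
  rw [LinearMap.sum_apply, Finsupp.finsetSum_apply, Finset.sum_eq_single k]
  · simp [block_apply, block_single_self, tensorAct_single, prodRep_single, mul_smul]
  · intro j _ hj
    simp [block_single_of_ne hj]
  · intro hk
    have coeff_eq_zero : ν g (Finsupp.single k 1) i = 0 := by simpa using hk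
    simp [coeff_eq_zero]

end Block

section CornerPlain

variable {E : FunctionalModule A} {hA : A.HasApproxUnit} {n m : Type u}
  {ν : Representation ℂ G (n →₀ ℂ)} {hν : RowFinite ν}

theorem corner_functionals_of_span {F : FunctionalModule (E.prod (self A)).compact} {J : Type*}
    {p : J → F.functionals} (hp : Submodule.span ℂ (Set.range p) = ⊤) :
    (corner hA E F).functionals = Submodule.span ℂ
      (Set.range fun j : A × J => cornerFunctional hA E F j.1 (p j.2)) := by
  refine corner_functionals.trans (le_antisymm (Submodule.span_le.2 ?_) (Submodule.span_mono ?_))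
  · rintro _ ⟨⟨b, φ⟩, rfl⟩
    let f : F.functionals →ₗ[ℂ] cornerCarrier hA E F →ₗ[ℂ] A :=
      { toFun := cornerFunctional hA E F b
        map_add' := fun φ ψ => LinearMap.ext fun ζ => by
          rw [cornerFunctional_eq_iff, LinearMap.add_apply, map_add, cornerFunctional_spec,
            cornerFunctional_spec, ← mul_add]
          rfl
        map_smul' := fun c φ => LinearMap.ext fun ζ => by
          rw [cornerFunctional_eq_iff, RingHom.id_apply, LinearMap.smul_apply, map_smul,
            cornerFunctional_spec, ← mul_smul_comm]
          rfl }
    have mem_range : f φ ∈ LinearMap.range f := ⟨φ, rfl⟩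
    rw [LinearMap.range_eq_map, ← hp, Submodule.map_span, ← Set.range_comp] at mem_range
    refine Submodule.span_mono ?_ mem_range
    exact Set.range_subset_iff.2 fun j => ⟨(b, j), rfl⟩
  · rintro _ ⟨j, rfl⟩
    exact ⟨(j.1, p j.2), rfl⟩

theorem exists_linkEmb_eq_apply (hH : (E.prod (self A)).HasRightUnits)
    (ζ : cornerCarrier hA E (plain (E.prod (self A)).compact n ν hν)) (i : n) :
    ∃ x, linkEmb hH x = Finsupp.lapply (R := ℂ) (M := (E.prod (self A)).compact) i ζ.1 := by
  have hle : cornerCarrier hA E (plain (E.prod (self A)).compact n ν hν) ≤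
      (LinearMap.range (linkEmb hH)).comap
        (Finsupp.lapply (R := ℂ) (M := (E.prod (self A)).compact) i) := by
    refine Submodule.span_le.2 ?_
    rintro _ ⟨ξ, a, rfl⟩
    exact ⟨_, ((freeMul_apply n ξ _ i).trans (mul_cornerEmb hA hH _ a)).symm⟩
  exact hle ζ.2

/-- The map `F · M_A → A^(n × m)`, for `F = K^n` and `K = 𝒦_A(E ⊕ A)`, which applies a map
`K → A^m` to every coordinate. -/
noncomputable def cornerCoord (hA : A.HasApproxUnit) (hν : RowFinite ν)
    (q : (E.prod (self A)).compact →ₗ[ℂ] m →₀ A) :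
    cornerCarrier hA E (plain (E.prod (self A)).compact n ν hν) →ₗ[ℂ] (n × m →₀ A) :=
  (Finsupp.curryLinearEquiv ℂ).symm.toLinearMap ∘ₗ Finsupp.mapRange.linearMap q ∘ₗ
    (cornerCarrier hA E (plain (E.prod (self A)).compact n ν hν)).subtype

theorem block_cornerCoord (q : (E.prod (self A)).compact →ₗ[ℂ] m →₀ A)
    (ζ : cornerCarrier hA E (plain (E.prod (self A)).compact n ν hν)) (i : n) :
    block A i (cornerCoord hA hν q ζ) =
      q (Finsupp.lapply (R := ℂ) (M := (E.prod (self A)).compact) i ζ.1) :=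
  Finsupp.ext fun _ => rfl

variable {μ : Representation ℂ G (m →₀ ℂ)} {hμ : RowFinite μ}
  {V : Hom (E.prod (self A)) (plain A m μ hμ)} {hH : (E.prod (self A)).HasRightUnits}
  {q : (E.prod (self A)).compact →ₗ[ℂ] m →₀ A}

theorem cornerCoord_rmul (hq : ∀ x, q (linkEmb hH x) = V.toFun x)
    (ζ : cornerCarrier hA E (plain (E.prod (self A)).compact n ν hν)) (a : A) :
    cornerCoord hA hν q ((corner hA E _).rmul ζ a) =
      freeMul A (n × m) (cornerCoord hA hν q ζ) a := by
  refine ext_block fun i => ?_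
  obtain ⟨x, hx⟩ := exists_linkEmb_eq_apply hH ζ i
  have block_freeMul : block A i (freeMul A (n × m) (cornerCoord hA hν q ζ) a) =
      freeMul A m (block A i (cornerCoord hA hν q ζ)) a :=
    Finsupp.ext fun k => (freeMul_apply _ _ a (i, k)).trans (freeMul_apply _ _ a k).symm
  rw [block_freeMul, block_cornerCoord, ← hx, hq]
  refine (block_cornerCoord q _ i).trans (Eq.trans (congrArg q ?_)
    ((hq ((E.prod (self A)).rmul x a)).trans (V.map_rmul x a)))
  rw [← linkEmb_mul_cornerEmb hA hH x a, hx]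
  exact freeMul_apply n _ (cornerEmb hA E a) i

theorem cornerCoord_act (hq : ∀ x, q (linkEmb hH x) = V.toFun x) (g : G)
    (ζ : cornerCarrier hA E (plain (E.prod (self A)).compact n ν hν)) :
    cornerCoord hA hν q ((corner hA E _).act g ζ) =
      tensorAct A (prodRep ν μ) g (cornerCoord hA hν q ζ) := by
  refine ext_block fun i => ?_
  have q_act (j : n) :
      q ((E.prod (self A)).compact.act g
        (Finsupp.lapply (R := ℂ) (M := (E.prod (self A)).compact) j ζ.1)) =
      tensorAct A μ g (block A j (cornerCoord hA hν q ζ)) := by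
    obtain ⟨x, hx⟩ := exists_linkEmb_eq_apply hH ζ j
    rw [block_cornerCoord, ← hx, linkEmb_act, hq, hq]
    exact V.map_act g x
  rw [block_tensorAct hν]
  refine (block_cornerCoord q _ i).trans ((congrArg q (tensorAct_apply hν g _ i)).trans ?_)
  rw [map_sum]
  exact Finset.sum_congr rfl fun j _ => (map_smul q _ _).trans (congrArg _ (q_act j))

/-- The functional `y ↦ V^*(m_b k) (y i)` on `A^(n × m)`, whose restriction along `cornerCoord` is
the functional `m_b φ` on `F · M_A` for the row `φ` with the single entry `k` at `i`. -/
noncomputable def cornerRow (V : Hom (E.prod (self A)) (plain A m μ hμ)) (b : A) (i : n)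
    (k : (E.prod (self A)).compact) : (n × m →₀ A) →ₗ[ℂ] A :=
  (V.dual (pairFunctional b k)).1 ∘ₗ block A i

theorem cornerRow_comp_cornerCoord (hq : ∀ x, q (linkEmb hH x) = V.toFun x) (b : A) (i : n)
    (k : (E.prod (self A)).compact) :
    cornerRow V b i k ∘ₗ cornerCoord hA hν q =
      cornerFunctional hA E (plain (E.prod (self A)).compact n ν hν) b
        ((row (E.prod (self A)).compact n).rangeRestrict (Finsupp.single i k)) := by
  refine LinearMap.ext fun ζ => Eq.symm ?_
  obtain ⟨x, hx⟩ := exists_linkEmb_eq_apply hH ζ i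
  have cornerRow_apply : cornerRow V b i k (cornerCoord hA hν q ζ) = (pairFunctional b k).1 x := by
    refine Eq.trans ?_ (V.pairing (pairFunctional b k) x)
    exact congrArg (V.dual (pairFunctional b k)).1
      ((block_cornerCoord q ζ i).trans ((congrArg q hx.symm).trans (hq x)))
  refine Eq.trans ?_ cornerRow_apply.symm
  refine cornerFunctional_eq_iff.2 (Eq.trans ?_ (cornerEmb_pairFunctional hA hH b k x).symm)
  rw [hx]
  exact congrArg (cornerEmb hA E b * ·) (row_single n i k _)

theorem act_comp_cornerRow (hν : RowFinite ν) (g : G) (b : A) (i : n)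
    (k : (E.prod (self A)).compact) :
    A.act g ∘ₗ cornerRow V b i k ∘ₗ tensorAct A (prodRep ν μ) g⁻¹ =
      ∑ j ∈ (hν g⁻¹ i).toFinset, ν g⁻¹ (Finsupp.single j 1) i •
        cornerRow V (A.act g b) j ((E.prod (self A)).compact.act g k) := by
  refine LinearMap.ext fun y => ?_
  let φ : (m →₀ A) →ₗ[ℂ] A := (V.dual (pairFunctional b k)).1
  have act_comp_φ (z : m →₀ A) : A.act g (φ (tensorAct A μ g⁻¹ z)) =
      (V.dual (pairFunctional (A.act g b) ((E.prod (self A)).compact.act g k))).1 z := by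
    rw [← dualAct_pairFunctional, V.dual_act]
    rfl
  change A.act g (φ (block A i (tensorAct A (prodRep ν μ) g⁻¹ y))) = _
  simp only [block_tensorAct hν, map_sum, map_smul, act_comp_φ, LinearMap.sum_apply,
    LinearMap.smul_apply]
  rfl

theorem single_linkEmb_mem_corner (hH : (E.prod (self A)).HasRightUnits) (i : n)
    (x : E.prod (self A)) :
    (Finsupp.single i (linkEmb hH x) : n →₀ (E.prod (self A)).compact) ∈
      cornerCarrier hA E (plain (E.prod (self A)).compact n ν hν) := by
  obtain ⟨e, he⟩ := exists_linkEmb_mul_cornerEmb_eq hA hH x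
  refine Submodule.subset_span ⟨Finsupp.single i (linkEmb hH x), e, ?_⟩
  refine Eq.trans ?_ (freeMul_single i (linkEmb hH x) (cornerEmb hA E e)).symm
  rw [he]

theorem exists_cornerRow_cornerCoord_eq (hV : V.IsExtension)
    (hq : ∀ x, q (linkEmb hH x) = V.toFun x) (t : Finset (A × n × (E.prod (self A)).compact))
    (l : (n × m) × A) :
    ∃ ζ : cornerCarrier hA E (plain (E.prod (self A)).compact n ν hν), ∀ j ∈ t,
      cornerRow V j.1 j.2.1 j.2.2 (cornerCoord hA hν q ζ) =
        cornerRow V j.1 j.2.1 j.2.2 (Finsupp.single l.1 l.2) := by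
  classical
  obtain ⟨⟨i, k⟩, a⟩ := l
  obtain ⟨x, hx⟩ := hV.2 (t.image fun j => pairFunctional j.1 j.2.2) (Finsupp.single k a)
  refine ⟨⟨_, single_linkEmb_mem_corner hH i x⟩, fun ⟨b, i', κ⟩ hj => ?_⟩
  let φ : (m →₀ A) →ₗ[ℂ] A := (V.dual (pairFunctional b κ)).1
  change φ (block A i' _) = φ (block A i' _)
  rw [block_cornerCoord]
  obtain rfl | hne := eq_or_ne i' i
  · rw [block_single_self]
    refine Eq.trans ?_ (hx _ (Finset.mem_image_of_mem _ hj)).symm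
    refine Eq.trans (congrArg (φ ∘ₗ q) (Finsupp.single_eq_same (a := i'))) ?_
    exact (congrArg φ (hq x)).trans (V.pairing (pairFunctional b κ) x)
  · rw [block_single_of_ne hne]
    exact congrArg φ ((congrArg q (Finsupp.single_eq_of_ne hne)).trans (map_zero q))

theorem corner_plain_embedsInPlain (hA : A.HasApproxUnit) (hE : (E.prod (self A)).EmbedsInPlain)
    (hK : (E.prod (self A)).compact.HasApproxUnit) (hν : RowFinite ν) :
    (corner hA E (plain (E.prod (self A)).compact n ν hν)).EmbedsInPlain := by
  have hH := hE.hasRightUnits hA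
  obtain ⟨m, μ, hμ, V, hV⟩ := hE
  obtain ⟨p, hp⟩ := (linkEmb hH).exists_leftInverse_of_injective
    (LinearMap.ker_eq_bot.2 (linkEmb_injective hH))
  let q : (E.prod (self A)).compact →ₗ[ℂ] m →₀ A := V.toFun ∘ₗ p
  have hq (x : E.prod (self A)) : q (linkEmb hH x) = V.toFun x :=
    congrArg V.toFun (LinearMap.congr_fun hp x)
  have hspan : (corner hA E (plain (E.prod (self A)).compact n ν hν)).functionals =
      Submodule.span ℂ (Set.range fun j : A × n × (E.prod (self A)).compact =>
        cornerRow V j.1 j.2.1 j.2.2 ∘ₗ cornerCoord hA hν q) := by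
    refine (corner_functionals_of_span span_range_rangeRestrict_row).trans ?_
    exact congrArg (fun f => Submodule.span ℂ (Set.range f))
      (funext fun j => (cornerRow_comp_cornerCoord hq j.1 j.2.1 j.2.2).symm)
  refine ⟨n × m, prodRep ν μ, rowFinite_prodRep hν hμ, ?_⟩
  refine exists_isExtension (E := corner hA E (plain (E.prod (self A)).compact n ν hν))
    (F := plain A (n × m) (prodRep ν μ) (rowFinite_prodRep hν hμ))
    (J := A × n × (E.prod (self A)).compact) (L := (n × m) × A) (cornerCoord hA hν q)
    ?_ (cornerCoord_rmul hq) (cornerCoord_act hq) (p := fun j => cornerRow V j.1 j.2.1 j.2.2)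
    ?_ hspan ?_ (y := fun l => Finsupp.single l.1 l.2) ?_ ?_
  · exact LocallyUnital.injective_of_functionals
      (E := corner hA E (plain (E.prod (self A)).compact n ν hν))
      (F := plain A (n × m) (prodRep ν μ) (rowFinite_prodRep hν hμ))
      (corner_locallyUnital hH (free_locallyUnital hK)) _ hspan
  · exact fun j => comp_block_mem_range_row (V.dual (pairFunctional j.1 j.2.2)).2 j.2.1
  · refine fun g j => (act_comp_cornerRow hν g j.1 j.2.1 j.2.2).symm ▸ ?_
    exact sum_mem fun j' _ => Submodule.smul_mem _ _ (Submodule.subset_span ⟨(_, j', _), rfl⟩)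
  · exact span_range_single
  · exact exists_cornerRow_cornerCoord_eq hV hq

end CornerPlain

theorem corner_inClassC {E : FunctionalModule A}
    {F : FunctionalModule (E.prod (self A)).compact} (hE : E.InClassC) (hF : F.InClassC) :
    (corner hE.approxUnit E F).InClassC := by
  have embeds : (E.prod (self A)).EmbedsInPlain :=
    prod_embedsInPlain hE.exists_extension self_embedsInPlain
  obtain ⟨hK, hF_unital, n, ν, hν, V, hV⟩ := inClassC_iff.1 hF
  obtain ⟨W, hW⟩ := hV.exists_corner (hA := hE.approxUnit)
  exact inClassC_iff.2 ⟨hE.approxUnit,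
    corner_locallyUnital (embeds.hasRightUnits hE.approxUnit) hF_unital,
    hW.embedsInPlain (corner_plain_embedsInPlain hE.approxUnit embeds hK hν)⟩

end FunctionalModule

theorem theorem6 {G : Type v} [Group G] :
    -- plain modules
    (∀ (A : GAlgebra.{u, v} G), A.HasApproxUnit →
      ∀ (n : Type u) (μ : Representation ℂ G (n →₀ ℂ)) (hμ : FunctionalModule.RowFinite μ),
        (FunctionalModule.plain A n μ hμ).InClassC) ∧
    -- plain modules with arbitrary actions of a finite group
    (Finite G → ∀ (A : GAlgebra.{u, v} G) (hA : A.HasApproxUnit) (n : Type u)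
      (γ : G →* AddMonoid.End (n →₀ A))
      (hγ : ∀ g ξ a, γ g (FunctionalModule.freeMul A n ξ a)
        = FunctionalModule.freeMul A n (γ g ξ) (A.act g a))
      (hrow : ∀ g, ∀ φ ∈ LinearMap.range (FunctionalModule.row A n),
        A.act g ∘ₗ φ ∘ₗ FunctionalModule.linearAction hA γ hγ g⁻¹
          ∈ LinearMap.range (FunctionalModule.row A n)),
        (FunctionalModule.free A n (FunctionalModule.linearAction hA γ hγ) hγ hrow).InClassC) ∧
    -- direct sums
    (∀ (A : GAlgebra.{u, v} G), A.HasApproxUnit →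
      ∀ (I : Type u) (E : I → FunctionalModule A),
        (∀ i, (E i).InClassC) → (FunctionalModule.directSum E).InClassC) ∧
    -- change of coefficient algebra
    (∀ (A B : GAlgebra.{u, v} G) (π : A.Hom B) (E : FunctionalModule A),
      B.HasApproxUnit → E.InClassC → (E.change π).InClassC) ∧
    -- external tensor products
    (∀ (A B : GAlgebra.{u, v} G) (E : FunctionalModule A) (F : FunctionalModule B),
      E.InClassC → F.InClassC → (E.tensor F).InClassC) ∧
    -- corner modules
    (∀ (A : GAlgebra.{u, v} G) (E : FunctionalModule A)
      (F : FunctionalModule (E.prod (FunctionalModule.self A)).compact)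
      (hE : E.InClassC), F.InClassC →
        (FunctionalModule.corner hE.approxUnit E F).InClassC) :=
  ⟨fun _ hA _ μ hμ => FunctionalModule.plain_inClassC hA μ hμ,
    fun _ _ hA _ _ hγ hrow => FunctionalModule.free_inClassC hA hγ hrow,
    fun _ hA _ _ hE => FunctionalModule.directSum_inClassC hA hE,
    fun _ _ _ _ hB hE => FunctionalModule.change_inClassC hB hE,
    fun _ _ _ _ hE hF => FunctionalModule.tensor_inClassC hE hF,
    fun _ _ _ hE hF => FunctionalModule.corner_inClassC hE hF⟩
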